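/- Let $D\subseteq\mathbb{R}^2$ be a bounded, open, connected set with $0\in D$, let $g$ be a positive continuous function on $\partial D$, and let $f:\mathbb{R}^2\to\mathbb{R}$ be continuous with $0<\lambda<f(x)<\Lambda$ for all $x$. For $v:\mathbb{R}^2\setminus D\to[0,\infty)$ put $\Omega(v)=\{x\in\mathbb{R}^2\setminus D: v(x)>0\}$. Call a continuous $v:\mathbb{R}^2\setminus D\to[0,\infty)$ a (viscosity) subsolution if 1. $\Delta v\ge 0$ in $\Omega(v)\setminus\overline D$ in the viscosity sense: if $x\in\Omega(v)\setminus\overline D$, $\varphi$ is $C^2$ near $x$ and $v-\varphi$ has a local maximum at $x$, then $\Delta\varphi(x)\ge 0$; 2. $v\le g$ on $\partial D$; 3. if $x_0\in\partial\Omega(v)\setminus\overline D$ and an open ball $B_s(y)$, $s>0$, with $B_s(y)\cap\Omega(v)=\emptyset$ and $|x_0-y|=s$ is given, then for $\nu=(x_0-y)/s$ and every real $\alpha$ such that $v(x)\le\alpha\langle x-x_0,\nu\rangle^+ + o(|x-x_0|)$ as $x\to x_0$, one has $\alpha\ge\sqrt{f(x_0)}$. Let $\rho>0$ with $D\subseteq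 B_\rho(0)$, let $M>0$, put $$R_0=\inf\Bigl\{R>\rho:\ \frac{M^2}{R^2\ln^2(\rho/R)}<\lambda\Bigr\},\qquad h(x)=M\Bigl(\frac{\ln(|x|/R_0)}{\ln(\rho/R_0)}\Bigr)^+,$$ and assume that $g\le h$ on $\partial D$ (which holds in particular if $g\le M$). Let $$u=\sup\{v:\ v \text{ is a subsolution and } v\le h \text{ on } \mathbb{R}^2\setminus D\}$$ be the largest subsolution. Let $x_0\in\partial\Omega(u)$ and $r>0$ with $B_r(x_0)\cap D=\emptyset$, and let $\tilde u(x)=u(x_0-rx)/r$ for $x\in B_1(0)$ be the normalization of $u$. Then for every connected component $\Gamma$ of $\{x\in B_1(0):\tilde u(x)>0\}$, the boundary $\partial\Gamma$ (taken in $\mathbb{R}^2$) has finite one-dimensional Hausdorff measure: $\mathcal{H}^1(\partial\Gamma)<+\infty$. -/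

import Mathlib

open Set Filter Topology Metric MeasureTheory

/-- The Euclidean plane. -/
abbrev Plane : Type := EuclideanSpace ℝ (Fin 2)

namespace FreeBoundary

/-- Functions on `ℝ² \ D` are represented by total functions `Plane → ℝ` whose values on `D` are
never used. This is the positivity set `Ω(v) = {x ∈ ℝ² \ D : v x > 0}`. -/
def posSet (D : Set Plane) (v : Plane → ℝ) : Set Plane := {x | x ∉ D ∧ 0 < v x}

/-- `Δ v ≥ 0` on `U` in the viscosity sense: every test function that is twice continuously
differentiable near `x ∈ U` and touches `v` from above at `x` (up to an additive constant) has
nonnegative Laplacian at `x`. -/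
def ViscositySubharmonicOn (v : Plane → ℝ) (U : Set Plane) : Prop :=
  ∀ x ∈ U, ∀ φ : Plane → ℝ, ContDiffAt ℝ 2 φ x →
    (∀ᶠ y in 𝓝 x, v y - φ y ≤ v x - φ x) → 0 ≤ Laplacian.laplacian φ x

/-- In a neighbourhood of `x₀`, `v x ≤ α ⟨x - x₀, ν⟩⁺ + o(|x - x₀|)`. -/
def BelowPlane (v : Plane → ℝ) (x₀ ν : Plane) (α : ℝ) : Prop :=
  ∀ ε > 0, ∀ᶠ x in 𝓝 x₀, v x ≤ α * max (inner ℝ (x - x₀) ν) 0 + ε * ‖x - x₀‖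

/-- Viscosity subsolutions of the one-phase free boundary problem
`Δ u = 0` in `Ω(u) \ D`, `u = g` on `∂D`, `u = 0` and `|∇u|² = f` on `∂Ω(u)`. -/
structure IsSubsolution (D : Set Plane) (f g v : Plane → ℝ) : Prop where
  continuousOn : ContinuousOn v Dᶜ
  nonneg : ∀ x ∉ D, 0 ≤ v x
  subharmonic : ViscositySubharmonicOn v (posSet D v \ closure D)
  le_boundary : ∀ x ∈ frontier D, v x ≤ g x
  /-- Free boundary condition: at a free boundary point `x₀` where a ball `B_s(y)` lying outside
  `Ω(v)` is tangent, with `ν = (x₀ - y) / s` the unit normal pointing into `Ω(v)`. -/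
  freeBoundary : ∀ x₀ ∈ frontier (posSet D v) \ closure D, ∀ (y : Plane) (s : ℝ), 0 < s →
    dist x₀ y = s → Disjoint (ball y s) (posSet D v) →
    ∀ α : ℝ, BelowPlane v x₀ (s⁻¹ • (x₀ - y)) α → √(f x₀) ≤ α

/-- The outer radius `R₀` of the barrier:
the infimum of all `R > ρ` with `M² / (R² ln² (ρ / R)) < lam`. -/
noncomputable def barrierRadius (lam ρ M : ℝ) : ℝ :=
  sInf {R : ℝ | ρ < R ∧ M ^ 2 / (R ^ 2 * Real.log (ρ / R) ^ 2) < lam}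

/-- The logarithmic barrier `h(x) = M (ln (|x| / R₀) / ln (ρ / R₀))⁺`, which equals `M` on `∂B_ρ(0)`
and has slope `√lam` on `∂B_{R₀}(0)`. -/
noncomputable def barrier (lam ρ M : ℝ) (x : Plane) : ℝ :=
  M * max (Real.log (‖x‖ / barrierRadius lam ρ M) / Real.log (ρ / barrierRadius lam ρ M)) 0

/-- The largest subsolution below `h`: `u = sup {v : v is a subsolution, v ≤ h on ℝ² \ D}`. -/
noncomputable def largestSubsolution (D : Set Plane) (f g h : Plane → ℝ) (x : Plane) : ℝ :=
  sSup {t : ℝ | ∃ v : Plane → ℝ, IsSubsolution D f g v ∧ (∀ y ∉ D, v y ≤ h y) ∧ v x = t}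

/-- The normalization of `u` that carries `B_r(x₀)` to the unit ball: `x ↦ u (x₀ - r x) / r`. -/
noncomputable def normalize (u : Plane → ℝ) (x₀ : Plane) (r : ℝ) (x : Plane) : ℝ :=
  u (x₀ - r • x) / r

end FreeBoundary

/-!
The largest subsolution `u` is itself a subsolution. Its continuity up to `∂D` needs no regularity
of `D` beyond connectedness: means of the potentials `log (r / |x - y|)`, with the points `y ∈ D`
spread over all distances from a given boundary point, serve as barriers. Comparison with
logarithmic profiles bounds `u` by a multiple of the distance to a free boundary point.

Since `u` is subharmonic, the excess `A_t u - u` of its averages over circles of radius `t` is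
nonnegative. Integrated over a disc of radius `s` on which `u ≤ m`, this excess is at most of order
`m t ^ 2`, because the averaging operator is self-adjoint and can be moved onto a cutoff. Two
counting arguments follow.

* Every small circle about a free boundary point leaves the closure of the positivity set, since
  otherwise harmonic replacement would enlarge `u`. Hence for small `τ` there are about `s / τ`
  points within distance `s` whose distance to the positivity set is exactly `τ`. Near each of
  them the excess is at least of order `τ` at scale `t = 4 τ`, as `u` would otherwise lie under
  a logarithmic profile of slope less than `√lam` touching its free boundary. So the maximum of
  `u` over a disc of radius of order `s` about a free boundary point is at least of order `s`.
* By this nondegeneracy the excess at scale `4 t` is of order `t` on a disc of radius comparable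
  to `t` about each free boundary point. As `m` is of order `s`, there are at most about `s / t`
  free boundary points in a disc of radius `s` with mutual distances at least `t`.

The boundary of the positivity set of the normalization of `u` consists of a rescaled part of the
free boundary and of points of the unit circle.
-/

namespace FreeBoundary

open InnerProductSpace Laplacian

/-! ### The Laplacian and comparison principles -/

section Laplacian

variable {E F : Type*} [NormedAddCommGroup E] [InnerProductSpace ℝ E]
  [NormedAddCommGroup F] [InnerProductSpace ℝ F]

theorem tendsto_add_smul_nhds_zero (x e : E) : Tendsto (fun s : ℝ => x + s • e) (𝓝 0) (𝓝 x) := by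
  have hcont : Continuous fun s : ℝ => x + s • e := by fun_prop
  simpa using hcont.tendsto 0

theorem hasDerivAt_comp_add_smul {G : Type*} [NormedAddCommGroup G] [NormedSpace ℝ G]
    {ψ : E → G} {x e : E} {t : ℝ} (h : DifferentiableAt ℝ ψ (x + t • e)) :
    HasDerivAt (fun s : ℝ => ψ (x + s • e)) (fderiv ℝ ψ (x + t • e) e) t := by
  have hline : HasDerivAt (fun s : ℝ => x + s • e) e t := by
    simpa using ((hasDerivAt_id t).smul_const e).const_add x
  exact h.hasFDerivAt.comp_hasDerivAt t hline

theorem deriv_deriv_comp_add_smul {ψ : E → ℝ} {x : E} (h : ContDiffAt ℝ 2 ψ x) (e : E) :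
    deriv (deriv fun s : ℝ => ψ (x + s • e)) 0 = iteratedFDeriv ℝ 2 ψ x ![e, e] := by
  have hdiff : ∀ᶠ y in 𝓝 x, DifferentiableAt ℝ ψ y := by
    filter_upwards [h.eventually (by simp)] with y hy
    exact hy.differentiableAt (by simp)
  have hfirst : deriv (fun s : ℝ => ψ (x + s • e)) =ᶠ[𝓝 0] fun s => fderiv ℝ ψ (x + s • e) e := by
    filter_upwards [(tendsto_add_smul_nhds_zero x e).eventually hdiff] with s hs
    exact (hasDerivAt_comp_add_smul hs).deriv
  have hsecond : DifferentiableAt ℝ (fderiv ℝ ψ) (x + (0 : ℝ) • e) := by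
    simpa using (h.fderiv_right (m := 1) (by norm_num)).differentiableAt (by simp)
  rw [hfirst.deriv_eq, ((hasDerivAt_comp_add_smul hsecond).clm_apply (hasDerivAt_const 0 e)).deriv,
    iteratedFDeriv_two_apply]
  simp

theorem iteratedFDeriv_two_nonneg_of_isLocalMin {ψ : E → ℝ} {x : E} (h : ContDiffAt ℝ 2 ψ x)
    (hmin : IsLocalMin ψ x) (e : E) : 0 ≤ iteratedFDeriv ℝ 2 ψ x ![e, e] := by
  by_contra! hneg
  rw [← deriv_deriv_comp_add_smul h e] at hneg
  set ℓ : ℝ → ℝ := fun s => ψ (x + s • e) with hℓ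
  have hℓmin : IsLocalMin ℓ 0 := by
    filter_upwards [(tendsto_add_smul_nhds_zero x e).eventually hmin] with s hs
    simpa [hℓ] using hs
  have hℓcont : ContinuousAt ℓ 0 := by
    have hψ : ContinuousAt ψ (x + (0 : ℝ) • e) := by simpa using h.continuousAt
    exact hψ.comp (f := fun s : ℝ => x + s • e) (by fun_prop)
  -- A negative second derivative makes the minimum a maximum too, so `ℓ` is locally constant.
  have hℓmax : IsLocalMax ℓ 0 := isLocalMax_of_deriv_deriv_neg hneg hℓmin.deriv_eq_zero hℓcont
  have hconst : ℓ =ᶠ[𝓝 0] fun _ => ℓ 0 := by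
    filter_upwards [hℓmin, hℓmax] with s h₁ h₂ using le_antisymm h₂ h₁
  have hderiv : deriv ℓ =ᶠ[𝓝 0] fun _ => 0 := by
    filter_upwards [hconst.deriv] with s hs
    rw [hs, deriv_const]
  rw [hderiv.deriv_eq, deriv_const] at hneg
  exact lt_irrefl _ hneg

theorem contDiff_norm_sub_sq {n : WithTop ℕ∞} (c : E) : ContDiff ℝ n fun x : E => ‖x - c‖ ^ 2 :=
  (contDiff_id.sub contDiff_const).norm_sq ℝ

theorem iteratedFDeriv_two_norm_sub_sq (c x e : E) :
    iteratedFDeriv ℝ 2 (fun x : E => ‖x - c‖ ^ 2) x ![e, e] = 2 * ‖e‖ ^ 2 := by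
  have hfderiv : fderiv ℝ (fun x : E => ‖x - c‖ ^ 2) = fun x => (2 : ℝ) • innerSL ℝ (x - c) := by
    funext y
    have hy : HasFDerivAt (fun x : E => ‖x - c‖ ^ 2)
        (2 • (innerSL ℝ (y - c)).comp (ContinuousLinearMap.id ℝ E)) y :=
      ((hasFDerivAt_id y).sub_const c).norm_sq
    rw [hy.fderiv]
    ext z
    simp
  have hinner : HasFDerivAt (fun y => (2 : ℝ) • innerSL ℝ (y - c)) ((2 : ℝ) • innerSL ℝ) x :=
    ((innerSL ℝ).hasFDerivAt.comp x ((hasFDerivAt_id x).sub_const c)).const_smul (2 : ℝ)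
  rw [iteratedFDeriv_two_apply, hfderiv, hinner.fderiv]
  change 2 * inner ℝ e e = 2 * ‖e‖ ^ 2
  rw [real_inner_self_eq_norm_sq]

section FiniteDimensional

variable [FiniteDimensional ℝ E]

theorem laplacian_nonneg_of_isLocalMin {ψ : E → ℝ} {x : E} (h : ContDiffAt ℝ 2 ψ x)
    (hmin : IsLocalMin ψ x) : 0 ≤ Laplacian.laplacian ψ x := by
  rw [laplacian_eq_iteratedFDeriv_stdOrthonormalBasis]
  exact Finset.sum_nonneg fun i _ => iteratedFDeriv_two_nonneg_of_isLocalMin h hmin _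

theorem laplacian_norm_sub_sq (c x : E) :
    Laplacian.laplacian (fun x : E => ‖x - c‖ ^ 2) x = 2 * Module.finrank ℝ E := by
  simp [laplacian_eq_iteratedFDeriv_stdOrthonormalBasis, iteratedFDeriv_two_norm_sub_sq, mul_comm]

theorem continuousAt_laplacian {φ : E → ℝ} {x : E} (hφ : ContDiffAt ℝ 2 φ x) :
    ContinuousAt (Laplacian.laplacian φ) x := by
  rw [laplacian_eq_iteratedFDeriv_stdOrthonormalBasis]
  have hD2 : ContinuousAt (iteratedFDeriv ℝ 2 φ) x :=
    (hφ.iteratedFDeriv_right (m := 0) (i := 2) (by norm_num)).continuousAt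
  exact tendsto_finsetSum _ fun i _ =>
    ((ContinuousMultilinearMap.apply ℝ (fun _ : Fin 2 => E) ℝ _).continuous.tendsto _).comp hD2

variable [FiniteDimensional ℝ F]

theorem laplacian_comp_linearIsometryEquiv (L : F ≃ₗᵢ[ℝ] E) (f : E → ℝ) (z : F) :
    Laplacian.laplacian (f ∘ L) z = Laplacian.laplacian f (L z) := by
  rw [laplacian_eq_iteratedFDeriv_stdOrthonormalBasis,
    laplacian_eq_iteratedFDeriv_orthonormalBasis f ((stdOrthonormalBasis ℝ F).map L)]
  refine Finset.sum_congr rfl fun i _ => ?_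
  have hcomp := L.toContinuousLinearEquiv.iteratedFDerivWithin_comp_right f uniqueDiffOn_univ
    (x := z) (mem_univ _) 2
  simp only [preimage_univ, iteratedFDerivWithin_univ,
    LinearIsometryEquiv.coe_toContinuousLinearEquiv] at hcomp
  rw [hcomp, ContinuousMultilinearMap.compContinuousLinearMap_apply]
  congr 1
  funext j
  fin_cases j <;> simp

theorem harmonicAt_comp_linearIsometryEquiv (L : F ≃ₗᵢ[ℝ] E) {f : E → ℝ} {z : F}
    (h : HarmonicAt f (L z)) : HarmonicAt (f ∘ L) z := by
  refine ⟨h.1.comp z L.contDiff.contDiffAt, ?_⟩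
  filter_upwards [(L.continuous.tendsto z).eventually h.2] with y hy
  rw [laplacian_comp_linearIsometryEquiv, hy, Pi.zero_apply, Pi.zero_apply]

end FiniteDimensional

end Laplacian

/-- The standard isometry between `ℂ` and the Euclidean plane, which transfers Mathlib's results on
harmonic functions of a complex variable. -/
noncomputable def toPlane : ℂ ≃ₗᵢ[ℝ] Plane := Complex.orthonormalBasisOneI.repr

theorem harmonicAt_log_norm_sub {x z : Plane} (h : x ≠ z) :
    HarmonicAt (fun y : Plane => Real.log ‖y - z‖) x := by
  have hℂ : HarmonicAt (fun w : ℂ => Real.log ‖w - toPlane.symm z‖) (toPlane.symm x) := by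
    apply AnalyticAt.harmonicAt_log_norm (f := fun w : ℂ => w - toPlane.symm z)
    · fun_prop
    · simpa [sub_eq_zero] using h
  convert harmonicAt_comp_linearIsometryEquiv toPlane.symm hℂ using 1
  funext y
  simp only [Function.comp_apply, ← map_sub, LinearIsometryEquiv.norm_map]

theorem ViscositySubharmonicOn.mono {v : Plane → ℝ} {U V : Set Plane}
    (h : ViscositySubharmonicOn v U) (hVU : V ⊆ U) : ViscositySubharmonicOn v V :=
  fun x hx => h x (hVU hx)

theorem viscositySubharmonicOn_of_harmonicAt {v : Plane → ℝ} {U : Set Plane}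
    (h : ∀ x ∈ U, HarmonicAt v x) : ViscositySubharmonicOn v U := by
  intro x hx φ hφ hmax
  have hmin : IsLocalMin (φ - v) x := by
    filter_upwards [hmax] with y hy
    simp only [Pi.sub_apply]; linarith
  have hΔ : 0 ≤ Laplacian.laplacian (φ - v) x :=
    laplacian_nonneg_of_isLocalMin (hφ.sub (h x hx).1) hmin
  rwa [hφ.laplacian_sub (h x hx).1, (h x hx).2.self_of_nhds, Pi.zero_apply, sub_zero] at hΔ

theorem ViscositySubharmonicOn.not_isLocalMax_sub_add_norm_sq {v w : Plane → ℝ} {y : Plane}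
    (hv : ViscositySubharmonicOn v {y}) (hw : ContDiffAt ℝ 2 w y)
    (hΔ : Laplacian.laplacian w y ≤ 0) {η : ℝ} (hη : 0 < η) :
    ¬ IsLocalMax (fun z => v z - w z + η * ‖z‖ ^ 2) y := by
  intro hmax
  set q : Plane → ℝ := fun z => ‖z - 0‖ ^ 2 with hq
  have hqC : ContDiffAt ℝ 2 q y := (contDiff_norm_sub_sq (0 : Plane)).contDiffAt
  have hΔq : Laplacian.laplacian (η • q) y = η * 4 := by
    rw [laplacian_smul η hqC, laplacian_norm_sub_sq, finrank_euclideanSpace_fin, smul_eq_mul]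
    norm_num
  have htouch : 0 ≤ Laplacian.laplacian (w - η • q) y := by
    refine hv y rfl _ (hw.sub (hqC.const_smul η)) ?_
    filter_upwards [hmax] with z hz
    simp only [hq, Pi.sub_apply, Pi.smul_apply, smul_eq_mul, sub_zero]
    linarith
  have hsub : Laplacian.laplacian (w - η • q) y = Laplacian.laplacian w y - η * 4 :=
    (hw.laplacian_sub (hqC.const_smul η)).trans (congrArg _ hΔq)
  linarith

theorem ViscositySubharmonicOn.le_of_le_frontier {O : Set Plane} (hO : IsOpen O)
    (hb : Bornology.IsBounded O) {v w : Plane → ℝ} (hv : ContinuousOn v (closure O))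
    (hw : ContinuousOn w (closure O)) (hsub : ViscositySubharmonicOn v {x ∈ O | w x < v x})
    (hw2 : ∀ x ∈ O, ContDiffAt ℝ 2 w x) (hΔ : ∀ x ∈ O, Laplacian.laplacian w x ≤ 0)
    (hfr : ∀ x ∈ frontier O, v x ≤ w x) : ∀ x ∈ closure O, v x ≤ w x := by
  intro x hx
  by_contra! hlt
  have hK : IsCompact (closure O) := hb.isCompact_closure
  obtain ⟨B, hB⟩ := hK.isBounded.exists_norm_le
  -- `η` is so small that `v - w + η ‖·‖ ^ 2` is maximal where `v - w` is positive.
  set η := (v x - w x) / (2 * (B ^ 2 + 1)) with hη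
  have hη0 : 0 < η := div_pos (sub_pos.2 hlt) (by positivity)
  have hηB : η * B ^ 2 < v x - w x := by
    rw [hη, div_mul_eq_mul_div, div_lt_iff₀ (by positivity)]
    nlinarith [sq_nonneg B]
  obtain ⟨y, hy, hymax⟩ := hK.exists_isMaxOn ⟨x, hx⟩
    (f := fun z => v z - w z + η * ‖z‖ ^ 2) (by fun_prop)
  have hpos : w y < v y := by
    have hxy := isMaxOn_iff.1 hymax x hx
    have hyB : ‖y‖ ^ 2 ≤ B ^ 2 := by gcongr; exact hB y hy
    nlinarith [sq_nonneg ‖x‖]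
  have hyO : y ∈ O := by
    by_contra hn
    exact (hfr y (hO.frontier_eq ▸ ⟨hy, hn⟩)).not_gt hpos
  exact (hsub.mono (singleton_subset_iff.2 ⟨hyO, hpos⟩)).not_isLocalMax_sub_add_norm_sq
    (hw2 y hyO) (hΔ y hyO) hη0 (hymax.isLocalMax (mem_of_superset (hO.mem_nhds hyO) subset_closure))

/-! ### The Dirichlet problem on discs -/

section Poisson

open Real

variable {R : ℝ} {φ : ℂ → ℝ} {c w z : ℂ}

theorem poissonKernel_le (hz : z ∈ sphere c R) (hw : w ∈ ball c R) :
    poissonKernel c w z ≤ (R + dist w c) / (R - dist w c) := by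
  rw [poissonKernel_eq_re_herglotzRieszKernel, dist_eq_norm]
  exact re_herglotzRieszKernel_le hz hw

theorem le_poissonKernel (hz : z ∈ sphere c R) (hw : w ∈ ball c R) :
    (R - dist w c) / (R + dist w c) ≤ poissonKernel c w z := by
  rw [poissonKernel_eq_re_herglotzRieszKernel, dist_eq_norm]
  exact le_re_herglotzRieszKernel hz hw

theorem poissonKernel_nonneg (hz : z ∈ sphere c R) (hw : w ∈ ball c R) :
    0 ≤ poissonKernel c w z := by
  have hR : 0 < R := pos_of_mem_ball hw
  exact (div_nonneg (sub_nonneg.2 (mem_ball.1 hw).le) (by positivity)).trans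
    (le_poissonKernel hz hw)

theorem poissonKernel_le_of_le_dist (hz : z ∈ sphere c R) (hw : w ∈ ball c R) {δ : ℝ} (hδ : 0 < δ)
    (hzw : δ ≤ dist z w) : poissonKernel c w z ≤ (R ^ 2 - dist w c ^ 2) / δ ^ 2 := by
  have hnum : 0 ≤ R ^ 2 - dist w c ^ 2 := by
    have := mem_ball.1 hw
    nlinarith [dist_nonneg (x := w) (y := c)]
  rw [poissonKernel_def, sub_sub_sub_cancel_right, ← dist_eq_norm, ← dist_eq_norm, ← dist_eq_norm,
    mem_sphere.1 hz]
  gcongr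

theorem continuousOn_poissonKernel (hw : w ∈ ball c R) :
    ContinuousOn (poissonKernel c w) (sphere c R) := by
  have hden : ∀ z ∈ sphere c R, ‖z - c - (w - c)‖ ^ 2 ≠ 0 := by
    rintro z hz h
    obtain rfl : z = w := by simpa [sub_eq_zero] using h
    exact (mem_ball.1 hw).ne (mem_sphere.1 hz)
  unfold poissonKernel
  fun_prop (disch := assumption)

theorem circleIntegrable_poissonKernel_smul (hφ : ContinuousOn φ (sphere c R)) (hw : w ∈ ball c R) :
    CircleIntegrable (poissonKernel c w • φ) c R :=
  ((continuousOn_poissonKernel hw).smul hφ).circleIntegrable (pos_of_mem_ball hw).le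

/-- The Poisson integral, which extends the boundary values `φ` on the circle of radius `R` about
the origin harmonically to the disc. -/
noncomputable def poissonIntegral (R : ℝ) (φ : ℂ → ℝ) (w : ℂ) : ℝ :=
  circleAverage (poissonKernel 0 w • φ) 0 R

theorem poissonIntegral_const (hw : w ∈ ball 0 R) (a : ℝ) :
    poissonIntegral R (fun _ => a) w = a :=
  HarmonicOnNhd.circleAverage_poissonKernel_smul (f := fun _ => a)
    (fun _ _ => harmonicAt_const a) hw

theorem poissonIntegral_sub_const (hφ : ContinuousOn φ (sphere 0 R)) (hw : w ∈ ball 0 R) (a : ℝ) :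
    poissonIntegral R (fun z => φ z - a) w = poissonIntegral R φ w - a := by
  conv_rhs => rw [← poissonIntegral_const hw a]
  rw [poissonIntegral, poissonIntegral, poissonIntegral,
    ← circleAverage_sub (circleIntegrable_poissonKernel_smul hφ hw)
      (circleIntegrable_poissonKernel_smul continuousOn_const hw)]
  congr 1
  funext z
  simp [mul_sub]

theorem harmonicAt_poissonIntegral (hφ : ContinuousOn φ (sphere 0 R)) (hw : w ∈ ball 0 R) :
    HarmonicAt (poissonIntegral R φ) w := by
  have hR : 0 ≤ R := (pos_of_mem_ball hw).le
  have hanalytic := analyticOnNhd_circleAverage_herglotzRieszKernel_smul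
    (ContinuousOn.circleIntegrable hR (Complex.continuous_ofReal.comp_continuousOn hφ)) w hw
  refine (harmonicAt_congr_nhds ?_).1 hanalytic.harmonicAt_re
  filter_upwards [isOpen_ball.mem_nhds hw] with y hy
  rw [poissonIntegral, poissonKernel_eq_re_herglotzRieszKernel]
  exact re_circleAverage_herglotzRieszKernel_smul (hφ.circleIntegrable hR) hy

-- The Poisson kernel has mass one and, as `w` approaches the circle, is small away from `w`.
theorem abs_poissonIntegral_sub_le (hφ : ContinuousOn φ (sphere 0 R)) {a B ε δ : ℝ}
    (hB : ∀ z ∈ sphere (0 : ℂ) R, |φ z - a| ≤ B) (hε : 0 ≤ ε) (hδ : 0 < δ) (hw : w ∈ ball 0 R)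
    (hnear : ∀ z ∈ sphere (0 : ℂ) R, dist z w < δ → |φ z - a| ≤ ε) :
    |poissonIntegral R φ w - a| ≤ ε + (R ^ 2 - dist w 0 ^ 2) / δ ^ 2 * B := by
  have hR : 0 < R := pos_of_mem_ball hw
  set C := (R ^ 2 - dist w 0 ^ 2) / δ ^ 2 * B
  have hbound : ∀ z ∈ sphere (0 : ℂ) |R|,
      |(poissonKernel 0 w • fun z => φ z - a) z| ≤
        ((poissonKernel 0 w • fun _ => ε) + fun _ => C : ℂ → ℝ) z := fun z hz => by
    rw [abs_of_pos hR] at hz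
    have hP := poissonKernel_nonneg hz hw
    have hB0 : 0 ≤ B := (abs_nonneg _).trans (hB z hz)
    simp only [Pi.smul_apply', Pi.add_apply, Pi.mul_apply, smul_eq_mul, abs_mul, abs_of_nonneg hP]
    rcases lt_or_ge (dist z w) δ with hzw | hzw
    · have hC0 : 0 ≤ C := mul_nonneg
        (div_nonneg (by nlinarith [mem_ball.1 hw, dist_nonneg (x := w) (y := 0)]) (by positivity))
        hB0
      nlinarith [hnear z hz hzw]
    · have hfar : poissonKernel 0 w z * |φ z - a| ≤ C :=
        mul_le_mul (poissonKernel_le_of_le_dist hz hw hδ hzw) (hB z hz) (abs_nonneg _)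
          (hP.trans (poissonKernel_le_of_le_dist hz hw hδ hzw))
      nlinarith
  have hcε := circleIntegrable_poissonKernel_smul (φ := fun _ => ε) continuousOn_const hw
  have hcC : CircleIntegrable (fun _ : ℂ => C) 0 R := continuousOn_const.circleIntegrable hR.le
  calc |poissonIntegral R φ w - a|
      = |circleAverage (poissonKernel 0 w • fun z => φ z - a) 0 R| := by
        rw [← poissonIntegral_sub_const hφ hw, poissonIntegral]
    _ ≤ circleAverage ((poissonKernel 0 w • fun _ : ℂ => ε) + fun _ => C) 0 R :=
        abs_circleAverage_le_circleAverage_abs.trans <| circleAverage_mono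
          ((circleIntegrable_poissonKernel_smul (hφ.sub continuousOn_const) hw).abs)
          (hcε.add hcC) hbound
    _ = ε + C := by
        rw [circleAverage_add hcε hcC, circleAverage_const]
        exact congrArg (· + C) (poissonIntegral_const hw ε)

theorem tendsto_poissonIntegral (hφ : ContinuousOn φ (sphere 0 R)) {ζ : ℂ} (hζ : ζ ∈ sphere 0 R) :
    Tendsto (poissonIntegral R φ) (𝓝[ball 0 R] ζ) (𝓝 (φ ζ)) := by
  obtain ⟨B, hB⟩ := (isCompact_sphere (0 : ℂ) R).exists_bound_of_continuousOn
    (hφ.sub (continuousOn_const (c := φ ζ)))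
  rw [Metric.tendsto_nhds]
  intro ε hε
  obtain ⟨δ, hδ, hnear⟩ := Metric.continuousWithinAt_iff.1 (hφ ζ hζ) (ε / 2) (by positivity)
  have hkernel : Tendsto (fun w : ℂ => (R ^ 2 - dist w 0 ^ 2) / (δ / 2) ^ 2 * B) (𝓝 ζ) (𝓝 0) := by
    have hcont : Continuous fun w : ℂ => (R ^ 2 - dist w 0 ^ 2) / (δ / 2) ^ 2 * B := by fun_prop
    convert hcont.tendsto ζ using 2
    rw [mem_sphere.1 hζ]; ring
  filter_upwards [self_mem_nhdsWithin, nhdsWithin_le_nhds (ball_mem_nhds ζ (half_pos hδ)),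
    nhdsWithin_le_nhds (hkernel.eventually (gt_mem_nhds (half_pos hε)))] with w hw hwζ hwk
  have hle := abs_poissonIntegral_sub_le hφ hB (half_pos hε).le (half_pos hδ) hw fun z hz hzw =>
    (hnear hz ((dist_triangle z w ζ).trans_lt (by linarith [mem_ball.1 hwζ]))).le
  rw [Real.dist_eq]
  linarith

theorem exists_dirichlet_complex (hφ : ContinuousOn φ (sphere 0 R)) :
    ∃ H : ℂ → ℝ, ContinuousOn H (closedBall 0 R) ∧ (∀ w ∈ ball (0 : ℂ) R, HarmonicAt H w) ∧
      EqOn H φ (sphere 0 R) := by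
  classical
  set H : ℂ → ℝ := (ball (0 : ℂ) R).piecewise (poissonIntegral R φ) φ
  have hHball : EqOn H (poissonIntegral R φ) (ball 0 R) := piecewise_eqOn _ _ _
  have hHsphere : EqOn H φ (sphere 0 R) := fun z hz =>
    piecewise_eq_of_notMem _ _ _ fun hzb => (mem_ball.1 hzb).ne (mem_sphere.1 hz)
  have hHharm : ∀ w ∈ ball (0 : ℂ) R, HarmonicAt H w := fun w hw =>
    (harmonicAt_congr_nhds (hHball.eventuallyEq_of_mem (isOpen_ball.mem_nhds hw))).2
      (harmonicAt_poissonIntegral hφ hw)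
  refine ⟨H, fun ζ hζ => ?_, hHharm, hHsphere⟩
  rcases (mem_closedBall.1 hζ).lt_or_eq with hlt | hζs
  · exact (hHharm ζ hlt).1.continuousAt.continuousWithinAt
  rw [← ball_union_sphere]
  refine ContinuousWithinAt.union ?_ ((hφ ζ hζs).congr hHsphere (hHsphere hζs))
  rw [ContinuousWithinAt, hHsphere hζs]
  exact (tendsto_poissonIntegral hφ hζs).congr' (hHball.symm.eventuallyEq_of_mem
    self_mem_nhdsWithin)

end Poisson

theorem harmonicAt_comp_sub {E : Type*} [NormedAddCommGroup E] [InnerProductSpace ℝ E]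
    [FiniteDimensional ℝ E] {f : E → ℝ} {x c : E} (h : HarmonicAt f (x - c)) :
    HarmonicAt (fun y => f (y - c)) x := by
  have hshift : Tendsto (fun y : E => y - c) (𝓝 x) (𝓝 (x - c)) :=
    (continuous_id.sub continuous_const).tendsto x
  refine ⟨h.1.comp x (by fun_prop), ?_⟩
  filter_upwards [hshift.eventually h.2] with y hy
  rw [laplacian_eq_iteratedFDeriv_stdOrthonormalBasis] at hy ⊢
  simpa only [iteratedFDeriv_comp_sub, Pi.zero_apply] using hy

theorem exists_dirichlet (c : Plane) {R : ℝ} {φ : Plane → ℝ} (hφ : ContinuousOn φ (sphere c R)) :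
    ∃ H : Plane → ℝ, ContinuousOn H (closedBall c R) ∧ (∀ w ∈ ball c R, HarmonicAt H w) ∧
      EqOn H φ (sphere c R) := by
  obtain ⟨H, hcont, hharm, hbdry⟩ := exists_dirichlet_complex (φ := fun z => φ (c + toPlane z))
    (hφ.comp (by fun_prop) fun z hz => by simpa using hz)
  have hdist : ∀ x : Plane, dist (toPlane.symm (x - c)) 0 = dist x c := fun x => by
    rw [dist_zero_right, LinearIsometryEquiv.norm_map, dist_eq_norm]
  refine ⟨fun x => H (toPlane.symm (x - c)), ?_, fun w hw => ?_, fun z hz => ?_⟩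
  · exact hcont.comp (by fun_prop) fun x hx => by rwa [mem_closedBall, hdist]
  · exact harmonicAt_comp_sub (f := H ∘ toPlane.symm)
      (harmonicAt_comp_linearIsometryEquiv toPlane.symm (hharm _ (by rwa [mem_ball, hdist])))
  · exact (hbdry (by rwa [mem_sphere, hdist])).trans (by simp)

/-! ### Circle averages and Harnack's inequality -/

theorem harnack_complex {f : ℂ → ℝ} {c w : ℂ} {R : ℝ} (hf : HarmonicContOnCl f (ball c R))
    (hf0 : ∀ z ∈ sphere c R, 0 ≤ f z) (hw : w ∈ ball c R) :
    (R - dist w c) / (R + dist w c) * Real.circleAverage f c R ≤ f w ∧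
      f w ≤ (R + dist w c) / (R - dist w c) * Real.circleAverage f c R := by
  have hR : 0 < R := pos_of_mem_ball hw
  have hfc : ContinuousOn f (sphere c R) := hf.continuousOn_ball.mono sphere_subset_closedBall
  have hf_int := hfc.circleIntegrable hR.le
  have hkernel := circleIntegrable_poissonKernel_smul hfc hw
  rw [← hf.circleAverage_poissonKernel_smul hw, ← smul_eq_mul, ← smul_eq_mul,
    ← Real.circleAverage_smul, ← Real.circleAverage_smul]
  constructor
  · refine Real.circleAverage_mono hf_int.const_smul hkernel fun z hz => ?_
    rw [abs_of_pos hR] at hz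
    exact mul_le_mul_of_nonneg_right (le_poissonKernel hz hw) (hf0 z hz)
  · refine Real.circleAverage_mono hkernel hf_int.const_smul fun z hz => ?_
    rw [abs_of_pos hR] at hz
    exact mul_le_mul_of_nonneg_right (poissonKernel_le hz hw) (hf0 z hz)

/-- The unit vector at angle `θ`. -/
noncomputable def unitVec (θ : ℝ) : Plane := toPlane (Complex.exp (θ * Complex.I))

theorem norm_unitVec (θ : ℝ) : ‖unitVec θ‖ = 1 := by
  rw [unitVec, LinearIsometryEquiv.norm_map, Complex.norm_exp_ofReal_mul_I]

theorem continuous_unitVec : Continuous unitVec := by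
  unfold unitVec
  fun_prop

theorem unitVec_add_pi (θ : ℝ) : unitVec (θ + Real.pi) = -unitVec θ := by
  rw [unitVec, unitVec, ← map_neg, Complex.ofReal_add, add_mul, Complex.exp_add,
    Complex.exp_pi_mul_I, mul_neg_one]

theorem dist_toPlane (z : ℂ) (c : Plane) : dist (toPlane z) c = dist z (toPlane.symm c) := by
  rw [← toPlane.dist_map, toPlane.apply_symm_apply]

/-- The average of `v` over the circle of radius `t` about `x`. -/
noncomputable def circleAvg (v : Plane → ℝ) (x : Plane) (t : ℝ) : ℝ :=
  Real.circleAverage (v ∘ toPlane) (toPlane.symm x) t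

theorem circleAvg_eq_integral (v : Plane → ℝ) (x : Plane) (t : ℝ) :
    circleAvg v x t = (2 * Real.pi)⁻¹ * ∫ θ in (0 : ℝ)..2 * Real.pi, v (x + t • unitVec θ) := by
  rw [circleAvg, Real.circleAverage_def, smul_eq_mul]
  congr 2
  funext θ
  simp only [Function.comp_apply, circleMap, map_add, LinearIsometryEquiv.apply_symm_apply, unitVec]
  rw [← map_smul, Complex.real_smul]

theorem circleAvg_congr {v w : Plane → ℝ} {x : Plane} {t : ℝ} (ht : 0 ≤ t)
    (h : EqOn v w (sphere x t)) : circleAvg v x t = circleAvg w x t :=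
  Real.circleAverage_congr_sphere fun z hz =>
    h (by rwa [mem_sphere, dist_toPlane, ← abs_of_nonneg ht])

theorem circleAvg_nonneg {v : Plane → ℝ} {x : Plane} {t : ℝ} (ht : 0 ≤ t)
    (h : ∀ y ∈ sphere x t, 0 ≤ v y) : 0 ≤ circleAvg v x t :=
  Real.circleAverage_nonneg_of_nonneg fun z hz =>
    h _ (by rwa [mem_sphere, dist_toPlane, ← abs_of_nonneg ht])

section Harnack

variable {H v : Plane → ℝ} {c w : Plane} {R : ℝ}

theorem harmonicContOnCl_comp_toPlane (hc : ContinuousOn H (closedBall c R))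
    (hh : ∀ x ∈ ball c R, HarmonicAt H x) :
    HarmonicContOnCl (H ∘ toPlane) (ball (toPlane.symm c) R) :=
  HarmonicContOnCl.mk_ball
    (fun z hz => harmonicAt_comp_linearIsometryEquiv toPlane
      (hh _ (by rwa [mem_ball, dist_toPlane])))
    (hc.comp toPlane.continuous.continuousOn fun z hz => by rwa [mem_closedBall, dist_toPlane])

theorem circleAvg_eq_of_harmonic (hR : 0 < R) (hc : ContinuousOn H (closedBall c R))
    (hh : ∀ x ∈ ball c R, HarmonicAt H x) : circleAvg H c R = H c := by
  have hH := harmonicContOnCl_comp_toPlane hc hh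
  rw [← abs_of_pos hR] at hH
  simpa only [circleAvg, Function.comp_apply, LinearIsometryEquiv.apply_symm_apply] using
    hH.circleAverage_eq

theorem harnack (hc : ContinuousOn H (closedBall c R)) (hh : ∀ x ∈ ball c R, HarmonicAt H x)
    (hH0 : ∀ x ∈ sphere c R, 0 ≤ H x) (hw : w ∈ ball c R) :
    (R - dist w c) / (R + dist w c) * circleAvg H c R ≤ H w ∧
      H w ≤ (R + dist w c) / (R - dist w c) * circleAvg H c R := by
  have hwc : dist (toPlane.symm w) (toPlane.symm c) = dist w c := toPlane.symm.dist_map w c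
  have hcomplex := harnack_complex (harmonicContOnCl_comp_toPlane hc hh)
    (fun z hz => hH0 _ (by rwa [mem_sphere, dist_toPlane])) (by rwa [mem_ball, hwc])
  simpa only [circleAvg, hwc, Function.comp_apply, LinearIsometryEquiv.apply_symm_apply] using
    hcomplex

theorem harmonic_nonneg_of_sphere (hc : ContinuousOn H (closedBall c R))
    (hh : ∀ x ∈ ball c R, HarmonicAt H x) (hH0 : ∀ x ∈ sphere c R, 0 ≤ H x) (hw : w ∈ ball c R) :
    0 ≤ H w := by
  have hR : 0 < R := pos_of_mem_ball hw
  have hwR : 0 ≤ R - dist w c := sub_nonneg.2 (mem_ball.1 hw).le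
  exact (mul_nonneg (by positivity) (circleAvg_nonneg hR.le hH0)).trans (harnack hc hh hH0 hw).1

theorem exists_harmonic_majorant (hR : 0 < R) (hc : ContinuousOn v (closedBall c R))
    (hv0 : ∀ x ∈ sphere c R, 0 ≤ v x)
    (hsub : ViscositySubharmonicOn v {x ∈ ball c R | 0 < v x}) :
    ∃ H : Plane → ℝ, ContinuousOn H (closedBall c R) ∧ (∀ w ∈ ball c R, HarmonicAt H w) ∧
      EqOn H v (sphere c R) ∧ ∀ z ∈ closedBall c R, v z ≤ H z := by
  obtain ⟨H, hHc, hHharm, hHv⟩ := exists_dirichlet c (hc.mono sphere_subset_closedBall)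
  have hH0 : ∀ x ∈ ball c R, 0 ≤ H x := fun x hx =>
    harmonic_nonneg_of_sphere hHc hHharm (fun y hy => (hv0 y hy).trans_eq (hHv hy).symm) hx
  have hle := ViscositySubharmonicOn.le_of_le_frontier (O := ball c R) (v := v) (w := H) isOpen_ball
    isBounded_ball (by rwa [closure_ball c hR.ne']) (by rwa [closure_ball c hR.ne'])
    (hsub.mono fun x hx => ⟨hx.1, (hH0 x hx.1).trans_lt hx.2⟩) (fun x hx => (hHharm x hx).1)
    (fun x hx => (hHharm x hx).2.self_of_nhds.le)
    (by rw [frontier_ball c hR.ne']; exact fun x hx => (hHv hx).ge)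
  rw [closure_ball c hR.ne'] at hle
  exact ⟨H, hHc, hHharm, hHv, hle⟩

theorem subharmonic_le_circleAvg (hc : ContinuousOn v (closedBall c R))
    (hv0 : ∀ x ∈ sphere c R, 0 ≤ v x)
    (hsub : ViscositySubharmonicOn v {x ∈ ball c R | 0 < v x}) (hw : w ∈ ball c R) :
    v w ≤ (R + dist w c) / (R - dist w c) * circleAvg v c R := by
  have hR : 0 < R := pos_of_mem_ball hw
  obtain ⟨H, hHc, hHharm, hHv, hle⟩ := exists_harmonic_majorant hR hc hv0 hsub
  rw [← circleAvg_congr hR.le hHv]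
  exact (hle w (ball_subset_closedBall hw)).trans
    (harnack hHc hHharm (fun x hx => (hv0 x hx).trans_eq (hHv hx).symm) hw).2

end Harnack

/-! ### Subsolutions below a barrier -/

/-- The standing assumptions on the domain, the data and the barrier `h`: the barrier dominates the
boundary data, is harmonic where it is positive, has bounded support, and at each of its zeros
outside `closure D` it has a tangent ball in the complement of its support and slope at most
`√lam`. -/
structure Admissible (D : Set Plane) (f g h : Plane → ℝ) (lam : ℝ) : Prop where
  isOpen : IsOpen D
  isConnected : IsConnected D
  lam_pos : 0 < lam
  f_cont : Continuous f
  lam_lt : ∀ x, lam < f x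
  g_cont : ContinuousOn g (frontier D)
  g_pos : ∀ x ∈ frontier D, 0 < g x
  g_le_h : ∀ x ∈ frontier D, g x ≤ h x
  h_nonneg : ∀ x ∉ D, 0 ≤ h x
  h_cont : ContinuousOn h Dᶜ
  h_harm : ∀ x ∉ closure D, 0 < h x → HarmonicAt h x
  h_supp : Bornology.IsBounded (posSet D h)
  h_slope : ∀ x ∉ closure D, h x = 0 → ∃ (y : Plane) (s : ℝ), 0 < s ∧ dist x y = s ∧
    Disjoint (ball y s) (posSet D h) ∧ BelowPlane h x (s⁻¹ • (x - y)) √lam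

/-- The family of subsolutions below `h`, whose supremum is the largest subsolution. -/
def subsolutionsBelow (D : Set Plane) (f g h : Plane → ℝ) : Set (Plane → ℝ) :=
  {v | IsSubsolution D f g v ∧ ∀ y ∉ D, v y ≤ h y}

/-- The free boundary condition of `IsSubsolution` at the single point `x`, for a function `w` and
a set `P` that plays the role of its positivity set. -/
def FreeBoundaryConditionAt (f w : Plane → ℝ) (P : Set Plane) (x : Plane) : Prop :=
  ∀ (y : Plane) (s : ℝ), 0 < s → dist x y = s → Disjoint (ball y s) P →
    ∀ α : ℝ, BelowPlane w x (s⁻¹ • (x - y)) α → √(f x) ≤ α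

section FreeBoundaryCondition

variable {f v w : Plane → ℝ} {P Q : Set Plane} {x y ν e : Plane} {s α β G : ℝ}

theorem norm_inv_smul_sub (hs : 0 < s) (hxy : dist x y = s) : ‖s⁻¹ • (x - y)‖ = 1 := by
  rw [norm_smul, norm_inv, Real.norm_of_nonneg hs.le, ← dist_eq_norm, hxy, inv_mul_cancel₀ hs.ne']

theorem BelowPlane.mono (hv : BelowPlane v x ν α) (hwv : ∀ᶠ y in 𝓝 x, w y ≤ v y) :
    BelowPlane w x ν α := fun ε hε => by
  filter_upwards [hv ε hε, hwv] with y hvy hwvy using hwvy.trans hvy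

theorem BelowPlane.mono_slope (hv : BelowPlane v x ν α) (h : α ≤ β) :
    BelowPlane v x ν β := fun ε hε => by
  filter_upwards [hv ε hε] with y hy
  exact hy.trans (by gcongr)

theorem BelowPlane.deriv_le_mul_inner (hb : BelowPlane w x ν α) (he : ‖e‖ = 1) (hw0 : w x = 0)
    (hd : HasDerivAt (fun t : ℝ => w (x + t • e)) G 0) : G ≤ α * max (inner ℝ e ν) 0 := by
  refine le_of_forall_pos_le_add fun ε hε => le_of_tendsto hd.tendsto_slope_zero_right ?_
  have hline : Tendsto (fun t : ℝ => x + t • e) (𝓝[>] 0) (𝓝 x) :=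
    (tendsto_add_smul_nhds_zero x e).mono_left nhdsWithin_le_nhds
  filter_upwards [hline.eventually (hb ε hε), self_mem_nhdsWithin] with t hle (ht : 0 < t)
  simp only [zero_add, zero_smul, add_zero, hw0, sub_zero, smul_eq_mul]
  simp only [add_sub_cancel_left, norm_smul, he, mul_one, Real.norm_of_nonneg ht.le,
    inner_smul_left, conj_trivial] at hle
  have hmax : max (t * inner ℝ e ν) 0 = t * max (inner ℝ e ν) 0 := by
    rw [mul_max_of_nonneg _ _ ht.le, mul_zero]
  rw [hmax] at hle
  rw [inv_mul_le_iff₀ ht]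
  linarith

theorem BelowPlane.deriv_le (hb : BelowPlane w x ν α) (hν : ‖ν‖ = 1) (he : ‖e‖ = 1)
    (hw0 : w x = 0) (hG : 0 < G) (hd : HasDerivAt (fun t : ℝ => w (x + t • e)) G 0) : G ≤ α := by
  have hle := hb.deriv_le_mul_inner he hw0 hd
  have hinner : inner ℝ e ν ≤ 1 := by simpa only [he, hν, one_mul] using real_inner_le_norm e ν
  have hmax : max (inner ℝ e ν) 0 ≤ (1 : ℝ) := max_le hinner zero_le_one
  have hα : 0 < α := pos_of_mul_pos_left (hG.trans_le hle) (le_max_right _ _)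
  exact hle.trans (mul_le_of_le_one_right hα.le hmax)

theorem FreeBoundaryConditionAt.mono (hv : FreeBoundaryConditionAt f v P x) (hPQ : P ⊆ Q)
    (hvw : ∀ᶠ y in 𝓝 x, v y ≤ w y) : FreeBoundaryConditionAt f w Q x :=
  fun y s hs hxy hdisj α hb => hv y s hs hxy (hdisj.mono_right hPQ) α (hb.mono hvw)

theorem freeBoundaryConditionAt_of_hasDerivAt (he : ‖e‖ = 1) (hw0 : w x = 0) (hG : 0 < G)
    (hd : HasDerivAt (fun t : ℝ => w (x + t • e)) G 0) (hfG : √(f x) ≤ G) :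
    FreeBoundaryConditionAt f w P x := fun _ _ hs hxy _ _ hb =>
  hfG.trans (hb.deriv_le (norm_inv_smul_sub hs hxy) he hw0 hG hd)

end FreeBoundaryCondition

section PosSet

variable {D : Set Plane} {v : Plane → ℝ} {x : Plane}

theorem compl_mem_nhds_of_notMem_closure (hx : x ∉ closure D) : Dᶜ ∈ 𝓝 x :=
  mem_of_superset (isClosed_closure.isOpen_compl.mem_nhds hx) (compl_subset_compl.2 subset_closure)

theorem notMem_of_notMem_closure (hx : x ∉ closure D) : x ∉ D := fun h => hx (subset_closure h)

theorem notMem_of_mem_frontier (hD : IsOpen D) (hx : x ∈ frontier D) : x ∉ D :=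
  (hD.frontier_eq ▸ hx).2

theorem eventually_mem_posSet (hv : ContinuousOn v Dᶜ) (hx : x ∉ closure D) (hx0 : 0 < v x) :
    ∀ᶠ y in 𝓝 x, y ∈ posSet D v := by
  have hD := compl_mem_nhds_of_notMem_closure hx
  filter_upwards [hD, (hv.continuousAt hD).eventually (lt_mem_nhds hx0)] with y hyD hy0
  exact ⟨hyD, hy0⟩

theorem notMem_posSet_of_mem_frontier (hv : ContinuousOn v Dᶜ) (hx : x ∉ closure D)
    (hfr : x ∈ frontier (posSet D v)) : x ∉ posSet D v := fun hmem =>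
  hfr.2 (mem_interior_iff_mem_nhds.2 (eventually_mem_posSet hv hx hmem.2))

end PosSet

/-- The function equal to `max v w` on `O` and to `v` elsewhere, by which a subsolution `v` is
modified on the open set `O`. -/
noncomputable def maxOn (O : Set Plane) (v w : Plane → ℝ) : Plane → ℝ :=
  open Classical in O.piecewise (v ⊔ w) v

section MaxOn

variable {D O : Set Plane} {f g h v w : Plane → ℝ} {x : Plane}

theorem maxOn_of_mem (hx : x ∈ O) : maxOn O v w x = max (v x) (w x) := by
  classical exact O.piecewise_eq_of_mem _ _ hx

theorem maxOn_of_notMem (hx : x ∉ O) : maxOn O v w x = v x := by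
  classical exact O.piecewise_eq_of_notMem _ _ hx

theorem le_maxOn_left (x : Plane) : v x ≤ maxOn O v w x := by
  by_cases hx : x ∈ O
  · exact (le_max_left _ _).trans_eq (maxOn_of_mem hx).symm
  · exact (maxOn_of_notMem hx).ge

theorem le_maxOn_right (hx : x ∈ O) : w x ≤ maxOn O v w x :=
  (le_max_right _ _).trans_eq (maxOn_of_mem hx).symm

theorem maxOn_le {b : ℝ} (hv : v x ≤ b) (hw : x ∈ O → w x ≤ b) : maxOn O v w x ≤ b := by
  by_cases hx : x ∈ O
  · exact (maxOn_of_mem hx).trans_le (max_le hv (hw hx))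
  · exact (maxOn_of_notMem hx).trans_le hv

theorem continuousOn_maxOn {s : Set Plane} (hv : ContinuousOn v s)
    (hw : ContinuousOn w (closure O ∩ s)) (hfr : ∀ x ∈ frontier O ∩ s, w x ≤ v x) :
    ContinuousOn (maxOn O v w) s := by
  classical
  refine ContinuousOn.piecewise (fun x hx => max_eq_left (hfr x hx.symm)) ?_
    (hv.mono inter_subset_left)
  exact (hv.mono inter_subset_left).sup (hw.mono (inter_comm _ _).subset)

theorem viscositySubharmonicOn_maxOn (hO : IsOpen O)
    (hv : ViscositySubharmonicOn v (posSet D v \ closure D))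
    (hw : ViscositySubharmonicOn w ((O ∩ posSet D w) \ closure D)) :
    ViscositySubharmonicOn (maxOn O v w) (posSet D (maxOn O v w) \ closure D) := by
  rintro x ⟨⟨hxD, hx0⟩, hxc⟩ φ hφ hmax
  by_cases hxv : maxOn O v w x = v x
  · refine hv x ⟨⟨hxD, hxv ▸ hx0⟩, hxc⟩ φ hφ ?_
    filter_upwards [hmax] with y hy
    linarith [le_maxOn_left (O := O) (v := v) (w := w) y]
  · have hxO : x ∈ O := by
      by_contra hn
      exact hxv (maxOn_of_notMem hn)
    have hxw : maxOn O v w x = w x := by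
      rw [maxOn_of_mem hxO] at hxv ⊢
      exact (max_choice (v x) (w x)).resolve_left hxv
    refine hw x ⟨⟨hxO, hxD, hxw ▸ hx0⟩, hxc⟩ φ hφ ?_
    filter_upwards [hmax, hO.mem_nhds hxO] with y hy hyO
    linarith [le_maxOn_right (v := v) (w := w) hyO]

theorem posSet_maxOn : posSet D (maxOn O v w) = posSet D v ∪ O ∩ posSet D w := by
  ext x
  by_cases hx : x ∈ O
  · simp only [posSet, mem_ofPred_eq, maxOn_of_mem hx, lt_max_iff, mem_union, mem_inter_iff, hx,
      true_and, and_or_left]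
  · simp only [posSet, mem_ofPred_eq, maxOn_of_notMem hx, mem_union, mem_inter_iff, hx, false_and,
      or_false]

theorem nonneg_of_mem_closure_posSet (hw : ContinuousOn w (closure O \ D)) (hxD : x ∉ D)
    (hx : x ∈ closure (O ∩ posSet D w)) : 0 ≤ w x := by
  have hsub : O ∩ posSet D w ⊆ closure O \ D := fun z hz => ⟨subset_closure hz.1, hz.2.1⟩
  have hxO : x ∈ closure O \ D := ⟨closure_mono inter_subset_left hx, hxD⟩
  have : (𝓝[O ∩ posSet D w] x).NeBot := mem_closure_iff_nhdsWithin_neBot.1 hx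
  refine ge_of_tendsto ((hw x hxO).mono_left (nhdsWithin_mono x hsub)) ?_
  filter_upwards [self_mem_nhdsWithin] with z hz using hz.2.2.le

theorem freeBoundaryConditionAt_maxOn (hO : IsOpen O) (hv : IsSubsolution D f g v)
    (hwc : ContinuousOn w (closure O \ D))
    (hout : ∀ x ∈ frontier O \ closure D, w x < 0 ∨ x ∈ closure (posSet D v))
    (hfb : ∀ x ∈ O \ closure D, x ∉ closure (posSet D v) → w x = 0 →
      x ∈ closure (O ∩ posSet D w) → FreeBoundaryConditionAt f w (O ∩ posSet D w) x)
    (hxc : x ∉ closure D) (hxcl : x ∈ closure (posSet D (maxOn O v w)))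
    (hxn : x ∉ posSet D (maxOn O v w)) :
    FreeBoundaryConditionAt f (maxOn O v w) (posSet D (maxOn O v w)) x := by
  have hxD := notMem_of_notMem_closure hxc
  rw [posSet_maxOn] at hxcl hxn ⊢
  by_cases hxv : x ∈ closure (posSet D v)
  · exact FreeBoundaryConditionAt.mono
      (hv.freeBoundary x ⟨⟨hxv, fun hi => hxn (Or.inl (interior_subset hi))⟩, hxc⟩)
      subset_union_left (Eventually.of_forall le_maxOn_left)
  rw [closure_union] at hxcl
  have hxw := hxcl.resolve_left hxv
  have hw0 : 0 ≤ w x := nonneg_of_mem_closure_posSet hwc hxD hxw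
  by_cases hxO : x ∈ O
  · have hwx : w x = 0 := le_antisymm (not_lt.1 fun hlt => hxn (Or.inr ⟨hxO, hxD, hlt⟩)) hw0
    refine (hfb x ⟨hxO, hxc⟩ hxv hwx hxw).mono subset_union_right ?_
    filter_upwards [hO.mem_nhds hxO] with z hz using le_maxOn_right hz
  · have hxfr : x ∈ frontier O := by
      rw [hO.frontier_eq]
      exact ⟨closure_mono inter_subset_left hxw, hxO⟩
    exact ((hout x ⟨hxfr, hxc⟩).elim (fun hneg => absurd hw0 hneg.not_ge)
      fun hcl => absurd hcl hxv)

theorem maxOn_mem_subsolutionsBelow (hO : IsOpen O) (hv : v ∈ subsolutionsBelow D f g h)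
    (hwc : ContinuousOn w (closure O \ D)) (hfr : ∀ x ∈ frontier O \ D, w x ≤ v x)
    (hg : ∀ x ∈ O ∩ frontier D, w x ≤ g x) (hh : ∀ x ∈ O \ D, w x ≤ h x)
    (hsub : ViscositySubharmonicOn w ((O ∩ posSet D w) \ closure D))
    (hout : ∀ x ∈ frontier O \ closure D, w x < 0 ∨ x ∈ closure (posSet D v))
    (hfb : ∀ x ∈ O \ closure D, x ∉ closure (posSet D v) → w x = 0 →
      x ∈ closure (O ∩ posSet D w) → FreeBoundaryConditionAt f w (O ∩ posSet D w) x) :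
    maxOn O v w ∈ subsolutionsBelow D f g h := by
  have hcont : ContinuousOn (maxOn O v w) Dᶜ := continuousOn_maxOn hv.1.continuousOn hwc hfr
  refine ⟨⟨hcont, fun x hx => (hv.1.nonneg x hx).trans (le_maxOn_left x),
    viscositySubharmonicOn_maxOn hO hv.1.subharmonic hsub,
    fun x hx => maxOn_le (hv.1.le_boundary x hx) fun hxO => hg x ⟨hxO, hx⟩, ?_⟩,
    fun x hx => maxOn_le (hv.2 x hx) fun hxO => hh x ⟨hxO, hx⟩⟩
  rintro x ⟨hxfr, hxc⟩
  exact freeBoundaryConditionAt_maxOn hO hv.1 hwc hout hfb hxc hxfr.1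
    (notMem_posSet_of_mem_frontier hcont hxc hxfr)

theorem sup_mem_subsolutionsBelow (hv : v ∈ subsolutionsBelow D f g h)
    (hw : w ∈ subsolutionsBelow D f g h) : v ⊔ w ∈ subsolutionsBelow D f g h := by
  have hmax : maxOn univ v w = v ⊔ w := funext fun x => maxOn_of_mem (mem_univ x)
  rw [← hmax]
  refine maxOn_mem_subsolutionsBelow isOpen_univ hv (hw.1.continuousOn.mono fun x hx => hx.2)
    (by simp) (fun x hx => hw.1.le_boundary x hx.2) (fun x hx => hw.2 x hx.2)
    (hw.1.subharmonic.mono fun x hx => ⟨hx.1.2, hx.2⟩) (by simp) ?_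
  rw [univ_inter]
  rintro x ⟨-, hxc⟩ - hx0 hxcl
  exact hw.1.freeBoundary x ⟨⟨hxcl, fun hi => (interior_subset hi).2.ne' hx0⟩, hxc⟩

end MaxOn

section HarmonicReplacement

variable {D : Set Plane} {f g h v H : Plane → ℝ} {c : Plane} {R lam : ℝ}

theorem notMem_closure_of_disjoint {s : Set Plane} (hs : Disjoint s (closure D)) {x : Plane}
    (hx : x ∈ s) : x ∉ closure D := disjoint_left.1 hs hx

theorem Admissible.zero_mem_subsolutionsBelow (A : Admissible D f g h lam) :
    0 ∈ subsolutionsBelow D f g h := by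
  have hempty : posSet D 0 = ∅ := by
    ext x
    simp [posSet]
  refine ⟨⟨continuousOn_const, fun _ _ => le_rfl, ?_, fun x hx => (A.g_pos x hx).le, ?_⟩,
    A.h_nonneg⟩
  · rw [hempty, empty_sdiff]
    exact fun x hx => hx.elim
  · rw [hempty, frontier_empty, empty_sdiff]
    exact fun x hx => hx.elim

theorem Admissible.harmonic_le (A : Admissible D f g h lam) (hR : 0 < R)
    (hdisj : Disjoint (closedBall c R) (closure D)) (hpos : ∀ x ∈ ball c R, 0 < h x)
    (hHc : ContinuousOn H (closedBall c R)) (hH : ∀ x ∈ ball c R, HarmonicAt H x)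
    (hle : ∀ x ∈ sphere c R, H x ≤ h x) : ∀ x ∈ closedBall c R, H x ≤ h x := by
  have hharm : ∀ x ∈ ball c R, HarmonicAt h x := fun x hx =>
    A.h_harm x (notMem_closure_of_disjoint hdisj (ball_subset_closedBall hx)) (hpos x hx)
  have hcomp := ViscositySubharmonicOn.le_of_le_frontier (O := ball c R) (v := H) (w := h)
    isOpen_ball isBounded_ball (by rwa [closure_ball c hR.ne'])
    (by
      rw [closure_ball c hR.ne']
      exact A.h_cont.mono (hdisj.mono_right subset_closure).subset_compl_right)
    (viscositySubharmonicOn_of_harmonicAt fun x hx => hH x hx.1) (fun x hx => (hharm x hx).1)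
    (fun x hx => (hharm x hx).2.self_of_nhds.le) (by rwa [frontier_ball c hR.ne'])
  rwa [closure_ball c hR.ne'] at hcomp

theorem eq_zero_of_harmonic_of_eq_zero (hHc : ContinuousOn H (closedBall c R))
    (hH : ∀ x ∈ ball c R, HarmonicAt H x) (hH0 : ∀ x ∈ sphere c R, 0 ≤ H x) {x : Plane}
    (hx : x ∈ ball c R) (hx0 : H x = 0) : EqOn H 0 (ball c R) := by
  have hR : 0 < R := pos_of_mem_ball hx
  have hkernel : 0 < (R - dist x c) / (R + dist x c) :=
    div_pos (sub_pos.2 (mem_ball.1 hx)) (by positivity)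
  have havg : circleAvg H c R ≤ 0 := by
    have := (harnack hHc hH hH0 hx).1
    rw [hx0] at this
    exact nonpos_of_mul_nonpos_right this hkernel
  intro y hy
  have hyR : 0 ≤ R - dist y c := sub_nonneg.2 (mem_ball.1 hy).le
  exact le_antisymm ((harnack hHc hH hH0 hy).2.trans
    (mul_nonpos_of_nonneg_of_nonpos (by positivity) havg)) (harmonic_nonneg_of_sphere hHc hH hH0 hy)

theorem Admissible.maxOn_harmonic_mem (A : Admissible D f g h lam)
    (hv : v ∈ subsolutionsBelow D f g h) (hR : 0 < R)
    (hdisj : Disjoint (closedBall c R) (closure D)) (hpos : ∀ x ∈ ball c R, 0 < h x)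
    (hs : sphere c R ⊆ closure (posSet D v)) (hHc : ContinuousOn H (closedBall c R))
    (hH : ∀ x ∈ ball c R, HarmonicAt H x) (hHv : EqOn H v (sphere c R)) :
    maxOn (ball c R) v H ∈ subsolutionsBelow D f g h := by
  have hnotMem : ∀ x ∈ closedBall c R, x ∉ D := fun x hx =>
    notMem_of_notMem_closure (notMem_closure_of_disjoint hdisj hx)
  have hHh := A.harmonic_le hR hdisj hpos hHc hH fun x hx =>
    (hHv hx).trans_le (hv.2 x (hnotMem x (sphere_subset_closedBall hx)))
  refine maxOn_mem_subsolutionsBelow isOpen_ball hv ?_ ?_ ?_ ?_ ?_ ?_ ?_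
  · rw [closure_ball c hR.ne']
    exact hHc.mono sdiff_subset
  · rw [frontier_ball c hR.ne']
    exact fun x hx => (hHv hx.1).le
  · exact fun x hx => absurd (frontier_subset_closure hx.2)
      (notMem_closure_of_disjoint hdisj (ball_subset_closedBall hx.1))
  · exact fun x hx => hHh x (ball_subset_closedBall hx.1)
  · exact viscositySubharmonicOn_of_harmonicAt fun x hx => hH x hx.1.1
  · rw [frontier_ball c hR.ne']
    exact fun x hx => Or.inr (hs hx.1)
  · rintro x ⟨hx, -⟩ - hx0 hxcl
    have hzero := eq_zero_of_harmonic_of_eq_zero hHc hH (fun z hz =>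
      (hv.1.nonneg z (hnotMem z (sphere_subset_closedBall hz))).trans_eq (hHv hz).symm) hx hx0
    have hempty : ball c R ∩ posSet D H = ∅ :=
      eq_empty_of_forall_notMem fun z hz => hz.2.2.ne' (hzero hz.1)
    rw [hempty, closure_empty] at hxcl
    exact hxcl.elim

theorem Admissible.exists_harmonic_replacement (A : Admissible D f g h lam)
    (hv : v ∈ subsolutionsBelow D f g h) (hR : 0 < R)
    (hdisj : Disjoint (closedBall c R) (closure D)) (hpos : ∀ x ∈ ball c R, 0 < h x)
    (hs : sphere c R ⊆ closure (posSet D v)) :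
    ∃ v' ∈ subsolutionsBelow D f g h, (∀ x, v x ≤ v' x) ∧ ContinuousOn v' (closedBall c R) ∧
      (∀ x ∈ ball c R, HarmonicAt v' x) ∧ EqOn v' v (sphere c R) := by
  have hnotMem : ∀ x ∈ closedBall c R, x ∉ D := fun x hx =>
    notMem_of_notMem_closure (notMem_closure_of_disjoint hdisj hx)
  obtain ⟨H, hHc, hH, hHv, hvH⟩ := exists_harmonic_majorant hR (hv.1.continuousOn.mono hnotMem)
    (fun x hx => hv.1.nonneg x (hnotMem x (sphere_subset_closedBall hx)))
    (hv.1.subharmonic.mono fun x hx =>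
      have hx' := ball_subset_closedBall hx.1
      ⟨⟨hnotMem x hx', hx.2⟩, notMem_closure_of_disjoint hdisj hx'⟩)
  have heq : EqOn (maxOn (ball c R) v H) H (closedBall c R) := by
    intro x hx
    by_cases hxb : x ∈ ball c R
    · exact (maxOn_of_mem hxb).trans (max_eq_right (hvH x hx))
    · exact (maxOn_of_notMem hxb).trans
        (hHv (mem_sphere.2 (le_antisymm hx (not_lt.1 hxb)))).symm
  refine ⟨_, A.maxOn_harmonic_mem hv hR hdisj hpos hs hHc hH hHv, le_maxOn_left, hHc.congr heq,
    fun x hx => (harmonicAt_congr_nhds ?_).2 (hH x hx),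
    (heq.mono sphere_subset_closedBall).trans hHv⟩
  exact (heq.mono ball_subset_closedBall).eventuallyEq_of_mem (isOpen_ball.mem_nhds hx)

end HarmonicReplacement

/-! ### The largest subsolution away from `D` -/

/-- The radial harmonic function `y ↦ a log (r / ‖y - x‖)`, which vanishes on the circle of radius
`r` about `x` and has slope `a / r` there. -/
noncomputable def logProfile (x : Plane) (a r : ℝ) (y : Plane) : ℝ :=
  a * (Real.log r - Real.log ‖y - x‖)

section LogProfile

variable {f : Plane → ℝ} {P : Set Plane} {x y : Plane} {a r s : ℝ}

theorem hasFDerivAt_log_norm (hx : x ≠ 0) :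
    HasFDerivAt (fun y : Plane => Real.log ‖y‖) ((‖x‖ ^ 2)⁻¹ • innerSL ℝ x) x := by
  have hsq := ((hasStrictFDerivAt_norm_sq x).hasFDerivAt.log (by simpa using hx)).const_mul (1 / 2)
  refine (hsq.congr_fderiv ?_).congr_of_eventuallyEq (Eventually.of_forall fun y => ?_)
  · module
  · simp only [Real.log_pow]
    push_cast
    ring

theorem hasDerivAt_log_norm_add_smul (hx : x ≠ 0) (e : Plane) :
    HasDerivAt (fun t : ℝ => Real.log ‖x + t • e‖) (inner ℝ x e / ‖x‖ ^ 2) 0 :=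
  ((hasFDerivAt_log_norm hx).hasLineDerivAt e).congr_deriv (inv_mul_eq_div _ _)

theorem logProfile_pos (ha : 0 < a) (hyx : y ≠ x) (hy : dist y x < r) : 0 < logProfile x a r y :=
  mul_pos ha (sub_pos.2 (Real.log_lt_log (norm_pos_iff.2 (sub_ne_zero.2 hyx))
    (by rwa [← dist_eq_norm])))

theorem logProfile_neg (ha : 0 < a) (hr : 0 < r) (hy : r < dist y x) : logProfile x a r y < 0 :=
  mul_neg_of_pos_of_neg ha (sub_neg.2 (Real.log_lt_log hr (by rwa [← dist_eq_norm])))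

theorem dist_eq_of_logProfile_eq_zero (ha : 0 < a) (hr : 0 < r) (hyx : y ≠ x)
    (hy : logProfile x a r y = 0) : dist y x = r := by
  rcases lt_trichotomy (dist y x) r with hlt | heq | hgt
  · exact absurd hy (logProfile_pos ha hyx hlt).ne'
  · exact heq
  · exact absurd hy (logProfile_neg ha hr hgt).ne

theorem logProfile_le (ha : 0 ≤ a) (hr : 0 < r) (hs : 0 < s) (hy : s ≤ dist y x) :
    logProfile x a r y ≤ a * Real.log (r / s) := by
  rw [Real.log_div hr.ne' hs.ne', logProfile, ← dist_eq_norm]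
  gcongr

theorem continuousAt_logProfile (hyx : y ≠ x) : ContinuousAt (logProfile x a r) y :=
  continuousAt_const.mul (continuousAt_const.sub
    (ContinuousAt.log (by fun_prop) (norm_ne_zero_iff.2 (sub_ne_zero.2 hyx))))

theorem harmonicAt_logProfile (hyx : y ≠ x) : HarmonicAt (logProfile x a r) y :=
  ((harmonicAt_const (Real.log r)).sub (harmonicAt_log_norm_sub hyx)).const_smul (c := a)

theorem hasFDerivAt_logProfile (hyx : y ≠ x) :
    HasFDerivAt (logProfile x a r) (-(a / ‖y - x‖ ^ 2) • innerSL ℝ (y - x)) y := by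
  have hlog := (hasFDerivAt_comp_sub x).2 (hasFDerivAt_log_norm (sub_ne_zero.2 hyx))
  refine ((hlog.const_sub (Real.log r)).const_mul a).congr_fderiv ?_
  module

theorem hasDerivAt_logProfile (hyx : y ≠ x) :
    HasDerivAt (fun t : ℝ => logProfile x a r (y + t • -(‖y - x‖⁻¹ • (y - x))))
      (a / ‖y - x‖) 0 := by
  have hne : ‖y - x‖ ≠ 0 := norm_ne_zero_iff.2 (sub_ne_zero.2 hyx)
  refine ((hasFDerivAt_logProfile hyx).hasLineDerivAt _).congr_deriv ?_
  rw [FunLike.coe_smul, Pi.smul_apply, innerSL_apply_apply, inner_neg_right, inner_smul_right,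
    real_inner_self_eq_norm_sq, smul_eq_mul]
  field_simp

theorem freeBoundaryConditionAt_logProfile (ha : 0 < a) (hr : 0 < r) (hyx : y ≠ x)
    (hy : logProfile x a r y = 0) (hf : √(f y) ≤ a / r) :
    FreeBoundaryConditionAt f (logProfile x a r) P y := by
  have hn0 : ‖y - x‖ ≠ 0 := norm_ne_zero_iff.2 (sub_ne_zero.2 hyx)
  refine freeBoundaryConditionAt_of_hasDerivAt ?_ hy (by positivity) (hasDerivAt_logProfile hyx) ?_
  · rw [norm_neg, norm_smul, norm_inv, norm_norm, inv_mul_cancel₀ hn0]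
  · rwa [← dist_eq_norm, dist_eq_of_logProfile_eq_zero ha hr hyx hy]

end LogProfile

section Annulus

variable {X : Type*} [PseudoMetricSpace X] {x : X} {r R : ℝ}

theorem closure_annulus_subset :
    closure (ball x R \ closedBall x r) ⊆ {y | dist y x ∈ Icc r R} :=
  closure_minimal (fun _ hy => ⟨(not_le.1 hy.2).le, (mem_ball.1 hy.1).le⟩)
    (isClosed_Icc.preimage (continuous_id.dist continuous_const))

theorem frontier_annulus_subset :
    frontier (ball x R \ closedBall x r) ⊆ sphere x r ∪ sphere x R := by
  intro y hy
  rw [(isOpen_ball.sdiff isClosed_closedBall).frontier_eq] at hy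
  obtain ⟨hr, hR⟩ := closure_annulus_subset hy.1
  by_contra hn
  rw [mem_union, not_or] at hn
  exact hy.2 ⟨lt_of_le_of_ne hR hn.2, not_le.2 (lt_of_le_of_ne hr (Ne.symm hn.1))⟩

end Annulus

section LargestSubsolution

variable {D K : Set Plane} {f g h v : Plane → ℝ} {x c : Plane} {b R lam : ℝ}

theorem bddAbove_values (hx : x ∉ D) :
    BddAbove {t : ℝ | ∃ v : Plane → ℝ, IsSubsolution D f g v ∧ (∀ y ∉ D, v y ≤ h y) ∧ v x = t} := by
  refine ⟨h x, ?_⟩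
  rintro t ⟨v, -, hvh, rfl⟩
  exact hvh x hx

theorem le_largestSubsolution (hv : v ∈ subsolutionsBelow D f g h) (hx : x ∉ D) :
    v x ≤ largestSubsolution D f g h x :=
  le_csSup (bddAbove_values hx) ⟨v, hv.1, hv.2, rfl⟩

theorem Admissible.largest_le (A : Admissible D f g h lam)
    (hb : ∀ v ∈ subsolutionsBelow D f g h, v x ≤ b) : largestSubsolution D f g h x ≤ b := by
  have hzero := A.zero_mem_subsolutionsBelow
  refine csSup_le ⟨0, _, hzero.1, hzero.2, rfl⟩ ?_
  rintro t ⟨v, hsub, hvh, rfl⟩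
  exact hb v ⟨hsub, hvh⟩

theorem Admissible.largest_le_barrier (A : Admissible D f g h lam) (hx : x ∉ D) :
    largestSubsolution D f g h x ≤ h x := A.largest_le fun _ hv => hv.2 x hx

theorem Admissible.largest_nonneg (A : Admissible D f g h lam) (hx : x ∉ D) :
    0 ≤ largestSubsolution D f g h x := le_largestSubsolution A.zero_mem_subsolutionsBelow hx

theorem Admissible.exists_lt_of_lt_largest (A : Admissible D f g h lam)
    (hb : b < largestSubsolution D f g h x) : ∃ v ∈ subsolutionsBelow D f g h, b < v x := by
  by_contra! hle
  exact hb.not_ge (A.largest_le hle)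

theorem posSet_subset_largest (hv : v ∈ subsolutionsBelow D f g h) :
    posSet D v ⊆ posSet D (largestSubsolution D f g h) :=
  fun _ hx => ⟨hx.1, hx.2.trans_le (le_largestSubsolution hv hx.1)⟩

theorem Admissible.eventually_mem_posSet_largest (A : Admissible D f g h lam)
    (hx : x ∉ closure D) (hpos : 0 < largestSubsolution D f g h x) :
    ∀ᶠ y in 𝓝 x, y ∈ posSet D (largestSubsolution D f g h) := by
  obtain ⟨v, hv, hv0⟩ := A.exists_lt_of_lt_largest hpos
  exact (eventually_mem_posSet hv.1.continuousOn hx hv0).mono (posSet_subset_largest hv)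

theorem Admissible.exists_subset_posSet (A : Admissible D f g h lam)
    (hv : v ∈ subsolutionsBelow D f g h) (hK : IsCompact K) (hKD : Disjoint K (closure D))
    (hKu : K ⊆ posSet D (largestSubsolution D f g h)) :
    ∃ w ∈ subsolutionsBelow D f g h, v ≤ w ∧ K ⊆ posSet D w := by
  refine hK.induction_on
    (p := fun K => ∃ w ∈ subsolutionsBelow D f g h, v ≤ w ∧ K ⊆ posSet D w)
    ⟨v, hv, le_rfl, empty_subset _⟩ ?_ ?_ ?_
  · rintro s t hst ⟨w, hw, hvw, htw⟩
    exact ⟨w, hw, hvw, hst.trans htw⟩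
  · rintro s t ⟨w, hw, hvw, hsw⟩ ⟨w', hw', -, htw'⟩
    exact ⟨w ⊔ w', sup_mem_subsolutionsBelow hw hw', hvw.trans le_sup_left,
      union_subset (fun x hx => ⟨(hsw hx).1, lt_sup_of_lt_left (hsw hx).2⟩)
        fun x hx => ⟨(htw' hx).1, lt_sup_of_lt_right (htw' hx).2⟩⟩
  · intro x hx
    obtain ⟨w, hw, hwx⟩ := A.exists_lt_of_lt_largest (hKu hx).2
    exact ⟨posSet D w, mem_nhdsWithin_of_mem_nhds (eventually_mem_posSet hw.1.continuousOn
      (notMem_closure_of_disjoint hKD hx) hwx), v ⊔ w, sup_mem_subsolutionsBelow hv hw, le_sup_left,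
      fun y hy => ⟨hy.1, lt_sup_of_lt_right hy.2⟩⟩

theorem Admissible.exists_ge_harnack (A : Admissible D f g h lam)
    (hv : v ∈ subsolutionsBelow D f g h) (hR : 0 < R)
    (hdisj : Disjoint (closedBall c R) (closure D))
    (hu : closedBall c R ⊆ posSet D (largestSubsolution D f g h)) :
    ∃ w ∈ subsolutionsBelow D f g h, v ≤ w ∧ ∀ y ∈ ball c R,
      (R - dist y c) / (R + dist y c) * w c ≤ w y ∧
      (R - dist y c) / (R + dist y c) * w y ≤ w c := by
  obtain ⟨v₁, hv₁, hvv₁, hpos⟩ := A.exists_subset_posSet hv (isCompact_closedBall c R) hdisj hu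
  obtain ⟨w, hw, hv₁w, hwc, hwh, hws⟩ := A.exists_harmonic_replacement hv₁ hR hdisj
    (fun x hx => (hpos (ball_subset_closedBall hx)).2.trans_le
      (hv₁.2 x (hpos (ball_subset_closedBall hx)).1))
    (sphere_subset_closedBall.trans (hpos.trans subset_closure))
  refine ⟨w, hw, hvv₁.trans hv₁w, fun y hy => ?_⟩
  have hkernel := harnack hwc hwh (fun x hx => by
    rw [hws hx]
    exact (hpos (sphere_subset_closedBall hx)).2.le) hy
  rw [circleAvg_eq_of_harmonic hR hwc hwh] at hkernel
  refine ⟨hkernel.1, ?_⟩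
  have hlt : 0 < R - dist y c := sub_pos.2 hy
  have hupper := hkernel.2
  rw [div_mul_eq_mul_div, le_div_iff₀ hlt] at hupper
  rw [div_mul_eq_mul_div, div_le_iff₀ (by positivity)]
  linarith

theorem Admissible.largest_harnack (A : Admissible D f g h lam)
    (hdisj : Disjoint (closedBall c R) (closure D))
    (hu : closedBall c R ⊆ posSet D (largestSubsolution D f g h)) {y : Plane} (hy : y ∈ ball c R) :
    (R - dist y c) / (R + dist y c) * largestSubsolution D f g h c ≤ largestSubsolution D f g h y ∧
      (R - dist y c) / (R + dist y c) * largestSubsolution D f g h y ≤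
        largestSubsolution D f g h c := by
  have hR : 0 < R := pos_of_mem_ball hy
  have hk : 0 < (R - dist y c) / (R + dist y c) :=
    div_pos (sub_pos.2 (mem_ball.1 hy)) (by positivity)
  have hcD : c ∉ D := (hu (mem_closedBall_self hR.le)).1
  have hyD : y ∉ D := (hu (ball_subset_closedBall hy)).1
  constructor <;> rw [← le_div_iff₀' hk] <;> refine A.largest_le fun v hv => ?_ <;>
    obtain ⟨w, hw, hvw, hwk⟩ := A.exists_ge_harnack hv hR hdisj hu <;> rw [le_div_iff₀' hk]
  · calc _ ≤ (R - dist y c) / (R + dist y c) * w c := by gcongr; exact hvw c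
      _ ≤ w y := (hwk y hy).1
      _ ≤ _ := le_largestSubsolution hw hyD
  · calc _ ≤ (R - dist y c) / (R + dist y c) * w y := by gcongr; exact hvw y
      _ ≤ w c := (hwk y hy).2
      _ ≤ _ := le_largestSubsolution hw hcD

end LargestSubsolution

section Growth

variable {D : Set Plane} {f g h v : Plane → ℝ} {x z : Plane} {e L lam : ℝ}

theorem logProfile_le_six_mul (hL : 0 < L) (he : 0 < e) {y : Plane} (hy : e / 8 ≤ dist y x) :
    logProfile x (2 * e * L) (2 * e) y ≤ 6 * L * e := by
  have hlog : Real.log (2 * e / (e / 8)) ≤ 3 := by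
    have hratio : 2 * e / (e / 8) = 2 ^ 4 := by
      field_simp
      norm_num
    rw [hratio, Real.log_pow]
    push_cast
    linarith [Real.log_two_lt_d9]
  calc _ ≤ 2 * e * L * Real.log (2 * e / (e / 8)) :=
        logProfile_le (by positivity) (by positivity) (by positivity) hy
    _ ≤ 2 * e * L * 3 := by gcongr
    _ = 6 * L * e := by ring

theorem maxOn_logProfile_mem_subsolutionsBelow (he : 0 < e)
    (hD : Disjoint (ball x (4 * e)) D) (hL : 0 < L) (hf : ∀ y ∈ ball x (3 * e), √(f y) ≤ L)
    (hh : ∀ y ∈ ball x (3 * e), 6 * L * e ≤ h y) (hv : v ∈ subsolutionsBelow D f g h)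
    (hlow : ∀ y ∈ closedBall x (e / 8), 6 * L * e ≤ v y) :
    maxOn (ball x (3 * e) \ closedBall x (e / 8)) v (logProfile x (2 * e * L) (2 * e)) ∈
      subsolutionsBelow D f g h := by
  have ha : 0 < 2 * e * L := by positivity
  have hDc : Disjoint (closedBall x (3 * e)) (closure D) :=
    (hD.closure_right isOpen_ball).mono_left (closedBall_subset_ball (by linarith))
  have hne : ∀ y, e / 8 ≤ dist y x → y ≠ x := by
    rintro y hy rfl
    rw [dist_self] at hy
    linarith
  have hneO : ∀ y ∈ ball x (3 * e) \ closedBall x (e / 8), y ≠ x := fun y hy =>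
    hne y (not_le.1 hy.2).le
  refine maxOn_mem_subsolutionsBelow (isOpen_ball.sdiff isClosed_closedBall) hv ?_ ?_ ?_ ?_ ?_ ?_ ?_
  · exact fun y hy =>
      (continuousAt_logProfile (hne y (closure_annulus_subset hy.1).1)).continuousWithinAt
  · rintro y ⟨hy, hyD⟩
    rcases frontier_annulus_subset hy with hin | hout
    · exact (logProfile_le_six_mul hL he (mem_sphere.1 hin).ge).trans
        (hlow y (sphere_subset_closedBall hin))
    · have hlt : 2 * e < dist y x := by linarith [mem_sphere.1 hout]
      exact (logProfile_neg ha (by positivity) hlt).le.trans (hv.1.nonneg y hyD)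
  · exact fun y hy => absurd (frontier_subset_closure hy.2)
      (notMem_closure_of_disjoint hDc (ball_subset_closedBall hy.1.1))
  · exact fun y hy => (logProfile_le_six_mul hL he (not_le.1 hy.1.2).le).trans (hh y hy.1.1)
  · exact viscositySubharmonicOn_of_harmonicAt fun y hy => harmonicAt_logProfile (hneO y hy.1.1)
  · rintro y ⟨hy, hyD⟩
    rcases frontier_annulus_subset hy with hin | hout
    · exact Or.inr (subset_closure ⟨notMem_of_notMem_closure hyD,
        lt_of_lt_of_le (by positivity) (hlow y (sphere_subset_closedBall hin))⟩)
    · have hlt : 2 * e < dist y x := by linarith [mem_sphere.1 hout]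
      exact Or.inl (logProfile_neg ha (by positivity) hlt)
  · rintro y ⟨hy, -⟩ - hy0 -
    refine freeBoundaryConditionAt_logProfile ha (by positivity) (hneO y hy) hy0 ?_
    rw [mul_div_cancel_left₀ L (by positivity)]
    exact hf y hy.1

theorem exists_pos_of_large (he : 0 < e)
    (hD : Disjoint (ball x (4 * e)) D) (hL : 0 < L) (hf : ∀ y ∈ ball x (3 * e), √(f y) ≤ L)
    (hh : ∀ y ∈ ball x (3 * e), 6 * L * e ≤ h y) (hv : v ∈ subsolutionsBelow D f g h)
    (hlow : ∀ y ∈ closedBall x (e / 8), 6 * L * e ≤ v y) :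
    ∃ v' ∈ subsolutionsBelow D f g h, ∀ y ∈ ball x (2 * e), e / 8 < dist y x → 0 < v' y := by
  refine ⟨_, maxOn_logProfile_mem_subsolutionsBelow he hD hL hf hh hv hlow, fun y hy hey => ?_⟩
  have hyO : y ∈ ball x (3 * e) \ closedBall x (e / 8) :=
    ⟨ball_subset_ball (by linarith) hy, not_le.2 hey⟩
  have hyx : y ≠ x := dist_pos.1 (by linarith)
  exact (logProfile_pos (by positivity) hyx hy).trans_le (le_maxOn_right hyO)

theorem Admissible.exists_ge_on_closedBall (A : Admissible D f g h lam) (he : 0 < e)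
    (hD : Disjoint (ball x (4 * e)) D)
    (hu : ball x e ⊆ posSet D (largestSubsolution D f g h)) (hL : 0 < L)
    (hlt : 10 * L * e < largestSubsolution D f g h x) :
    ∃ w ∈ subsolutionsBelow D f g h, ∀ y ∈ closedBall x (e / 8), 6 * L * e ≤ w y := by
  obtain ⟨v, hv, hvx⟩ := A.exists_lt_of_lt_largest hlt
  obtain ⟨w, hw, hvw, hwk⟩ := A.exists_ge_harnack hv (half_pos he)
    ((hD.closure_right isOpen_ball).mono_left (closedBall_subset_ball (by linarith)))
    ((closedBall_subset_ball (half_lt_self he)).trans hu)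
  refine ⟨w, hw, fun y hy => ?_⟩
  rw [mem_closedBall] at hy
  have hkernel : 3 / 5 ≤ (e / 2 - dist y x) / (e / 2 + dist y x) := by
    rw [div_le_div_iff₀ (by norm_num) (by positivity)]
    linarith
  calc 6 * L * e = 3 / 5 * (10 * L * e) := by ring
    _ ≤ (e / 2 - dist y x) / (e / 2 + dist y x) * w x := by
        gcongr
        exact hvx.le.trans (hvw x)
    _ ≤ w y := (hwk y (mem_ball.2 (by linarith))).1

theorem Admissible.largest_le_dist (A : Admissible D f g h lam)
    (hz : z ∉ posSet D (largestSubsolution D f g h)) (hD : Disjoint (ball x (4 * dist x z)) D)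
    (hx : x ∉ closure D) (hL : 0 < L) (hf : ∀ y ∈ ball x (3 * dist x z), √(f y) ≤ L)
    (hh : ∀ y ∈ ball x (3 * dist x z), 6 * L * dist x z ≤ h y) :
    largestSubsolution D f g h x ≤ 10 * L * dist x z := by
  set u := largestSubsolution D f g h
  by_contra! hlt
  have hux : 0 < u x := lt_of_le_of_lt (by positivity) hlt
  set e := infDist x (posSet D u)ᶜ with he
  have hne : ((posSet D u)ᶜ).Nonempty := ⟨z, hz⟩
  have hez : e ≤ dist x z := infDist_le_dist_of_mem hz
  have he0 : 0 < e := by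
    rw [he, ← infDist_pos_iff_notMem_closure hne, closure_compl, notMem_compl_iff]
    exact mem_interior_iff_mem_nhds.2 (A.eventually_mem_posSet_largest hx hux)
  have hu : ball x e ⊆ posSet D u := ball_infDist_compl_subset
  have hsub : ∀ t : ℝ, 0 ≤ t → ball x (t * e) ⊆ ball x (t * dist x z) := fun t ht =>
    ball_subset_ball (by gcongr)
  have hDe := hD.mono_left (hsub 4 (by norm_num))
  obtain ⟨w, hw, hlow⟩ := A.exists_ge_on_closedBall he0 hDe hu hL (lt_of_le_of_lt (by gcongr) hlt)
  obtain ⟨v, hv, hpos⟩ := exists_pos_of_large he0 hDe hL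
    (fun y hy => hf y (hsub 3 (by norm_num) hy))
    (fun y hy => le_trans (by gcongr) (hh y (hsub 3 (by norm_num) hy))) hw hlow
  obtain ⟨y, hyu, hyd⟩ := (infDist_lt_iff hne).1 (show e < 2 * e by linarith)
  have hey : e ≤ dist x y := infDist_le_dist_of_mem hyu
  rw [dist_comm] at hyd hey
  exact hyu (posSet_subset_largest hv ⟨disjoint_left.1 hDe (mem_ball.2 (by linarith)),
    hpos y hyd (by linarith)⟩)

end Growth

section Continuity

variable {D : Set Plane} {f g h : Plane → ℝ} {x : Plane} {lam : ℝ}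

theorem Admissible.continuousAt_largest_of_pos (A : Admissible D f g h lam) (hx : x ∉ closure D)
    (hpos : 0 < largestSubsolution D f g h x) :
    ContinuousAt (largestSubsolution D f g h) x := by
  set u := largestSubsolution D f g h
  obtain ⟨R, hR, hRu⟩ := nhds_basis_closedBall.mem_iff.1
    ((A.eventually_mem_posSet_largest hx hpos).and
      (isClosed_closure.isOpen_compl.eventually_mem hx))
  have hharnack : ∀ y ∈ ball x R, _ := fun y hy => A.largest_harnack
    (disjoint_left.2 fun y hy => (hRu hy).2) (fun y hy => (hRu hy).1) hy
  have hk : Tendsto (fun y => (R - dist y x) / (R + dist y x)) (𝓝 x) (𝓝 1) := by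
    have hcont : ContinuousAt (fun y => (R - dist y x) / (R + dist y x)) x :=
      ContinuousAt.div (by fun_prop) (by fun_prop) (by simpa using hR.ne')
    simpa only [dist_self, sub_zero, add_zero, div_self hR.ne'] using hcont.tendsto
  have hlow := hk.mul_const (u x)
  have hup := (hk.inv₀ one_ne_zero).mul_const (u x)
  rw [one_mul] at hlow
  rw [inv_one, one_mul] at hup
  refine tendsto_of_tendsto_of_tendsto_of_le_of_le' hlow hup ?_ ?_
  · filter_upwards [ball_mem_nhds x hR] with y hy using (hharnack y hy).1
  · filter_upwards [ball_mem_nhds x hR] with y hy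
    rw [le_inv_mul_iff₀ (div_pos (sub_pos.2 hy) (by positivity))]
    exact (hharnack y hy).2

theorem Admissible.eventually_largest_le_dist (A : Admissible D f g h lam) (hx : x ∉ closure D)
    (hux : largestSubsolution D f g h x = 0) (hhx : 0 < h x) :
    ∃ C : ℝ, ∀ᶠ y in 𝓝 x, largestSubsolution D f g h y ≤ C * dist y x := by
  have hD := compl_mem_nhds_of_notMem_closure hx
  obtain ⟨ε, hε, hεb⟩ := nhds_basis_ball.eventually_iff.1
    ((isClosed_closure.isOpen_compl.eventually_mem hx).and
    (((A.h_cont.continuousAt hD).eventually (lt_mem_nhds (half_lt_self hhx))).and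
      (A.f_cont.continuousAt.eventually (gt_mem_nhds (lt_add_one (f x))))))
  set L := √(f x + 1)
  have hL : 0 < L := Real.sqrt_pos.2 (by linarith [A.lam_pos, A.lam_lt x])
  have hsmall : ∀ᶠ y in 𝓝 x, 6 * L * dist y x < h x / 2 := by
    have hcont : ContinuousAt (fun y => 6 * L * dist y x) x := by fun_prop
    exact hcont.eventually (gt_mem_nhds (by simpa using hhx))
  refine ⟨10 * L, ?_⟩
  filter_upwards [hsmall, ball_mem_nhds x (show 0 < ε / 5 by positivity)] with y hysmall hy
  rw [mem_ball] at hy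
  have hsub : ∀ t ≤ 4, ball y (t * dist y x) ⊆ ball x ε := fun t ht =>
    ball_subset_ball' (by nlinarith [dist_nonneg (x := y) (y := x)])
  refine A.largest_le_dist (fun hmem => hmem.2.ne' hux)
    (disjoint_left.2 fun z hz => notMem_of_notMem_closure (hεb (hsub 4 le_rfl hz)).1)
    (hεb (mem_ball.2 (by linarith))).1 hL (fun z hz => ?_) fun z hz => ?_
  · exact Real.sqrt_le_sqrt (hεb (hsub 3 (by norm_num) hz)).2.2.le
  · exact hysmall.le.trans (hεb (hsub 3 (by norm_num) hz)).2.1.le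

theorem Admissible.continuousAt_largest (A : Admissible D f g h lam) (hx : x ∉ closure D) :
    ContinuousAt (largestSubsolution D f g h) x := by
  have hD := compl_mem_nhds_of_notMem_closure hx
  have hxD := notMem_of_notMem_closure hx
  rcases (A.largest_nonneg hxD).lt_or_eq with hpos | hux
  · exact A.continuousAt_largest_of_pos hx hpos
  suffices hupper : ∃ w : Plane → ℝ, Tendsto w (𝓝 x) (𝓝 0) ∧
      ∀ᶠ y in 𝓝 x, largestSubsolution D f g h y ≤ w y by
    obtain ⟨w, hw, hle⟩ := hupper
    rw [ContinuousAt, ← hux]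
    exact tendsto_of_tendsto_of_tendsto_of_le_of_le' tendsto_const_nhds hw
      (mem_of_superset hD fun y hy => A.largest_nonneg hy) hle
  rcases (A.h_nonneg x hxD).lt_or_eq with hhx | hhx
  · obtain ⟨C, hC⟩ := A.eventually_largest_le_dist hx hux.symm hhx
    refine ⟨fun y => C * dist y x, ?_, hC⟩
    exact Continuous.tendsto' (by fun_prop) _ _ (by rw [dist_self, mul_zero])
  · refine ⟨h, ?_, mem_of_superset hD fun y hy => A.largest_le_barrier hy⟩
    rw [hhx]
    exact A.h_cont.continuousAt hD

end Continuity

/-! ### Potentials of points of `D` near `∂D` -/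

section SpacedSums

theorem sum_Icc_log_div_le (n : ℕ) : ∑ j ∈ Finset.Icc 1 n, Real.log (n / j) ≤ n := by
  rcases n.eq_zero_or_pos with rfl | hn
  · simp
  have hpos : ∀ j ∈ Finset.Icc 1 n, (n : ℝ) / j ≠ 0 := fun j hj => by
    have := (Finset.mem_Icc.1 hj).1
    positivity
  have hprod : ∏ j ∈ Finset.Icc 1 n, (n : ℝ) / j = n ^ n / n.factorial := by
    rw [Finset.prod_div_distrib, Finset.prod_const, Nat.card_Icc, Nat.add_sub_cancel,
      ← Nat.cast_prod, ← Finset.Ico_add_one_right_eq_Icc, Finset.prod_Ico_id_eq_factorial]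
  rw [← Real.log_prod hpos, hprod, Real.log_le_iff_le_exp (by positivity)]
  exact Real.pow_div_factorial_le_exp _ n.cast_nonneg n

theorem sum_max_log_div_le (n : ℕ) (J : Finset ℕ) : ∑ j ∈ J, max (Real.log (n / j)) 0 ≤ n := by
  refine le_trans ?_ (sum_Icc_log_div_le n)
  have hzero : ∀ j ∈ J, max (Real.log (n / j)) 0 ≠ 0 → j ∈ Finset.Icc 1 n := by
    refine fun j _ hj => Finset.mem_Icc.2 ?_
    by_contra! hout
    refine hj (max_eq_right ?_)
    rcases j.eq_zero_or_pos with rfl | hj0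
    · simp
    · refine Real.log_nonpos (by positivity) ((div_le_one (by positivity)).2 ?_)
      exact_mod_cast (hout hj0).le
  rw [← Finset.sum_filter_of_ne hzero]
  calc _ ≤ ∑ j ∈ Finset.Icc 1 n, max (Real.log (n / j)) 0 :=
        Finset.sum_le_sum_of_subset_of_nonneg (fun j hj => (Finset.mem_filter.1 hj).2)
          fun _ _ _ => le_max_right _ _
    _ = ∑ j ∈ Finset.Icc 1 n, Real.log (n / j) := Finset.sum_congr rfl fun j hj => by
        have hj0 : (0 : ℝ) < j := by exact_mod_cast (Finset.mem_Icc.1 hj).1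
        refine max_eq_left (Real.log_nonneg ((one_le_div hj0).2 ?_))
        exact_mod_cast (Finset.mem_Icc.1 hj).2

theorem sum_le_of_injOn {ι : Type*} {I : Finset ι} {F : ι → ℝ} {d : ι → ℕ} {n : ℕ}
    (hd : InjOn d I) (hF : ∀ i ∈ I, F i ≤ Real.log (n / d i)) : ∑ i ∈ I, F i ≤ n :=
  calc ∑ i ∈ I, F i ≤ ∑ i ∈ I, max (Real.log (n / d i)) 0 :=
        Finset.sum_le_sum fun i hi => (hF i hi).trans (le_max_left _ _)
    _ = ∑ j ∈ I.image d, max (Real.log (n / j)) 0 :=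
        (Finset.sum_image (f := fun j : ℕ => max (Real.log (n / j)) 0) hd).symm
    _ ≤ n := sum_max_log_div_le n _

theorem sum_range_le_of_le_log {N n : ℕ} {ρ T : ℝ} {F : ℕ → ℝ} (hT : 0 ≤ T)
    (hFT : ∀ i < N, F i ≤ T) (hF : ∀ i < N, ∀ j : ℕ, 0 < j → j ≤ |ρ - i| → F i ≤ Real.log (n / j)) :
    ∑ i ∈ Finset.range N, F i ≤ 2 * T + 2 * n := by
  set k := ⌊ρ⌋₊
  have hbelow : ∑ i ∈ Finset.range N with i < k, F i ≤ n := by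
    refine sum_le_of_injOn (d := fun i => k - i) (fun i hi j hj hij => ?_) fun i hi => ?_
    · simp only [Finset.coe_filter, mem_ofPred_eq] at hi hj hij
      omega
    · obtain ⟨hiN, hik⟩ := Finset.mem_filter.1 hi
      refine hF i (Finset.mem_range.1 hiN) _ (by omega) (le_trans ?_ (le_abs_self _))
      have hk : (k : ℝ) ≤ ρ := Nat.floor_le (Nat.pos_of_floor_pos (by omega)).le
      rw [Nat.cast_sub hik.le]
      linarith
  have habove : ∑ i ∈ Finset.range N with ¬ i < k ∧ k + 1 < i, F i ≤ n := by
    refine sum_le_of_injOn (d := fun i => i - (k + 1)) (fun i hi j hj hij => ?_) fun i hi => ?_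
    · simp only [Finset.coe_filter, mem_ofPred_eq] at hi hj hij
      omega
    · obtain ⟨hiN, -, hik⟩ := Finset.mem_filter.1 hi
      refine hF i (Finset.mem_range.1 hiN) _ (by omega) (le_trans ?_ (neg_le_abs _))
      have hk : ρ < k + 1 := Nat.lt_floor_add_one ρ
      rw [Nat.cast_sub hik.le]
      push_cast
      linarith
  have hnear : ∑ i ∈ Finset.range N with ¬ i < k ∧ ¬ k + 1 < i, F i ≤ 2 * T := by
    have hcard : (Finset.range N |>.filter fun i => ¬ i < k ∧ ¬ k + 1 < i).card ≤ 2 :=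
      (Finset.card_le_card (t := {k, k + 1}) fun i hi => by
        simp only [Finset.mem_filter, Finset.mem_insert, Finset.mem_singleton] at hi ⊢
        omega).trans Finset.card_le_two
    calc _ ≤ _ := Finset.sum_le_card_nsmul _ _ T fun i hi =>
          hFT i (Finset.mem_range.1 (Finset.mem_filter.1 hi).1)
      _ ≤ 2 * T := by
          rw [nsmul_eq_mul]
          gcongr
          exact_mod_cast hcard
  rw [← Finset.sum_filter_add_sum_filter_not _ (fun i => i < k),
    ← Finset.sum_filter_add_sum_filter_not {i ∈ Finset.range N | ¬ i < k} (fun i => k + 1 < i),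
    Finset.filter_filter, Finset.filter_filter]
  linarith

end SpacedSums

section BoundaryPotential

variable {D : Set Plane} {p : Plane} {δ : ℝ}

theorem exists_isCompact_sphere_inter (hD : IsOpen D) (hDc : IsConnected D) (hp : p ∈ closure D)
    (hδ : 0 < δ) (hDδ : ∃ q ∈ D, δ ≤ dist q p) :
    ∃ K ⊆ D, IsCompact K ∧ ∀ s ∈ Icc (δ / 2) δ, ∃ y ∈ K, dist y p = s := by
  obtain ⟨q, hq, hqp⟩ := hDδ
  obtain ⟨p', hp', hpp'⟩ := Metric.mem_closure_iff.1 hp (δ / 2) (by positivity)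
  obtain ⟨γ, hγ⟩ := ((hD.isConnected_iff_isPathConnected).1 hDc).joinedIn p' hp' q hq
  refine ⟨range γ, range_subset_iff.2 hγ, isCompact_range γ.continuous, fun s hs => ?_⟩
  have hcont : Continuous fun τ => dist (γ τ) p := by fun_prop
  obtain ⟨τ, hτ⟩ := mem_range_of_exists_le_of_exists_ge (c := s) hcont
    ⟨0, by rw [γ.source, dist_comm]; exact hpp'.le.trans hs.1⟩
    ⟨1, by rw [γ.target]; exact hs.2.trans hqp⟩
  exact ⟨γ τ, mem_range_self _, hτ⟩

theorem sum_log_sub_log_norm_le {N : ℕ} {y : ℕ → Plane} {x : Plane} {t : ℝ} (hδ : 0 < δ)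
    (hN : 2 * max (Real.log (4 * δ / t)) 0 ≤ N) (ht : 0 < t) (hxy : ∀ i < N, t ≤ ‖x - y i‖)
    (hy : ∀ i < N, dist (y i) p = δ / 2 + i * (δ / (2 * N))) :
    ∑ i ∈ Finset.range N, (Real.log (4 * δ) - Real.log ‖x - y i‖) ≤ 17 * N := by
  rcases N.eq_zero_or_pos with rfl | hN0
  · simp
  set a := δ / (2 * N) with ha
  have ha0 : 0 < a := by positivity
  have hlog : ∀ i < N, Real.log (4 * δ) - Real.log ‖x - y i‖ = Real.log (4 * δ / ‖x - y i‖) :=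
    fun i hi => (Real.log_div (by positivity) (ht.trans_le (hxy i hi)).ne').symm
  have hsum := sum_range_le_of_le_log (N := N) (n := 8 * N) (ρ := (dist x p - δ / 2) / a)
    (F := fun i => Real.log (4 * δ) - Real.log ‖x - y i‖) (le_max_right (Real.log (4 * δ / t)) 0)
    (fun i hi => ?_) fun i hi j hj hji => ?_
  · push_cast at hsum
    linarith
  · rw [hlog i hi]
    have hpos := ht.trans_le (hxy i hi)
    refine le_trans (Real.log_le_log (by positivity) ?_) (le_max_left _ _)
    exact div_le_div_of_nonneg_left (by positivity) ht (hxy i hi)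
  · have hdist : j * a ≤ ‖x - y i‖ :=
      calc j * a ≤ |(dist x p - δ / 2) / a - i| * a := by gcongr
        _ = |dist x p - dist (y i) p| := by
          rw [hy i hi, ← abs_of_pos ha0, ← abs_mul, abs_of_pos ha0]
          congr 1
          field_simp
          ring
        _ ≤ ‖x - y i‖ := by
          rw [← dist_eq_norm]
          exact abs_dist_sub_le _ _ _
    have hja : 0 < j * a := by positivity
    rw [hlog i hi]
    calc Real.log (4 * δ / ‖x - y i‖) ≤ Real.log (4 * δ / (j * a)) :=
          Real.log_le_log (div_pos (by positivity) (hja.trans_le hdist))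
            (div_le_div_of_nonneg_left (by positivity) hja hdist)
      _ = Real.log ((8 * N : ℕ) / j) := by
          congr 1
          rw [ha]
          push_cast
          field_simp
          norm_num

/-- The mean over `i` of the potentials `log (r / |x - y i|)` of the points `y i`. -/
noncomputable def meanPotential {N : ℕ} (y : Fin N → Plane) (r : ℝ) (x : Plane) : ℝ :=
  (N : ℝ)⁻¹ * ∑ i, (Real.log r - Real.log ‖x - y i‖)

section meanPotential

variable {N : ℕ} {y : Fin N → Plane} {x : Plane} {r : ℝ}

theorem le_inv_mul_sum [NeZero N] {F : Fin N → ℝ} {b : ℝ} (h : ∀ i, b ≤ F i) :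
    b ≤ (N : ℝ)⁻¹ * ∑ i, F i := by
  rw [le_inv_mul_iff₀ (by exact_mod_cast NeZero.pos N)]
  simpa using Finset.card_nsmul_le_sum Finset.univ _ b fun i _ => h i

theorem inv_mul_sum_le [NeZero N] {F : Fin N → ℝ} {b : ℝ} (h : ∀ i, F i ≤ b) :
    (N : ℝ)⁻¹ * ∑ i, F i ≤ b := by
  rw [inv_mul_le_iff₀ (by exact_mod_cast NeZero.pos N)]
  simpa using Finset.sum_le_card_nsmul Finset.univ _ b fun i _ => h i

theorem log_sub_log_le_meanPotential [NeZero N] {s : ℝ} (hxy : ∀ i, x ≠ y i)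
    (hs : ∀ i, dist x (y i) ≤ s) : Real.log r - Real.log s ≤ meanPotential y r x :=
  le_inv_mul_sum fun i => sub_le_sub_left (Real.log_le_log (norm_sub_pos_iff.2 (hxy i))
    (dist_eq_norm x (y i) ▸ hs i)) _

theorem meanPotential_le_log_sub_log [NeZero N] {s : ℝ} (hs0 : 0 < s)
    (hs : ∀ i, s ≤ dist x (y i)) : meanPotential y r x ≤ Real.log r - Real.log s :=
  inv_mul_sum_le fun i => sub_le_sub_left (Real.log_le_log hs0 (dist_eq_norm x (y i) ▸ hs i)) _

theorem harmonicAt_meanPotential (hxy : ∀ i, x ≠ y i) : HarmonicAt (meanPotential y r) x := by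
  have hsum : ∀ s : Finset (Fin N),
      HarmonicAt (fun x => ∑ i ∈ s, (Real.log r - Real.log ‖x - y i‖)) x := fun s => by
    induction s using Finset.induction_on with
    | empty => simpa only [Finset.sum_empty] using harmonicAt_const 0
    | insert i s hi ih =>
      simp only [Finset.sum_insert hi]
      exact ((harmonicAt_const (Real.log r)).sub (harmonicAt_log_norm_sub (hxy i))).add ih
  exact (hsum Finset.univ).const_smul (c := (N : ℝ)⁻¹)

theorem hasDerivAt_meanPotential (hxy : ∀ i, x ≠ y i) (e : Plane) :
    HasDerivAt (fun t : ℝ => meanPotential y r (x + t • e))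
      ((N : ℝ)⁻¹ * ∑ i, -(inner ℝ (x - y i) e / ‖x - y i‖ ^ 2)) 0 := by
  unfold meanPotential
  refine HasDerivAt.const_mul _ (HasDerivAt.fun_sum fun i _ => ?_)
  simp only [add_sub_right_comm x]
  exact (hasDerivAt_log_norm_add_smul (sub_ne_zero.2 (hxy i)) e).const_sub _

theorem exists_hasDerivAt_meanPotential [NeZero N] (hδ : 0 < δ) (hy : ∀ i, dist (y i) p ≤ δ)
    (hxy : ∀ i, x ≠ y i) (hx : 3 * δ ≤ dist x p) (hx' : dist x p ≤ 6 * δ) :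
    ∃ (e : Plane) (G : ℝ), ‖e‖ = 1 ∧ 1 / (25 * δ) ≤ G ∧
      HasDerivAt (fun t : ℝ => meanPotential y r (x + t • e)) G 0 := by
  rw [dist_eq_norm] at hx hx'
  have hxp : 0 < ‖x - p‖ := by linarith
  refine ⟨-(‖x - p‖⁻¹ • (x - p)), _, ?_, le_inv_mul_sum fun i => ?_, hasDerivAt_meanPotential hxy _⟩
  · rw [norm_neg]
    exact norm_inv_smul_sub hxp rfl
  · have hpos : 0 < ‖x - y i‖ := norm_sub_pos_iff.2 (hxy i)
    have hyp : ‖y i - p‖ ≤ δ := by simpa only [dist_eq_norm] using hy i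
    have hle : ‖x - y i‖ ≤ ‖x - p‖ + δ := by
      linarith [norm_sub_le (x - p) (y i - p), congrArg norm (sub_sub_sub_cancel_right x (y i) p)]
    have hinner : ‖x - p‖ - δ ≤ ‖x - p‖⁻¹ * inner ℝ (x - y i) (x - p) := by
      rw [le_inv_mul_iff₀ hxp, ← sub_sub_sub_cancel_right x (y i) p, inner_sub_left,
        real_inner_self_eq_norm_sq]
      nlinarith [real_inner_le_norm (y i - p) (x - p)]
    rw [inner_neg_right, inner_smul_right, neg_div, neg_neg, div_le_div_iff₀ (by positivity)
      (by positivity), one_mul]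
    calc ‖x - y i‖ ^ 2 ≤ (‖x - p‖ + δ) ^ 2 := by gcongr
      _ ≤ (‖x - p‖ - δ) * (25 * δ) := by nlinarith
      _ ≤ _ := by gcongr

end meanPotential

/-- A potential of scale `δ` at the point `p` near the open set `D`, with constants that do not
depend on `D`. -/
structure BoundaryPotential (D : Set Plane) (p : Plane) (δ : ℝ) (P : Plane → ℝ) : Prop where
  harmonicAt {x : Plane} : x ∉ D → HarmonicAt P x
  le {x : Plane} : x ∉ D → P x ≤ 17
  half_le {x : Plane} : x ∉ D → dist x p ≤ δ → 1 / 2 ≤ P x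
  pos {x : Plane} : x ∉ D → dist x p < 3 * δ → 0 < P x
  neg {x : Plane} : 6 * δ ≤ dist x p → P x < 0
  exists_hasDerivAt {x : Plane} : x ∉ D → P x = 0 → ∃ (e : Plane) (G : ℝ), ‖e‖ = 1 ∧
    1 / (25 * δ) ≤ G ∧ HasDerivAt (fun t : ℝ => P (x + t • e)) G 0

theorem boundaryPotential_meanPotential {N : ℕ} [NeZero N] {y : Fin N → Plane} (hδ : 0 < δ)
    (hyD : ∀ i, y i ∈ D) (hy : ∀ i, dist (y i) p ≤ δ)
    (hle : ∀ x ∉ D, meanPotential y (4 * δ) x ≤ 17) :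
    BoundaryPotential D p δ (meanPotential y (4 * δ)) := by
  have hne : ∀ {x}, x ∉ D → ∀ i, x ≠ y i := fun hx i hxy => hx (hxy ▸ hyD i)
  have hdist : ∀ x i, dist x (y i) ≤ dist x p + δ := fun x i => by
    linarith [dist_triangle_right x (y i) p, hy i]
  have hpos : ∀ {x}, x ∉ D → dist x p < 3 * δ → 0 < meanPotential y (4 * δ) x := fun hx hxp => by
    refine lt_of_lt_of_le ?_ (log_sub_log_le_meanPotential (hne hx) (hdist _))
    exact sub_pos.2 (Real.log_lt_log (by positivity) (by linarith))
  have hneg : ∀ {x}, 6 * δ ≤ dist x p → meanPotential y (4 * δ) x < 0 := fun {x} hxp => by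
    refine (meanPotential_le_log_sub_log (s := 5 * δ) (by positivity) fun i => ?_).trans_lt ?_
    · linarith [dist_triangle x (y i) p, hy i]
    · exact sub_neg.2 (Real.log_lt_log (by positivity) (by linarith))
  refine ⟨fun hx => harmonicAt_meanPotential (hne hx), hle _, fun {x} hx hxp => ?_, hpos, hneg,
    fun hx hx0 => exists_hasDerivAt_meanPotential hδ hy (hne hx) ?_ ?_⟩
  · have hlog : Real.log (4 * δ) - Real.log (2 * δ) = Real.log 2 := by
      rw [← Real.log_div (by positivity) (by positivity), mul_div_mul_right _ _ hδ.ne']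
      norm_num
    have := log_sub_log_le_meanPotential (r := 4 * δ) (s := 2 * δ) (hne hx) fun i => by
      linarith [hdist x i]
    linarith [Real.log_two_gt_d9]
  · exact not_lt.1 fun hlt => (hpos hx hlt).ne' hx0
  · exact (not_le.1 fun hge => (hneg hge).ne hx0).le

theorem exists_boundaryPotential (hD : IsOpen D) (hDc : IsConnected D) (hp : p ∈ closure D)
    (hδ : 0 < δ) (hDδ : ∃ q ∈ D, δ ≤ dist q p) : ∃ P, BoundaryPotential D p δ P := by
  obtain ⟨K, hKD, hK, hKs⟩ := exists_isCompact_sphere_inter hD hDc hp hδ hDδ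
  obtain ⟨t, ht, htD⟩ := hK.exists_thickening_subset_open hD hKD
  obtain ⟨N, hN⟩ := exists_nat_gt (2 * max (Real.log (4 * δ / t)) 0)
  have hN0 : 0 < N := Nat.cast_pos.1 ((by positivity : (0 : ℝ) ≤ _).trans_lt hN)
  have : NeZero N := ⟨hN0.ne'⟩
  have hmem : ∀ i < N, δ / 2 + i * (δ / (2 * N)) ∈ Icc (δ / 2) δ := fun i hi => by
    have hiN : (i : ℝ) * (δ / (2 * N)) ≤ N * (δ / (2 * N)) := by gcongr
    have hNδ : N * (δ / (2 * N)) = δ / 2 := by field_simp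
    exact ⟨le_add_of_nonneg_right (by positivity), by linarith⟩
  choose! y hyK hy using fun i hi => hKs _ (hmem i hi)
  refine ⟨_, boundaryPotential_meanPotential (y := fun i : Fin N => y i) hδ
    (fun i => hKD (hyK i i.2)) (fun i => (hy i i.2).trans_le (hmem i i.2).2) fun x hx => ?_⟩
  rw [meanPotential, Fin.sum_univ_eq_sum_range
    (fun i => Real.log (4 * δ) - Real.log ‖x - y i‖), inv_mul_le_iff₀ (by positivity),
    mul_comm _ 17]
  refine sum_log_sub_log_norm_le hδ hN.le ht (fun i hi => ?_) hy
  by_contra! hlt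
  exact hx (htD (mem_thickening_iff.2 ⟨y i, hyK i hi, by rwa [dist_eq_norm]⟩))

variable {P : Plane → ℝ}

theorem BoundaryPotential.harmonicAt_affine (hP : BoundaryPotential D p δ P) (a b : ℝ) {x : Plane}
    (hx : x ∉ D) : HarmonicAt (fun x => a + b * P x) x :=
  (harmonicAt_const a).add ((hP.harmonicAt hx).const_smul (c := b))

theorem BoundaryPotential.continuousOn_affine (hP : BoundaryPotential D p δ P) (a b : ℝ) :
    ContinuousOn (fun x => a + b * P x) Dᶜ := fun _ hx =>
  (hP.harmonicAt_affine a b hx).1.continuousAt.continuousWithinAt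

end BoundaryPotential

/-! ### Boundary values of the largest subsolution -/

theorem eventually_forall_dist_le {X : Type*} [PseudoMetricSpace X] {p : X} {Q : X → Prop}
    (hQ : ∀ᶠ x in 𝓝 p, Q x) {c : ℝ} (hc : 0 < c) :
    ∀ᶠ δ in 𝓝[>] (0 : ℝ), ∀ x, dist x p ≤ c * δ → Q x := by
  obtain ⟨ε, hε, hball⟩ := Metric.eventually_nhds_iff.1 hQ
  filter_upwards [Ioo_mem_nhdsGT (div_pos hε hc)] with δ hδ x hx
  exact hball (hx.trans_lt (by simpa only [mul_comm] using (lt_div_iff₀ hc).1 hδ.2))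

section BoundaryValues

variable {D : Set Plane} {f g h v P : Plane → ℝ} {lam a b c δ L S : ℝ} {p x : Plane}

theorem maxOn_boundaryPotential_mem_subsolutionsBelow (hD : IsOpen D) (hδ : 0 < δ)
    (hP : BoundaryPotential D p δ P) (hv : v ∈ subsolutionsBelow D f g h)
    (hle : ∀ x, dist x p ≤ 6 * δ → x ∉ D →
      (x ∈ frontier D → a + c * P x ≤ g x) ∧ a + c * P x ≤ h x)
    (hfr : ∀ x ∉ D, dist x p = 6 * δ → a + c * P x ≤ v x)
    (hout : ∀ x ∉ closure D, dist x p = 6 * δ → a + c * P x < 0 ∨ x ∈ closure (posSet D v))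
    (hfb : ∀ x ∉ closure D, dist x p ≤ 6 * δ → x ∉ closure (posSet D v) → a + c * P x = 0 →
      ∀ U, FreeBoundaryConditionAt f (fun x => a + c * P x) U x) :
    maxOn (ball p (6 * δ)) v (fun x => a + c * P x) ∈ subsolutionsBelow D f g h := by
  have hsphere : ∀ x ∈ frontier (ball p (6 * δ)), dist x p = 6 * δ := fun x hx => by
    rwa [frontier_ball p (by positivity), mem_sphere] at hx
  refine maxOn_mem_subsolutionsBelow isOpen_ball hv
    ((hP.continuousOn_affine a c).mono fun x hx => hx.2)
    (fun x hx => hfr x hx.2 (hsphere x hx.1))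
    (fun x hx => (hle x (mem_ball.1 hx.1).le (notMem_of_mem_frontier hD hx.2)).1 hx.2)
    (fun x hx => (hle x (mem_ball.1 hx.1).le hx.2).2)
    (viscositySubharmonicOn_of_harmonicAt fun x hx =>
      hP.harmonicAt_affine a c (notMem_of_notMem_closure hx.2))
    (fun x hx => hout x hx.2 (hsphere x hx.1))
    fun x hx hxv hx0 _ => hfb x hx.2 (mem_ball.1 hx.1).le hxv hx0 _

theorem BoundaryPotential.freeBoundaryConditionAt (hP : BoundaryPotential D p δ P) (hδ : 0 < δ)
    (hL : 0 < L) (hx : x ∉ D) (hx0 : P x = 0) (hf : √(f x) ≤ L) (U : Set Plane) :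
    FreeBoundaryConditionAt f (fun x => 0 + 25 * δ * L * P x) U x := by
  obtain ⟨e, G, he, hG, hd⟩ := hP.exists_hasDerivAt hx hx0
  have hLG : L ≤ 25 * δ * L * G :=
    calc L = 25 * δ * L * (1 / (25 * δ)) := by field_simp
      _ ≤ 25 * δ * L * G := by gcongr
  exact freeBoundaryConditionAt_of_hasDerivAt he (by rw [hx0, mul_zero, add_zero])
    (hL.trans_le hLG) ((hd.const_mul _).const_add 0) (hf.trans hLG)

theorem Admissible.eventually_boundaryPotential (A : Admissible D f g h lam)
    (hp : p ∈ frontier D) : ∀ᶠ δ in 𝓝[>] (0 : ℝ), 0 < δ ∧ ∃ P, BoundaryPotential D p δ P := by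
  obtain ⟨q, hq⟩ := A.isConnected.nonempty
  have hqp : 0 < dist q p := dist_pos.2 fun h => notMem_of_mem_frontier A.isOpen hp (h ▸ hq)
  filter_upwards [Ioc_mem_nhdsGT hqp] with δ hδ
  exact ⟨hδ.1, exists_boundaryPotential A.isOpen A.isConnected (frontier_subset_closure hp) hδ.1
    ⟨q, hq, hδ.2⟩⟩

theorem Admissible.eventually_le_bounds (A : Admissible D f g h lam) (hp : p ∈ frontier D)
    (hb : b < g p) : ∀ᶠ x in 𝓝 p, x ∉ D → (x ∈ frontier D → b ≤ g x) ∧ b ≤ h x := by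
  have hpD := notMem_of_mem_frontier A.isOpen hp
  filter_upwards [eventually_nhdsWithin_iff.1 ((A.g_cont p hp).eventually (lt_mem_nhds hb)),
    eventually_nhdsWithin_iff.1
      ((A.h_cont p hpD).eventually (lt_mem_nhds (hb.trans_le (A.g_le_h p hp))))] with x hg hh hxD
  exact ⟨fun hx => (hg hx).le, (hh hxD).le⟩

theorem Admissible.exists_pos_near_frontier (A : Admissible D f g h lam) (hp : p ∈ frontier D) :
    ∃ v ∈ subsolutionsBelow D f g h, ∀ᶠ x in 𝓝 p, x ∉ D → 0 < v x := by
  have hgp := A.g_pos p hp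
  have hf : ∀ᶠ x in 𝓝 p, √(f x) ≤ √(f p + 1) := by
    filter_upwards [A.f_cont.continuousAt.eventually (gt_mem_nhds (lt_add_one (f p)))] with x hx
      using Real.sqrt_le_sqrt hx.le
  set L := √(f p + 1)
  have hL : 0 < L := Real.sqrt_pos.2 (by linarith [A.lam_pos, A.lam_lt p])
  obtain ⟨δ, ⟨hδ, P, hP⟩, hbounds, hδg⟩ := ((A.eventually_boundaryPotential hp).and
    ((eventually_forall_dist_le ((A.eventually_le_bounds hp (half_lt_self hgp)).and hf)
      (c := 6) (by norm_num)).and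
    (Ioc_mem_nhdsGT (show 0 < g p / 2 / (425 * L) by positivity)))).exists
  have hPle : ∀ x ∉ D, 0 + 25 * δ * L * P x ≤ g p / 2 := fun x hx =>
    calc 0 + 25 * δ * L * P x ≤ 0 + 25 * δ * L * 17 := by gcongr; exact hP.le hx
      _ = δ * (425 * L) := by ring
      _ ≤ g p / 2 := (le_div_iff₀ (by positivity)).1 hδg.2
  have hneg : ∀ x, dist x p = 6 * δ → 0 + 25 * δ * L * P x < 0 := fun x hx => by
    rw [zero_add]
    exact mul_neg_of_pos_of_neg (by positivity) (hP.neg hx.ge)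
  refine ⟨_, maxOn_boundaryPotential_mem_subsolutionsBelow A.isOpen hδ hP
    A.zero_mem_subsolutionsBelow (fun x hx hxD => ?_) (fun x _ hx => (hneg x hx).le)
    (fun x _ hx => Or.inl (hneg x hx)) fun x hxc hx _ hx0 => ?_, ?_⟩
  · obtain ⟨hg, hh⟩ := (hbounds x hx).1 hxD
    exact ⟨fun hxfr => (hPle x hxD).trans (hg hxfr), (hPle x hxD).trans hh⟩
  · refine hP.freeBoundaryConditionAt hδ hL (notMem_of_notMem_closure hxc) ?_ (hbounds x hx).2
    rw [zero_add] at hx0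
    exact (mul_eq_zero.1 hx0).resolve_left (by positivity)
  · filter_upwards [ball_mem_nhds p (show 0 < 3 * δ by positivity)] with x hx hxD
    have hPx := hP.pos hxD hx
    refine lt_of_lt_of_le ?_ (le_maxOn_right (ball_subset_ball (by linarith) hx))
    positivity

theorem Admissible.exists_sub_mul_le_near_frontier (A : Admissible D f g h lam)
    (hp : p ∈ frontier D) (hb : b < g p) (hS : 0 < S) (hv : v ∈ subsolutionsBelow D f g h)
    (hvS : ∀ᶠ x in 𝓝 p, x ∉ D → 0 < v x ∧ b - S ≤ v x) :
    ∃ w ∈ subsolutionsBelow D f g h, ∀ᶠ x in 𝓝 p, x ∉ D → 0 < w x ∧ b - S * (33 / 34) ≤ w x := by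
  obtain ⟨δ, ⟨hδ, P, hP⟩, hbounds⟩ := ((A.eventually_boundaryPotential hp).and
    (eventually_forall_dist_le ((A.eventually_le_bounds hp hb).and hvS)
      (c := 6) (by norm_num))).exists
  have hPle : ∀ x ∉ D, b - S + S / 17 * P x ≤ b := fun x hx =>
    calc b - S + S / 17 * P x ≤ b - S + S / 17 * 17 := by gcongr; exact hP.le hx
      _ = b := by ring
  have hPfr : ∀ x, dist x p = 6 * δ → b - S + S / 17 * P x ≤ b - S := fun x hx => by
    linarith [mul_neg_of_pos_of_neg (show 0 < S / 17 by positivity) (hP.neg hx.ge)]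
  have hmem : ∀ x ∉ closure D, dist x p ≤ 6 * δ → x ∈ posSet D v := fun x hxc hx =>
    have hxD := notMem_of_notMem_closure hxc
    ⟨hxD, ((hbounds x hx).2 hxD).1⟩
  refine ⟨_, maxOn_boundaryPotential_mem_subsolutionsBelow A.isOpen hδ hP hv
    (fun x hx hxD => ?_) (fun x hxD hx => (hPfr x hx).trans ((hbounds x hx.le).2 hxD).2)
    (fun x hxc hx => Or.inr (subset_closure (hmem x hxc hx.le)))
    (fun x hxc hx hxv => absurd (subset_closure (hmem x hxc hx)) hxv), ?_⟩
  · obtain ⟨hg, hh⟩ := (hbounds x hx).1 hxD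
    exact ⟨fun hxfr => (hPle x hxD).trans (hg hxfr), (hPle x hxD).trans hh⟩
  · filter_upwards [closedBall_mem_nhds p hδ] with x hx hxD
    have hxδ : dist x p < 6 * δ := (mem_closedBall.1 hx).trans_lt (by linarith)
    refine ⟨((hbounds x hxδ.le).2 hxD).1.trans_le (le_maxOn_left x), ?_⟩
    refine le_trans ?_ (le_maxOn_right (mem_ball.2 hxδ))
    nlinarith [hP.half_le hxD hx]

theorem IsSubsolution.le_affine_boundaryPotential (hv : IsSubsolution D f g v) (hD : IsOpen D)
    (hP : BoundaryPotential D p δ P) (hnonneg : ∀ x ∉ D, 0 ≤ a + c * P x)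
    (hfr : ∀ x ∉ D, dist x p ≤ 6 * δ → x ∈ frontier D ∨ dist x p = 6 * δ → v x ≤ a + c * P x) :
    ∀ x ∉ D, dist x p < 6 * δ → v x ≤ a + c * P x := fun x hxD hx => by
  by_cases hxc : x ∈ closure D
  · exact hfr x hxD hx.le (Or.inl (hD.frontier_eq ▸ ⟨hxc, hxD⟩))
  set O := ball p (6 * δ) \ closure D
  have hO : IsOpen O := isOpen_ball.sdiff isClosed_closure
  have hclO : ∀ x ∈ closure O, x ∉ D ∧ dist x p ≤ 6 * δ := fun x hx =>
    ⟨closure_minimal (fun y hy => notMem_of_notMem_closure hy.2) hD.isClosed_compl hx,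
      closure_ball_subset_closedBall (closure_mono sdiff_subset hx)⟩
  have hharm : ∀ z ∈ O, HarmonicAt (fun x => a + c * P x) z := fun z hz =>
    hP.harmonicAt_affine a c (notMem_of_notMem_closure hz.2)
  refine ViscositySubharmonicOn.le_of_le_frontier hO (isBounded_ball.subset sdiff_subset)
    (hv.continuousOn.mono fun z hz => (hclO z hz).1)
    ((hP.continuousOn_affine a c).mono fun z hz => (hclO z hz).1)
    (hv.subharmonic.mono fun z hz => ⟨⟨notMem_of_notMem_closure hz.1.2, ?_⟩, hz.1.2⟩)
    (fun z hz => (hharm z hz).1) (fun z hz => (hharm z hz).2.self_of_nhds.le)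
    (fun z hz => ?_) x (subset_closure ⟨hx, hxc⟩)
  · exact (hnonneg z (notMem_of_notMem_closure hz.1.2)).trans_lt hz.2
  · rw [hO.frontier_eq] at hz
    obtain ⟨hzD, hzp⟩ := hclO z hz.1
    refine hfr z hzD hzp (or_iff_not_imp_left.2 fun hzfr => ?_)
    refine hzp.antisymm (not_lt.1 fun hlt => hz.2 ⟨hlt, fun hzc => hzfr ?_⟩)
    exact hD.frontier_eq ▸ ⟨hzc, hzD⟩

theorem Admissible.eventually_le_add_mul_of_le_add (A : Admissible D f g h lam)
    (hp : p ∈ frontier D) (hb : g p < b) (hS : 0 < S)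
    (hvS : ∀ᶠ x in 𝓝 p, x ∉ D → ∀ v ∈ subsolutionsBelow D f g h, v x ≤ b + S) :
    ∀ᶠ x in 𝓝 p, x ∉ D → ∀ v ∈ subsolutionsBelow D f g h, v x ≤ b + S * (33 / 34) := by
  obtain ⟨δ, ⟨hδ, P, hP⟩, hbounds⟩ := ((A.eventually_boundaryPotential hp).and
    (eventually_forall_dist_le ((eventually_nhdsWithin_iff.1
      ((A.g_cont p hp).eventually (gt_mem_nhds hb))).and hvS) (c := 6) (by norm_num))).exists
  have hbP : ∀ x ∉ D, b ≤ b + S + -(S / 17) * P x := fun x hx => by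
    linarith [mul_le_mul_of_nonneg_left (hP.le hx) (show 0 ≤ S / 17 by positivity)]
  have hSP : ∀ x, dist x p = 6 * δ → b + S ≤ b + S + -(S / 17) * P x := fun x hx => by
    linarith [mul_neg_of_pos_of_neg (show 0 < S / 17 by positivity) (hP.neg hx.ge)]
  filter_upwards [closedBall_mem_nhds p hδ] with x hx hxD v hv
  refine (hv.1.le_affine_boundaryPotential A.isOpen hP
    (fun z hz => ((A.g_pos p hp).trans hb).le.trans (hbP z hz)) (fun z hzD hzp hz => ?_) x hxD
    ((mem_closedBall.1 hx).trans_lt (by linarith))).trans (?_ : b + S + -(S / 17) * P x ≤ _)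
  · rcases hz with hzfr | hzs
    · exact (hv.1.le_boundary z hzfr).trans ((hbounds z hzp).1 hzfr).le |>.trans (hbP z hzD)
    · exact ((hbounds z hzp).2 hzD v hv).trans (hSP z hzs)
  · nlinarith [hP.half_le hxD hx]

theorem exists_add_mul_pow_lt {b b' : ℝ} (hb : b < b') (S : ℝ) :
    ∃ k : ℕ, b + S * (33 / 34 : ℝ) ^ k < b' := by
  have hpow : Tendsto (fun k : ℕ => b + S * (33 / 34 : ℝ) ^ k) atTop (𝓝 (b + S * 0)) :=
    ((tendsto_pow_atTop_nhds_zero_of_lt_one (by norm_num) (by norm_num)).const_mul S).const_add b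
  rw [mul_zero, add_zero] at hpow
  exact (hpow.eventually (gt_mem_nhds hb)).exists

theorem Admissible.eventually_lt_largest_of_mem_frontier (A : Admissible D f g h lam)
    (hp : p ∈ frontier D) (hb : b < g p) :
    ∀ᶠ x in 𝓝 p, x ∉ D → b < largestSubsolution D f g h x := by
  obtain ⟨b', hb', hb'g⟩ := exists_between (max_lt hb (A.g_pos p hp))
  have hb'0 : 0 < b' := (le_max_right _ _).trans_lt hb'
  have hiter : ∀ k : ℕ, ∃ v ∈ subsolutionsBelow D f g h,
      ∀ᶠ x in 𝓝 p, x ∉ D → 0 < v x ∧ b' - b' * (33 / 34) ^ k ≤ v x := fun k => by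
    induction k with
    | zero =>
      obtain ⟨v, hv, hpos⟩ := A.exists_pos_near_frontier hp
      exact ⟨v, hv, hpos.mono fun x hx hxD => ⟨hx hxD, by simpa using (hx hxD).le⟩⟩
    | succ k ih =>
      obtain ⟨v, hv, hvb⟩ := ih
      simpa only [pow_succ, mul_assoc] using
        A.exists_sub_mul_le_near_frontier hp hb'g (by positivity) hv hvb
  obtain ⟨k, hk⟩ := exists_add_mul_pow_lt (neg_lt_neg ((le_max_left _ _).trans_lt hb')) b'
  obtain ⟨v, hv, hvb⟩ := hiter k
  filter_upwards [hvb] with x hx hxD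
  linarith [(hx hxD).2, le_largestSubsolution hv hxD]

theorem Admissible.eventually_largest_lt_of_mem_frontier (A : Admissible D f g h lam)
    (hp : p ∈ frontier D) (hb : g p < b) :
    ∀ᶠ x in 𝓝 p, x ∉ D → largestSubsolution D f g h x < b := by
  obtain ⟨b', hgb', hb'⟩ := exists_between hb
  have hpD := notMem_of_mem_frontier A.isOpen hp
  have hB : 0 < h p + 1 := by linarith [A.h_nonneg p hpD]
  have hiter : ∀ k : ℕ, ∀ᶠ x in 𝓝 p, x ∉ D →
      ∀ v ∈ subsolutionsBelow D f g h, v x ≤ b' + (h p + 1) * (33 / 34) ^ k := fun k => by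
    induction k with
    | zero =>
      filter_upwards [eventually_nhdsWithin_iff.1
        ((A.h_cont p hpD).eventually (gt_mem_nhds (lt_add_one (h p))))] with x hx hxD v hv
      linarith [hx hxD, hv.2 x hxD, A.g_pos p hp]
    | succ k ih =>
      simpa only [pow_succ, mul_assoc] using
        A.eventually_le_add_mul_of_le_add hp hgb' (by positivity) ih
  obtain ⟨k, hk⟩ := exists_add_mul_pow_lt hb' (h p + 1)
  filter_upwards [hiter k] with x hx hxD
  exact (A.largest_le fun v hv => hx hxD v hv).trans_lt hk

theorem Admissible.largest_le_boundary (A : Admissible D f g h lam) (hp : p ∈ frontier D) :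
    largestSubsolution D f g h p ≤ g p :=
  A.largest_le fun _ hv => hv.1.le_boundary p hp

theorem Admissible.continuousOn_largest (A : Admissible D f g h lam) :
    ContinuousOn (largestSubsolution D f g h) Dᶜ := fun p hpD => by
  by_cases hpc : p ∈ closure D
  · have hp : p ∈ frontier D := A.isOpen.frontier_eq ▸ ⟨hpc, hpD⟩
    have hval : largestSubsolution D f g h p = g p := (A.largest_le_boundary hp).antisymm
      (le_of_forall_lt fun b hb =>
        (A.eventually_lt_largest_of_mem_frontier hp hb).self_of_nhds hpD)
    rw [ContinuousWithinAt, hval, tendsto_order]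
    exact ⟨fun b hb => eventually_nhdsWithin_iff.2 (A.eventually_lt_largest_of_mem_frontier hp hb),
      fun b hb => eventually_nhdsWithin_iff.2 (A.eventually_largest_lt_of_mem_frontier hp hb)⟩
  · exact (A.continuousAt_largest hpc).continuousWithinAt

end BoundaryValues

/-! ### The largest subsolution is a subsolution -/

section Subharmonicity

variable {D : Set Plane} {f g h v φ ψ : Plane → ℝ} {x : Plane} {r c lam : ℝ}

theorem exists_laplacian_add_norm_sq_nonpos (hφ : ContDiffAt ℝ 2 φ x)
    (hneg : Laplacian.laplacian φ x < 0) :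
    ∃ η : ℝ, 0 < η ∧ ∀ᶠ y in 𝓝 x, ContDiffAt ℝ 2 (φ + η • fun z => ‖z - x‖ ^ 2) y ∧
      Laplacian.laplacian (φ + η • fun z => ‖z - x‖ ^ 2) y ≤ 0 := by
  have hq : ContDiffAt ℝ 2 (fun z : Plane => ‖z - x‖ ^ 2) x := (contDiff_norm_sub_sq x).contDiffAt
  set η := -Laplacian.laplacian φ x / 8 with hη
  have hψ : ContDiffAt ℝ 2 (φ + η • fun z => ‖z - x‖ ^ 2) x := hφ.add (hq.const_smul η)
  have hΔ : Laplacian.laplacian (φ + η • fun z => ‖z - x‖ ^ 2) x < 0 := by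
    have hadd : Laplacian.laplacian (φ + η • fun z => ‖z - x‖ ^ 2) x =
        Laplacian.laplacian φ x + Laplacian.laplacian (η • fun z => ‖z - x‖ ^ 2) x :=
      hφ.laplacian_add (hq.const_smul η)
    rw [hadd, laplacian_smul η hq, laplacian_norm_sub_sq, finrank_euclideanSpace_fin, smul_eq_mul]
    push_cast
    linarith
  refine ⟨η, by linarith, ?_⟩
  filter_upwards [hψ.eventually (by simp), (continuousAt_laplacian hψ).eventually (gt_mem_nhds hΔ)]
    with y hy hy' using ⟨hy, hy'.le⟩

theorem ViscositySubharmonicOn.le_add_of_sphere (hv : ViscositySubharmonicOn v (ball x r))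
    (hr : 0 < r) (hvc : ContinuousOn v (closedBall x r))
    (hψ : ∀ y ∈ closedBall x r, ContDiffAt ℝ 2 ψ y ∧ Laplacian.laplacian ψ y ≤ 0)
    (hle : ∀ y ∈ sphere x r, v y ≤ ψ y + c) : v x ≤ ψ x + c := by
  have hψc : ∀ y ∈ closedBall x r, ContDiffAt ℝ 2 (ψ + fun _ => c) y := fun y hy =>
    (hψ y hy).1.add contDiffAt_const
  refine ViscositySubharmonicOn.le_of_le_frontier (w := ψ + fun _ => c) isOpen_ball isBounded_ball
    ?_ ?_ (hv.mono fun y hy => hy.1) (fun y hy => hψc y (ball_subset_closedBall hy)) ?_ ?_ x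
    (subset_closure (mem_ball_self hr))
  · rwa [closure_ball x hr.ne']
  · rw [closure_ball x hr.ne']
    exact fun y hy => (hψc y hy).continuousAt.continuousWithinAt
  · intro y hy
    have hψy := hψ y (ball_subset_closedBall hy)
    rw [hψy.1.laplacian_add contDiffAt_const, (harmonicAt_const c).2.self_of_nhds]
    simpa using hψy.2
  · rwa [frontier_ball x hr.ne']

theorem Admissible.viscositySubharmonicOn_largest (A : Admissible D f g h lam) :
    ViscositySubharmonicOn (largestSubsolution D f g h)
      (posSet D (largestSubsolution D f g h) \ closure D) := by
  set u := largestSubsolution D f g h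
  rintro x ⟨⟨-, hx0⟩, hxc⟩ φ hφ hmax
  by_contra! hneg
  obtain ⟨η, hη, hψ⟩ := exists_laplacian_add_norm_sq_nonpos hφ hneg
  obtain ⟨v₀, hv₀, hv₀x⟩ := A.exists_lt_of_lt_largest hx0
  obtain ⟨r, hr, hball⟩ := nhds_basis_closedBall.eventually_iff.1 ((hψ.and hmax).and
    ((eventually_mem_posSet hv₀.1.continuousOn hxc hv₀x).and
      (isClosed_closure.isOpen_compl.eventually_mem hxc)))
  have hle : ∀ v ∈ subsolutionsBelow D f g h, v x ≤ u x - η * r ^ 2 := by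
    intro v hv
    have hw := sup_mem_subsolutionsBelow hv hv₀
    have hpos : ∀ y ∈ closedBall x r, y ∈ posSet D (v ⊔ v₀) \ closure D := fun y hy =>
      ⟨⟨(hball hy).2.1.1, lt_sup_of_lt_right (hball hy).2.1.2⟩, (hball hy).2.2⟩
    have hcomp := (hw.1.subharmonic.mono fun y hy =>
      hpos y (ball_subset_closedBall hy)).le_add_of_sphere (c := u x - φ x - η * r ^ 2) hr
        (hw.1.continuousOn.mono fun y hy => (hpos y hy).1.1) (fun y hy => (hball hy).1.1)
        fun y hy => by
          have hyb := sphere_subset_closedBall hy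
          have hwu := le_largestSubsolution hw (hpos y hyb).1.1
          have htouch := (hball hyb).1.2
          simp only [Pi.add_apply, Pi.smul_apply, smul_eq_mul, ← dist_eq_norm, mem_sphere.1 hy]
          linarith
    simp only [Pi.add_apply, Pi.smul_apply, smul_eq_mul, sub_self, norm_zero] at hcomp
    linarith [le_sup_left.trans hcomp]
  have hgap : 0 < η * r ^ 2 := by positivity
  linarith [A.largest_le hle]

end Subharmonicity

section Touching

variable {D S : Set Plane} {f g v w : Plane → ℝ} {p q x z ν : Plane} {α κ σ B : ℝ}

theorem belowPlane_of_hasFDerivAt (hα : 0 ≤ α) (hwq : w q = 0)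
    (hw : HasFDerivAt w (α • innerSL ℝ ν) q) (hv : ∀ᶠ x in 𝓝 q, v x ≤ max (w x) 0) :
    BelowPlane v q ν α := by
  intro ε hε
  filter_upwards [hv, (hasFDerivAt_iff_isLittleO.1 hw).def hε] with x hvx hwx
  refine hvx.trans (max_le ?_ (by positivity))
  simp only [hwq, sub_zero, FunLike.coe_smul, Pi.smul_apply, innerSL_apply_apply, smul_eq_mul,
    Real.norm_eq_abs] at hwx
  rw [real_inner_comm] at hwx
  calc w x ≤ α * inner ℝ (x - q) ν + ε * ‖x - q‖ := by
        linarith [le_abs_self (w x - α * inner ℝ (x - q) ν)]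
    _ ≤ _ := by
      gcongr
      exact le_max_left _ _

theorem belowPlane_of_le_logProfile (hσ : 0 < σ) (hB : 0 ≤ B) (hqz : dist q z = σ)
    (hv : ∀ᶠ x in 𝓝 q, v x ≤ max (logProfile z (-B) σ x) 0) :
    BelowPlane v q (σ⁻¹ • (q - z)) (B / σ) := by
  have hqz' : ‖q - z‖ = σ := by rw [← dist_eq_norm, hqz]
  refine belowPlane_of_hasFDerivAt (by positivity) ?_ ?_ hv
  · rw [logProfile, hqz', sub_self, mul_zero]
  · refine (hasFDerivAt_logProfile (dist_pos.1 (hqz ▸ hσ))).congr_fderiv ?_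
    rw [hqz', map_smul, smul_smul, neg_div, neg_neg]
    congr 1
    field_simp

theorem nonpos_of_mem_closure_of_disjoint (hv : ContinuousOn v Dᶜ) (hS : Disjoint S (posSet D v))
    (hx : x ∉ closure D) (hxS : x ∈ closure S) : v x ≤ 0 := by
  by_contra! hpos
  obtain ⟨y, hyS, hyv⟩ := ((mem_closure_iff_frequently.1 hxS).and_eventually
    (eventually_mem_posSet hv hx hpos)).exists
  exact disjoint_left.1 hS hyS hyv

theorem logProfile_neg_nonneg (hσ : 0 < σ) (hB : 0 ≤ B) (hx : σ ≤ dist x z) :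
    0 ≤ logProfile z (-B) σ x := by
  rw [dist_eq_norm] at hx
  exact mul_nonneg_of_nonpos_of_nonpos (neg_nonpos.2 hB) (sub_nonpos.2 (Real.log_le_log hσ hx))

theorem IsSubsolution.le_logProfile (hv : IsSubsolution D f g v) (hσ : 0 < σ) (hB : 0 ≤ B)
    (hdisj : Disjoint (ball z σ) (posSet D v)) (hD : Disjoint (closedBall p κ) (closure D))
    (hle : ∀ x, dist x p = κ → σ ≤ dist x z → v x ≤ logProfile z (-B) σ x) :
    ∀ x ∈ ball p κ, v x ≤ max (logProfile z (-B) σ x) 0 := by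
  have hzero : ∀ x ∈ closedBall p κ, dist x z ≤ σ → v x ≤ 0 := fun x hx hxσ =>
    nonpos_of_mem_closure_of_disjoint hv.continuousOn hdisj (notMem_closure_of_disjoint hD hx)
      (by rwa [closure_ball z hσ.ne'])
  have hO : IsOpen (ball p κ \ closedBall z σ) := isOpen_ball.sdiff isClosed_closedBall
  have hcl : ∀ x ∈ closure (ball p κ \ closedBall z σ), x ∈ closedBall p κ ∧ σ ≤ dist x z :=
    closure_minimal (fun y hy => ⟨ball_subset_closedBall hy.1, (not_le.1 hy.2).le⟩)
      (isClosed_closedBall.inter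
        (isClosed_le continuous_const (continuous_id.dist continuous_const)))
  have hpos : ∀ x ∈ closure (ball p κ \ closedBall z σ), 0 ≤ logProfile z (-B) σ x := fun x hx =>
    logProfile_neg_nonneg hσ hB (hcl x hx).2
  have hharm : ∀ x ∈ closure (ball p κ \ closedBall z σ), HarmonicAt (logProfile z (-B) σ) x :=
    fun x hx => harmonicAt_logProfile (dist_pos.1 (hσ.trans_le (hcl x hx).2))
  have hcomp := ViscositySubharmonicOn.le_of_le_frontier hO (isBounded_ball.subset sdiff_subset)
    (hv.continuousOn.mono fun x hx =>
      notMem_of_notMem_closure (notMem_closure_of_disjoint hD (hcl x hx).1))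
    (fun x hx => (hharm x hx).1.continuousAt.continuousWithinAt)
    (hv.subharmonic.mono fun x hx =>
      have hxc := notMem_closure_of_disjoint hD (ball_subset_closedBall hx.1.1)
      ⟨⟨notMem_of_notMem_closure hxc, (hpos x (subset_closure hx.1)).trans_lt hx.2⟩, hxc⟩)
    (fun x hx => (hharm x (subset_closure hx)).1)
    (fun x hx => (hharm x (subset_closure hx)).2.self_of_nhds.le) (fun x hx => by
      obtain ⟨hxp, hxz⟩ := hcl x (frontier_subset_closure hx)
      rw [hO.frontier_eq] at hx
      by_cases hxκ : dist x p = κ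
      · exact hle x hxκ hxz
      · have hxσ : dist x z ≤ σ := by
          by_contra! hlt
          exact hx.2 ⟨lt_of_le_of_ne hxp hxκ, not_le.2 hlt⟩
        exact (hzero x hxp hxσ).trans (hpos x hx.1))
  intro x hx
  by_cases hxσ : dist x z ≤ σ
  · exact (hzero x (ball_subset_closedBall hx) hxσ).trans (le_max_right _ _)
  · exact (hcomp x (subset_closure ⟨hx, hxσ⟩)).trans (le_max_left _ _)

theorem IsSubsolution.sqrt_le_of_touching (hv : IsSubsolution D f g v) (hσ : 0 < σ) (hB : 0 ≤ B)
    (hdisj : Disjoint (ball z σ) (posSet D v)) (hD : Disjoint (closedBall p κ) (closure D))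
    (hle : ∀ x, dist x p = κ → σ ≤ dist x z → v x ≤ logProfile z (-B) σ x)
    (hq : q ∈ closure (posSet D v)) (hqz : dist q z = σ) (hqp : q ∈ ball p κ) : √(f q) ≤ B / σ := by
  have hqc := notMem_closure_of_disjoint hD (ball_subset_closedBall hqp)
  have hqfr : q ∈ frontier (posSet D v) := by
    refine ⟨hq, fun hi => (interior_subset hi).2.not_ge ?_⟩
    refine nonpos_of_mem_closure_of_disjoint hv.continuousOn hdisj hqc ?_
    rw [closure_ball z hσ.ne']
    exact hqz.le
  refine hv.freeBoundary q ⟨hqfr, hqc⟩ z σ hσ hqz hdisj _ (belowPlane_of_le_logProfile hσ hB hqz ?_)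
  filter_upwards [isOpen_ball.mem_nhds hqp] with x hx
  exact hv.le_logProfile hσ hB hdisj hD hle x hx

end Touching

section TangentBall

variable {P : Set Plane} {p x ν : Plane} {s κ σ η : ℝ}

theorem norm_sub_sub_smul_sq (hν : ‖ν‖ = 1) (x p : Plane) (σ : ℝ) :
    ‖x - (p - σ • ν)‖ ^ 2 = ‖x - p‖ ^ 2 + 2 * σ * inner ℝ (x - p) ν + σ ^ 2 := by
  rw [← sub_add, norm_add_sq_real, inner_smul_right, norm_smul, hν, mul_one, Real.norm_eq_abs,
    sq_abs, mul_assoc]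

theorem neg_norm_sq_le_mul_inner (hν : ‖ν‖ = 1) (hs : 0 ≤ s) (hx : x ∉ ball (p - s • ν) s) :
    -‖x - p‖ ^ 2 ≤ 2 * s * inner ℝ (x - p) ν := by
  rw [mem_ball, dist_eq_norm, not_lt] at hx
  have hsq := norm_sub_sub_smul_sq hν x p s
  have hle : s ^ 2 ≤ ‖x - (p - s • ν)‖ ^ 2 := by gcongr
  linarith

theorem norm_sq_add_sq_le_norm_sub_sq (hν : ‖ν‖ = 1) (hs : 0 < s) (hσ : 0 ≤ σ) (hσs : 2 * σ ≤ s)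
    (hx : x ∉ ball (p - s • ν) s) : ‖x - p‖ ^ 2 / 2 + σ ^ 2 ≤ ‖x - (p - σ • ν)‖ ^ 2 := by
  have hinner : -‖x - p‖ ^ 2 / 2 ≤ 2 * σ * inner ℝ (x - p) ν :=
    calc -‖x - p‖ ^ 2 / 2 = 1 / 2 * -‖x - p‖ ^ 2 := by ring
      _ ≤ σ / s * -‖x - p‖ ^ 2 := by
        refine mul_le_mul_of_nonpos_right ?_ (neg_nonpos.2 (sq_nonneg _))
        rw [div_le_div_iff₀ hs two_pos]
        linarith
      _ ≤ σ / s * (2 * s * inner ℝ (x - p) ν) := by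
        gcongr
        exact neg_norm_sq_le_mul_inner hν hs.le hx
      _ = 2 * σ * inner ℝ (x - p) ν := by field_simp
  rw [norm_sub_sub_smul_sq hν]
  linarith

theorem exists_nearest_mem_ball (hν : ‖ν‖ = 1) (hs : 0 < s) (hσ : 0 ≤ σ) (hσs : 2 * σ ≤ s)
    (hP : Disjoint (ball (p - s • ν) s) P) (hx : x ∈ P) (hxη : dist x p ≤ η) (hκ : 0 < κ)
    (hη : η * (2 * σ + η) < κ ^ 2 / 2) :
    ∃ q ∈ closure P, Disjoint (ball (p - σ • ν) (dist q (p - σ • ν))) P ∧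
      σ ≤ dist q (p - σ • ν) ∧ dist q (p - σ • ν) ≤ σ + η ∧ q ∈ ball p κ := by
  set z := p - σ • ν with hz
  have hpz : dist p z = σ := by
    rw [dist_eq_norm, hz, sub_sub_cancel, norm_smul, hν, mul_one, Real.norm_of_nonneg hσ]
  obtain ⟨q, hq, hqz⟩ := isClosed_closure.exists_infDist_eq_dist ⟨x, subset_closure hx⟩ z
  rw [infDist_closure, dist_comm] at hqz
  have hfar := norm_sq_add_sq_le_norm_sub_sq hν hs hσ hσs
    (disjoint_right.1 (hP.closure_right isOpen_ball) hq)
  rw [← hz, ← dist_eq_norm, ← dist_eq_norm] at hfar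
  have hle : dist q z ≤ σ + η := calc
    dist q z ≤ dist z x := hqz ▸ infDist_le_dist_of_mem hx
    _ ≤ dist z p + dist p x := dist_triangle _ _ _
    _ ≤ σ + η := by rw [dist_comm z, hpz, dist_comm p]; gcongr
  have hle_sq : dist q z ^ 2 ≤ (σ + η) ^ 2 := by gcongr
  refine ⟨q, hq, ?_, ?_, hle, ?_⟩
  · rw [← hqz]
    exact disjoint_ball_infDist
  · exact le_of_sq_le_sq (by linarith [sq_nonneg (dist q p)]) dist_nonneg
  · exact lt_of_pow_lt_pow_left₀ 2 hκ.le (by linarith)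

end TangentBall

section FreeBoundaryOfLargest

variable {D : Set Plane} {f g h u v : Plane → ℝ} {p z x ν : Plane}
  {s α α' β ε η κ L lam σ₀ σ : ℝ}

theorem div_le_mul_log_one_add (hL : 1 ≤ L) (hβ : -(1 / (4 * L)) ≤ β) (hβ1 : β ≤ 1) :
    (1 / (2 * L) + β) / (1 + 3 / (2 * L)) ≤
      L * (1 / 2 * Real.log (1 + (1 / L ^ 2 + 2 * β / L))) := by
  have : 0 < L := one_pos.trans_le hL
  set X := 1 / L ^ 2 + 2 * β / L with hX
  have hX0 : 0 ≤ X := by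
    have hXeq : X = 2 / L * (1 / (2 * L) + β) := by rw [hX]; field_simp
    have hquarter : 1 / (2 * L) = 2 * (1 / (4 * L)) := by ring
    have hpos : 0 < 1 / (4 * L) := by positivity
    rw [hXeq]
    exact mul_nonneg (by positivity) (by linarith)
  have hX3 : X ≤ 3 / L :=
    calc X ≤ 1 / L + 2 * 1 / L := by
          rw [hX]
          gcongr
          exact le_self_pow₀ hL two_ne_zero
      _ = 3 / L := by ring
  calc (1 / (2 * L) + β) / (1 + 3 / (2 * L)) = L * (1 / 2 * (2 * X / (3 / L + 2))) := by
        rw [hX]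
        field_simp
        ring
    _ ≤ L * (1 / 2 * (2 * X / (X + 2))) := by gcongr
    _ ≤ L * (1 / 2 * Real.log (1 + X)) := by
        gcongr
        exact Real.le_log_one_add_of_nonneg hX0

theorem exists_mul_max_add_le_mul_log (hα : 0 ≤ α) (hα' : α < α') :
    ∃ L ≥ 1, ∃ ε > 0, ∀ β, -(1 / (4 * L)) ≤ β → β ≤ 1 →
      α * max β 0 + 2 * ε ≤ α' * (L * (1 / 2 * Real.log (1 + (1 / L ^ 2 + 2 * β / L)))) := by
  have hlim : Tendsto (fun L : ℝ => α * (1 + 3 / (2 * L))) atTop (𝓝 (α * (1 + 0))) :=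
    ((tendsto_const_nhds.div_atTop (tendsto_id.const_mul_atTop two_pos)).const_add 1).const_mul α
  rw [add_zero, mul_one] at hlim
  obtain ⟨L, hL, hLα⟩ := ((eventually_ge_atTop 1).and (hlim.eventually (gt_mem_nhds hα'))).exists
  have : 0 < L := one_pos.trans_le hL
  set γ := α' / (1 + 3 / (2 * L)) with hγ
  have hαγ : α ≤ γ := by
    rw [hγ, le_div_iff₀ (by positivity)]
    exact hLα.le
  have hα'0 : 0 < α' := hα.trans_lt hα'
  have hγ0 : 0 < γ := by positivity
  refine ⟨L, hL, γ * (1 / (8 * L)), by positivity, fun β hβ hβ1 => ?_⟩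
  have hhalf : 1 / (2 * L) = 4 * (1 / (8 * L)) := by ring
  have hquarter : 1 / (4 * L) = 2 * (1 / (8 * L)) := by ring
  have hpos : 0 < 1 / (8 * L) := by positivity
  calc α * max β 0 + 2 * (γ * (1 / (8 * L))) ≤ γ * max β 0 + 2 * (γ * (1 / (8 * L))) := by
        gcongr
    _ = γ * (max β 0 + 2 * (1 / (8 * L))) := by ring
    _ ≤ γ * (1 / (2 * L) + β) := by
        refine mul_le_mul_of_nonneg_left ?_ hγ0.le
        rcases max_cases β 0 with ⟨hmax, -⟩ | ⟨hmax, -⟩ <;> linarith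
    _ = α' * ((1 / (2 * L) + β) / (1 + 3 / (2 * L))) := by rw [hγ]; ring
    _ ≤ _ := by
        gcongr
        exact div_le_mul_log_one_add hL hβ hβ1

theorem logProfile_sub_smul (hν : ‖ν‖ = 1) (hL : 0 < L) (hκ : 0 < κ) (hxp : ‖x - p‖ = κ)
    (hβ : inner ℝ (x - p) ν = κ * β) (hx : x ≠ p - (L * κ) • ν) :
    logProfile (p - (L * κ) • ν) (-(α * (L * κ))) (L * κ) x =
      κ * (α * (L * (1 / 2 * Real.log (1 + (1 / L ^ 2 + 2 * β / L))))) := by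
  have hratio : ‖x - (p - (L * κ) • ν)‖ ^ 2 / (L * κ) ^ 2 = 1 + (1 / L ^ 2 + 2 * β / L) := by
    rw [norm_sub_sub_smul_sq hν, hxp, hβ]
    field_simp
    ring
  have hnorm := norm_ne_zero_iff.2 (sub_ne_zero.2 hx)
  rw [← hratio, Real.log_div (by positivity) (by positivity), Real.log_pow, Real.log_pow,
    logProfile]
  push_cast
  ring

theorem BelowPlane.eventually_add_le_logProfile (hu : BelowPlane u p ν α) (hν : ‖ν‖ = 1)
    (hs : 0 < s) (hε : 0 < ε) (hL : 1 ≤ L) (hlog : ∀ β, -(1 / (4 * L)) ≤ β → β ≤ 1 →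
      α * max β 0 + 2 * ε ≤ α' * (L * (1 / 2 * Real.log (1 + (1 / L ^ 2 + 2 * β / L))))) :
    ∀ᶠ κ in 𝓝[>] (0 : ℝ), ∀ x, dist x p = κ → x ∉ ball (p - s • ν) s →
      u x + ε * κ ≤ logProfile (p - (L * κ) • ν) (-(α' * (L * κ))) (L * κ) x := by
  have : 0 < L := one_pos.trans_le hL
  filter_upwards [eventually_forall_dist_le (hu ε hε) one_pos,
    Ioc_mem_nhdsGT (show 0 < s / (2 * L) by positivity)] with κ hκu ⟨hκ, hκs⟩ x hx hxs
  rw [le_div_iff₀ (by positivity)] at hκs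
  have hxp : ‖x - p‖ = κ := by rw [← dist_eq_norm, hx]
  set β := inner ℝ (x - p) ν / κ with hβ
  have hinner : inner ℝ (x - p) ν = κ * β := by rw [hβ]; field_simp
  have hβ1 : β ≤ 1 := by
    rw [hβ, div_le_one hκ]
    simpa only [hν, hxp, mul_one] using real_inner_le_norm (x - p) ν
  have hβL : -(1 / (4 * L)) ≤ β := by
    have hball := neg_norm_sq_le_mul_inner hν hs.le hxs
    rw [hxp, hinner] at hball
    have hsβ : -κ ≤ 2 * s * β := le_of_mul_le_mul_left (by linarith) hκ
    rw [neg_le, div_eq_mul_inv, one_mul, ← one_div, le_div_iff₀ (by positivity)]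
    by_contra! hlt
    nlinarith
  have hxz : x ≠ p - (L * κ) • ν := by
    intro hxz
    have hfar := norm_sq_add_sq_le_norm_sub_sq (σ := L * κ) hν hs (by positivity) (by linarith) hxs
    rw [← hxz, sub_self, norm_zero, hxp] at hfar
    have hpos : 0 < κ ^ 2 / 2 + (L * κ) ^ 2 := by positivity
    linarith
  have hux := hκu x (by rw [hx, one_mul])
  rw [hxp, hinner, ← mul_zero κ, ← mul_max_of_nonneg _ _ hκ.le] at hux
  rw [logProfile_sub_smul hν (by positivity) hκ hxp hinner hxz]
  calc u x + ε * κ ≤ κ * (α * max β 0 + 2 * ε) := by linarith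
    _ ≤ _ := by
      gcongr
      exact hlog β hβL hβ1

theorem logProfile_le_add_mul_sub (hα : 0 ≤ α) (hσ₀ : 0 < σ₀) (hσ : 0 < σ) :
    logProfile z (-(α * σ₀)) σ₀ x ≤ logProfile z (-(α * σ₀)) σ x + α * (σ - σ₀) := by
  have hlog : Real.log σ - Real.log σ₀ ≤ σ / σ₀ - 1 := by
    rw [← Real.log_div hσ.ne' hσ₀.ne']
    exact Real.log_le_sub_one_of_pos (by positivity)
  have hmul : α * σ₀ * (Real.log σ - Real.log σ₀) ≤ α * (σ - σ₀) :=
    calc _ ≤ α * σ₀ * (σ / σ₀ - 1) := by gcongr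
      _ = α * (σ - σ₀) := by field_simp
  simp only [logProfile]
  linarith

theorem exists_sqrt_le_of_le_logProfile (hv : IsSubsolution D f g v)
    (hdisj : Disjoint (ball (p - s • ν) s) (posSet D v))
    (hD : Disjoint (closedBall p κ) (closure D)) (hν : ‖ν‖ = 1) (hs : 0 < s) (hσ : 0 < σ)
    (hσs : 2 * σ ≤ s) (hκ : 0 < κ) (hα : 0 ≤ α) (hx : x ∈ posSet D v) (hxη : dist x p ≤ η)
    (hη : η * (2 * σ + η) < κ ^ 2 / 2)
    (habove : ∀ y, dist y p = κ → y ∈ posSet D v →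
      v y + α * η ≤ logProfile (p - σ • ν) (-(α * σ)) σ y) :
    ∃ q ∈ ball p κ, √(f q) ≤ α := by
  obtain ⟨q, hq, hqdisj, hσq, hqη, hqp⟩ :=
    exists_nearest_mem_ball hν hs hσ.le hσs hdisj hx hxη hκ hη
  set z := p - σ • ν
  have hσ' : 0 < dist q z := hσ.trans_le hσq
  have htouch : √(f q) ≤ α * σ / dist q z := by
    refine hv.sqrt_le_of_touching hσ' (by positivity) hqdisj hD (fun y hy hyσ => ?_) hq rfl hqp
    by_cases hyv : y ∈ posSet D v
    · have hshift := logProfile_le_add_mul_sub (z := z) (x := y) hα hσ hσ'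
      have hη' : α * (dist q z - σ) ≤ α * η := mul_le_mul_of_nonneg_left (by linarith) hα
      linarith [habove y hy hyv]
    · have hyD := notMem_of_notMem_closure (disjoint_left.1 hD (sphere_subset_closedBall hy))
      exact (not_lt.1 fun hpos => hyv ⟨hyD, hpos⟩).trans
        (logProfile_neg_nonneg hσ' (by positivity) hyσ)
  refine ⟨q, hqp, htouch.trans ?_⟩
  rw [div_le_iff₀ hσ']
  gcongr

theorem exists_pos_mul_le_and_mul_add_lt (hε : 0 < ε) (hκ : 0 < κ) :
    ∃ η > 0, α * η ≤ ε ∧ η * (2 * σ + η) < κ := by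
  have hlim : Tendsto (fun η : ℝ => α * η) (𝓝 0) (𝓝 0) :=
    Continuous.tendsto' (by fun_prop) _ _ (mul_zero α)
  have hlim' : Tendsto (fun η : ℝ => η * (2 * σ + η)) (𝓝 0) (𝓝 0) :=
    Continuous.tendsto' (by fun_prop) _ _ (zero_mul _)
  obtain ⟨η, ⟨hηε, hηκ⟩, hη⟩ := (((hlim.eventually (ge_mem_nhds hε)).and
    (hlim'.eventually (gt_mem_nhds hκ))).filter_mono nhdsWithin_le_nhds |>.and
    self_mem_nhdsWithin : ∀ᶠ η in 𝓝[>] (0 : ℝ), _).exists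
  exact ⟨η, hη, hηε, hηκ⟩

theorem Admissible.freeBoundaryConditionAt_largest (A : Admissible D f g h lam)
    (hp : p ∈ closure (posSet D (largestSubsolution D f g h))) (hpD : p ∉ closure D) :
    FreeBoundaryConditionAt f (largestSubsolution D f g h)
      (posSet D (largestSubsolution D f g h)) p := by
  set u := largestSubsolution D f g h
  intro y s hs hpy hdisj α hb
  by_contra! hlt
  set ν := s⁻¹ • (p - y) with hν_def
  have hν : ‖ν‖ = 1 := norm_inv_smul_sub hs hpy
  have hy : y = p - s • ν := by rw [hν_def, smul_inv_smul₀ hs.ne', sub_sub_cancel]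
  rw [hy] at hdisj
  obtain ⟨α', hαα', hα'f⟩ :=
    exists_between (max_lt hlt (Real.sqrt_pos.2 (A.lam_pos.trans (A.lam_lt p))))
  obtain ⟨L, hL, ε, hε, hlog⟩ := exists_mul_max_add_le_mul_log (le_max_right α 0) hαα'
  have : 0 < L := one_pos.trans_le hL
  obtain ⟨κ, ⟨habove, hnear⟩, hκ, hκs⟩ :=
    (((hb.mono_slope (le_max_left α 0)).eventually_add_le_logProfile hν hs hε hL hlog).and
      (eventually_forall_dist_le ((A.f_cont.sqrt.continuousAt.eventually (lt_mem_nhds hα'f)).and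
        (isClosed_closure.isOpen_compl.eventually_mem hpD)) one_pos)).and
      (Ioc_mem_nhdsGT (show 0 < s / (2 * L) by positivity)) |>.exists
  simp only [one_mul] at hnear
  rw [le_div_iff₀ (by positivity)] at hκs
  obtain ⟨η, hη, hηε, hηκ⟩ := exists_pos_mul_le_and_mul_add_lt (α := α') (σ := L * κ)
    (show 0 < ε * κ by positivity) (show 0 < κ ^ 2 / 2 by positivity)
  obtain ⟨x, hx, hxp⟩ := Metric.mem_closure_iff.1 hp η hη
  obtain ⟨v, hv, hvx⟩ := A.exists_lt_of_lt_largest hx.2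
  have hdisjv := hdisj.mono_right (posSet_subset_largest hv)
  obtain ⟨q, hq, hfq⟩ := exists_sqrt_le_of_le_logProfile hv.1 hdisjv
    (disjoint_left.2 fun x hx => (hnear x hx).2) hν hs (σ := L * κ) (η := η)
    (by positivity) (by linarith) hκ ((le_max_right _ _).trans hαα'.le) ⟨hx.1, hvx⟩
    (by rw [dist_comm]; exact hxp.le) hηκ fun y hy hyv => by
      linarith [le_largestSubsolution hv hyv.1, habove y hy (disjoint_right.1 hdisjv hyv)]
  exact hfq.not_gt (hnear q (mem_ball.1 hq).le).1

theorem Admissible.largest_mem_subsolutionsBelow (A : Admissible D f g h lam) :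
    largestSubsolution D f g h ∈ subsolutionsBelow D f g h :=
  ⟨⟨A.continuousOn_largest, fun _ => A.largest_nonneg, A.viscositySubharmonicOn_largest,
    fun _ => A.largest_le_boundary, fun _ hp => A.freeBoundaryConditionAt_largest hp.1.1 hp.2⟩,
    fun _ => A.largest_le_barrier⟩

end FreeBoundaryOfLargest

/-! ### Counting disjoint balls by the excess of circular averages -/

section CircleAvg

variable {u w : Plane → ℝ} {y : Plane} {c t : ℝ}

theorem continuous_circleAvg (hu : Continuous u) (t : ℝ) :
    Continuous fun y => circleAvg u y t := by
  simp only [circleAvg_eq_integral]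
  have hcont := continuous_unitVec
  exact continuous_const.mul
    (intervalIntegral.continuous_parametric_intervalIntegral_of_continuous'
      (f := fun y θ => u (y + t • unitVec θ)) (by fun_prop) 0 (2 * Real.pi))

theorem periodic_unitVec : Function.Periodic unitVec (2 * Real.pi) := fun θ => by
  rw [two_mul, ← add_assoc, unitVec_add_pi, unitVec_add_pi, neg_neg]

theorem integral_comp_neg_unitVec {G : Plane → ℝ} :
    ∫ θ in (0 : ℝ)..2 * Real.pi, G (-unitVec θ) = ∫ θ in (0 : ℝ)..2 * Real.pi, G (unitVec θ) := by
  have hperiod := (periodic_unitVec.comp G).intervalIntegral_add_eq Real.pi 0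
  rw [zero_add] at hperiod
  simp only [← unitVec_add_pi]
  rw [intervalIntegral.integral_comp_add_right (fun θ => G (unitVec θ)) Real.pi, zero_add,
    add_comm (2 * Real.pi)]
  exact hperiod

theorem circleAvg_eq_integral_sub (w : Plane → ℝ) (y : Plane) (t : ℝ) :
    circleAvg w y t = (2 * Real.pi)⁻¹ * ∫ θ in (0 : ℝ)..2 * Real.pi, w (y - t • unitVec θ) := by
  rw [circleAvg_eq_integral, ← integral_comp_neg_unitVec (G := fun e => w (y + t • e))]
  simp only [smul_neg, ← sub_eq_add_neg]

theorem two_mul_circleAvg_sub_le (hw : Continuous w) (ht : 0 ≤ t)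
    (h : ∀ e : Plane, ‖e‖ = t → w (y + e) + w (y - e) - 2 * w y ≤ c) :
    2 * (circleAvg w y t - w y) ≤ c := by
  have hcont := continuous_unitVec
  have hle : ∫ θ in (0 : ℝ)..2 * Real.pi, (w (y + t • unitVec θ) + w (y - t • unitVec θ)) ≤
      ∫ θ in (0 : ℝ)..2 * Real.pi, (2 * w y + c) := by
    refine intervalIntegral.integral_mono_on (by positivity)
      (Continuous.intervalIntegrable (by fun_prop) _ _)
      (Continuous.intervalIntegrable (by fun_prop) _ _) fun θ _ => ?_
    linarith [h (t • unitVec θ) (by rw [norm_smul, norm_unitVec, mul_one, Real.norm_of_nonneg ht])]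
  rw [intervalIntegral.integral_add (Continuous.intervalIntegrable (by fun_prop) _ _)
    (Continuous.intervalIntegrable (by fun_prop) _ _), intervalIntegral.integral_const, sub_zero,
    smul_eq_mul] at hle
  have hsum : 2 * circleAvg w y t = (2 * Real.pi)⁻¹ *
      ((∫ θ in (0 : ℝ)..2 * Real.pi, w (y + t • unitVec θ)) +
        ∫ θ in (0 : ℝ)..2 * Real.pi, w (y - t • unitVec θ)) := by
    rw [mul_add, ← circleAvg_eq_integral, ← circleAvg_eq_integral_sub, two_mul]
  have hscale := mul_le_mul_of_nonneg_left hle (inv_nonneg.2 Real.two_pi_pos.le)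
  rw [← hsum, inv_mul_cancel_left₀ Real.two_pi_pos.ne'] at hscale
  linarith

theorem integral_intervalIntegral_swap {F : Plane → ℝ → ℝ} {K : Set Plane} {a b : ℝ} (hab : a ≤ b)
    (hF : Continuous (Function.uncurry F)) (hK : IsCompact K) (hFK : ∀ y ∉ K, ∀ θ, F y θ = 0) :
    ∫ y, ∫ θ in a..b, F y θ = ∫ θ in a..b, ∫ y, F y θ := by
  simp only [intervalIntegral.integral_of_le hab]
  refine integral_integral_swap ?_
  rw [← Measure.restrict_univ (μ := (volume : Measure Plane)), Measure.prod_restrict]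
  refine IntegrableOn.of_forall_sdiff_eq_zero (s := K ×ˢ Ioc a b) ?_
    (MeasurableSet.univ.prod measurableSet_Ioc) fun z hz => ?_
  · exact (hF.continuousOn.integrableOn_compact (hK.prod isCompact_Icc)).mono_set
      (prod_mono le_rfl Ioc_subset_Icc_self)
  · exact hFK z.1 (fun h => hz.2 ⟨h, hz.1.2⟩) z.2

theorem sub_smul_unitVec_notMem {K : Set Plane} (hy : y ∉ cthickening |t| K) (θ : ℝ) :
    y - t • unitVec θ ∉ K := fun h => by
  refine hy (mem_cthickening_of_dist_le y _ _ _ h ?_)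
  rw [dist_self_sub_right, norm_smul, norm_unitVec, mul_one, Real.norm_eq_abs]

theorem hasCompactSupport_circleAvg (hws : HasCompactSupport w) (t : ℝ) :
    HasCompactSupport fun y => circleAvg w y t := by
  refine HasCompactSupport.intro (hws.isCompact.cthickening (r := |t|)) fun y hy => ?_
  simp only [circleAvg_eq_integral_sub,
    image_eq_zero_of_notMem_tsupport (sub_smul_unitVec_notMem hy _),
    intervalIntegral.integral_zero, mul_zero]

theorem integral_mul_circleAvg_comm (hw : Continuous w) (hws : HasCompactSupport w)
    (hu : Continuous u) (t : ℝ) :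
    ∫ y, w y * circleAvg u y t = ∫ y, circleAvg w y t * u y := by
  have hcont := continuous_unitVec
  have hshift (θ : ℝ) : ∫ y, w y * u (y + t • unitVec θ) = ∫ y, w (y - t • unitVec θ) * u y := by
    rw [← integral_add_right_eq_self (fun y => w (y - t • unitVec θ) * u y) (t • unitVec θ)]
    simp only [add_sub_cancel_right]
  have hswap := integral_intervalIntegral_swap Real.two_pi_pos.le
    (F := fun y θ => w y * u (y + t • unitVec θ)) (by unfold Function.uncurry; fun_prop)
    hws.isCompact fun y hy θ => by
      simp only [image_eq_zero_of_notMem_tsupport hy, zero_mul]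
  have hswap' := integral_intervalIntegral_swap Real.two_pi_pos.le
    (F := fun y θ => w (y - t • unitVec θ) * u y) (by unfold Function.uncurry; fun_prop)
    (hws.isCompact.cthickening (r := |t|)) fun y hy θ => by
      simp only [image_eq_zero_of_notMem_tsupport (sub_smul_unitVec_notMem hy θ), zero_mul]
  simp only [hshift, intervalIntegral.integral_const_mul, intervalIntegral.integral_mul_const]
    at hswap hswap'
  simp only [circleAvg_eq_integral u, circleAvg_eq_integral_sub w, mul_left_comm (w _), mul_assoc,
    integral_const_mul, hswap, hswap']

end CircleAvg

section Bump

variable {x y : Plane} {a c k s t : ℝ}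

/-- The cutoff `((4s² - |y - x|²)⁺)²`, supported in the ball of radius `2s` about `x`. It is
`C^{1,1}`, which is all that the second difference bounds below require. -/
noncomputable def bump (x : Plane) (s : ℝ) (y : Plane) : ℝ :=
  max (4 * s ^ 2 - ‖y - x‖ ^ 2) 0 ^ 2

theorem continuous_bump (x : Plane) (s : ℝ) : Continuous (bump x s) := by
  unfold bump
  fun_prop

theorem bump_nonneg (x : Plane) (s : ℝ) (y : Plane) : 0 ≤ bump x s y := sq_nonneg _

theorem bump_eq_zero (hs : 0 ≤ s) (hy : 2 * s ≤ dist y x) : bump x s y = 0 := by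
  rw [dist_eq_norm] at hy
  have hsq : (2 * s) ^ 2 ≤ ‖y - x‖ ^ 2 := by gcongr
  rw [bump, max_eq_right (by linarith), zero_pow two_ne_zero]

theorem le_bump (hy : dist y x ≤ s) : 9 * s ^ 4 ≤ bump x s y := by
  rw [dist_eq_norm] at hy
  have hsq : ‖y - x‖ ^ 2 ≤ s ^ 2 := by gcongr
  calc 9 * s ^ 4 = (3 * s ^ 2) ^ 2 := by ring
    _ ≤ _ := by
      unfold bump
      gcongr
      exact le_max_of_le_left (by linarith)

theorem hasCompactSupport_bump (x : Plane) (hs : 0 ≤ s) : HasCompactSupport (bump x s) :=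
  HasCompactSupport.intro (isCompact_closedBall x (2 * s)) fun _ hy =>
    bump_eq_zero hs (not_le.1 hy).le

theorem integrable_bump_mul {w : Plane → ℝ} (x : Plane) (hs : 0 ≤ s) (hw : Continuous w) :
    Integrable fun y => bump x s y * w y :=
  ((continuous_bump x s).mul hw).integrable_of_hasCompactSupport
    (hasCompactSupport_bump x hs).mul_right

theorem sq_max_zero_le_sq (r : ℝ) : max r 0 ^ 2 ≤ r ^ 2 := by
  rw [← sq_abs r]
  gcongr
  exact max_le (le_abs_self r) (abs_nonneg r)

theorem sq_max_sub_add_sq_max_add_le (hk : 0 ≤ k) :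
    max (c - a - k) 0 ^ 2 + max (c + a - k) 0 ^ 2 - 2 * max c 0 ^ 2 ≤ 2 * (a ^ 2 + k ^ 2) := by
  rcases le_total c 0 with hc | hc
  · have hsub : max (c - a - k) 0 ^ 2 ≤ max (-a) 0 ^ 2 := by gcongr; linarith
    have hadd : max (c + a - k) 0 ^ 2 ≤ max a 0 ^ 2 := by gcongr; linarith
    linarith [sq_max_zero_le_sq a, sq_max_zero_le_sq (-a), neg_sq a, sq_nonneg (max c 0),
      sq_nonneg k]
  · rw [max_eq_left hc]
    linarith [sq_max_zero_le_sq (c - a - k), sq_max_zero_le_sq (c + a - k), mul_nonneg hc hk]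

theorem bump_add_add_bump_sub_le (x y e : Plane) (s : ℝ) :
    bump x s (y + e) + bump x s (y - e) - 2 * bump x s y ≤
      2 * (2 * ‖y - x‖ * ‖e‖ + ‖e‖ ^ 2) ^ 2 := by
  have hadd : 4 * s ^ 2 - ‖y + e - x‖ ^ 2 =
      4 * s ^ 2 - ‖y - x‖ ^ 2 - 2 * inner ℝ (y - x) e - ‖e‖ ^ 2 := by
    rw [add_sub_right_comm, norm_add_sq_real]
    ring
  have hsub : 4 * s ^ 2 - ‖y - e - x‖ ^ 2 =
      4 * s ^ 2 - ‖y - x‖ ^ 2 + 2 * inner ℝ (y - x) e - ‖e‖ ^ 2 := by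
    rw [sub_right_comm, norm_sub_sq_real]
    ring
  have hinner : (2 * inner ℝ (y - x) e) ^ 2 ≤ (2 * ‖y - x‖ * ‖e‖) ^ 2 := by
    rw [← sq_abs, abs_mul, abs_two, mul_assoc]
    gcongr
    exact abs_real_inner_le_norm _ _
  have hcross : 0 ≤ 2 * ‖y - x‖ * ‖e‖ * ‖e‖ ^ 2 := by positivity
  rw [bump, bump, bump, hadd, hsub]
  refine (sq_max_sub_add_sq_max_add_le (sq_nonneg _)).trans ?_
  linarith

theorem circleAvg_bump_sub_le (ht : 0 ≤ t) (hts : t ≤ s) :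
    circleAvg (bump x s) y t - bump x s y ≤
      (closedBall x (3 * s)).indicator (fun _ => 49 * (s * t) ^ 2) y := by
  have hs := ht.trans hts
  by_cases hy : y ∈ closedBall x (3 * s)
  · rw [indicator_of_mem hy]
    rw [mem_closedBall, dist_eq_norm] at hy
    have hle := two_mul_circleAvg_sub_le (continuous_bump x s) ht (y := y)
      (c := 2 * (7 * (s * t)) ^ 2) fun e he => by
        refine (bump_add_add_bump_sub_le x y e s).trans ?_
        rw [he]
        gcongr
        calc 2 * ‖y - x‖ * t + t ^ 2 ≤ 2 * (3 * s) * t + s * t := by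
              rw [sq]
              gcongr
          _ = 7 * (s * t) := by ring
    linarith
  · rw [indicator_of_notMem hy]
    have hzero (z : Plane) (hz : z ∈ sphere y t) : bump x s z = 0 := by
      refine bump_eq_zero hs ?_
      rw [mem_sphere] at hz
      linarith [not_le.1 (mem_closedBall.not.1 hy), dist_triangle_left y x z]
    rw [circleAvg_congr ht (w := 0) hzero, circleAvg_eq_integral]
    simp [bump_nonneg]

theorem integral_bump_mul_circleAvg_sub_le {u : Plane → ℝ} {m : ℝ} (x : Plane) (ht : 0 ≤ t)
    (hts : t ≤ s) (hu : Continuous u) (hu0 : ∀ y, 0 ≤ u y) (hum : ∀ y, u y ≤ m) :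
    ∫ y, bump x s y * (circleAvg u y t - u y) ≤ 441 * Real.pi * m * s ^ 4 * t ^ 2 := by
  have hs := ht.trans hts
  have hb := continuous_bump x s
  have hbs := hasCompactSupport_bump x hs
  have hbu := integrable_bump_mul x hs hu
  have hAu : Integrable fun y => circleAvg (bump x s) y t * u y :=
    ((continuous_circleAvg hb t).mul hu).integrable_of_hasCompactSupport
      (hasCompactSupport_circleAvg hbs t).mul_right
  have : 0 ≤ m := (hu0 x).trans (hum x)
  have hvol : volume.real (closedBall x (3 * s)) = 9 * Real.pi * s ^ 2 := by
    rw [Measure.real, EuclideanSpace.volume_closedBall_fin_two, ENNReal.toReal_mul,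
      ENNReal.toReal_pow, ENNReal.toReal_ofReal (by positivity),
      ENNReal.toReal_ofReal Real.pi_pos.le]
    ring
  calc ∫ y, bump x s y * (circleAvg u y t - u y)
      = ∫ y, (circleAvg (bump x s) y t - bump x s y) * u y := by
        simp only [mul_sub, sub_mul]
        rw [integral_sub (integrable_bump_mul x hs (continuous_circleAvg hu t)) hbu,
          integral_sub hAu hbu, integral_mul_circleAvg_comm hb hbs hu]
    _ ≤ ∫ y, (closedBall x (3 * s)).indicator (fun _ => 49 * (s * t) ^ 2 * m) y := by
        refine integral_mono ?_ ?_ fun y => ?_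
        · simpa only [sub_mul, Pi.sub_def] using hAu.sub hbu
        · exact (integrable_indicator_iff measurableSet_closedBall).2
            (integrableOn_const measure_closedBall_lt_top.ne)
        · refine (mul_le_mul_of_nonneg_right (circleAvg_bump_sub_le ht hts) (hu0 y)).trans ?_
          rw [← indicator_mul_left]
          exact indicator_le_indicator (mul_le_mul_of_nonneg_left (hum y) (by positivity))
    _ = 441 * Real.pi * m * s ^ 4 * t ^ 2 := by
        rw [integral_indicator measurableSet_closedBall, setIntegral_const, hvol, smul_eq_mul]
        ring

theorem volume_real_ball {r : ℝ} (z : Plane) (hr : 0 ≤ r) :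
    volume.real (ball z r) = Real.pi * r ^ 2 := by
  rw [Measure.real, EuclideanSpace.volume_ball_fin_two, ENNReal.toReal_mul, ENNReal.toReal_pow,
    ENNReal.toReal_ofReal hr, ENNReal.toReal_ofReal Real.pi_pos.le, mul_comm]

theorem exists_continuous_eqOn_closedBall {u : Plane → ℝ} {m r : ℝ} (hr : 0 ≤ r)
    (hu : ContinuousOn u (closedBall x r)) (hum : ∀ y ∈ closedBall x r, u y ∈ Icc 0 m) :
    ∃ g : Plane → ℝ, Continuous g ∧ EqOn g u (closedBall x r) ∧ ∀ y, g y ∈ Icc 0 m := by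
  obtain ⟨g, hg, hgu⟩ := ContinuousMap.exists_extension_forall_mem_of_isClosedEmbedding
    (⟨(closedBall x r).domRestrict u, hu.domRestrict⟩ : C(closedBall x r, ℝ))
    (t := Icc 0 m) (e := Subtype.val) (fun y => hum y y.2) ⟨u x, hum x (mem_closedBall_self hr)⟩
    isClosed_closedBall.isClosedEmbedding_subtypeVal
  exact ⟨g, g.continuous, fun y hy => congr_fun hgu ⟨y, hy⟩, hg⟩

theorem card_mul_le_integral {ι : Type*} {F : Finset ι} {B : ι → Set Plane} {G : Plane → ℝ}
    {μ c : ℝ} (hB : ∀ i ∈ F, MeasurableSet (B i)) (hdisj : (F : Set ι).PairwiseDisjoint B)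
    (hμ : ∀ i ∈ F, volume.real (B i) = μ) (hfin : ∀ i ∈ F, volume (B i) ≠ ⊤)
    (hG : Integrable G) (hG0 : ∀ y, 0 ≤ G y) (hc : ∀ i ∈ F, ∀ y ∈ B i, c ≤ G y) :
    F.card * (μ * c) ≤ ∫ y, G y := by
  have hle (i) (hi : i ∈ F) : μ * c ≤ ∫ y in B i, G y := by
    have hmono := setIntegral_mono_on (integrableOn_const (hfin i hi)) hG.integrableOn (hB i hi)
      (hc i hi)
    rwa [setIntegral_const, hμ i hi, smul_eq_mul] at hmono
  calc F.card * (μ * c) ≤ ∑ i ∈ F, ∫ y in B i, G y := by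
        rw [← nsmul_eq_mul]
        exact Finset.card_nsmul_le_sum F _ _ hle
    _ = ∫ y in ⋃ i ∈ F, B i, G y :=
        (integral_biUnion_finset F hB hdisj fun _ _ => hG.integrableOn).symm
    _ ≤ ∫ y, G y := setIntegral_le_integral hG (Eventually.of_forall hG0)

theorem card_mul_le_of_circleAvg_sub {u : Plane → ℝ} {m τ b : ℝ} {F : Finset Plane}
    (hs : 0 < s) (ht : 0 ≤ t) (hts : t ≤ s) (hτ : 0 ≤ τ)
    (hu : ContinuousOn u (closedBall x (3 * s)))
    (hum : ∀ y ∈ closedBall x (3 * s), u y ∈ Icc 0 m)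
    (hsub : ∀ y ∈ ball x (2 * s), u y ≤ circleAvg u y t)
    (hdisj : (F : Set Plane).PairwiseDisjoint fun z => ball z τ)
    (hF : ∀ z ∈ F, ball z τ ⊆ closedBall x s)
    (hb : ∀ z ∈ F, ∀ y ∈ ball z τ, b ≤ circleAvg u y t - u y) :
    F.card * τ ^ 2 * b ≤ 49 * m * t ^ 2 := by
  obtain ⟨g, hgc, hgu, hgm⟩ := exists_continuous_eqOn_closedBall (by positivity) hu hum
  have hexcess (y) (hy : y ∈ ball x (2 * s)) : circleAvg g y t - g y = circleAvg u y t - u y := by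
    rw [mem_ball] at hy
    have hsphere : sphere y t ⊆ closedBall x (3 * s) :=
      sphere_subset_closedBall.trans (closedBall_subset_closedBall' (by linarith))
    rw [hgu (mem_closedBall.2 (by linarith)), circleAvg_congr ht (hgu.mono hsphere)]
  have hle := card_mul_le_integral (c := 9 * s ^ 4 * b) (fun z _ => measurableSet_ball) hdisj
    (fun z _ => volume_real_ball z hτ) (fun z _ => measure_ball_lt_top.ne)
    (integrable_bump_mul x hs.le (w := fun y => circleAvg g y t - g y)
      ((continuous_circleAvg hgc t).sub hgc))
    (fun y => ?_) fun z hz y hy => ?_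
  · have htotal := hle.trans (integral_bump_mul_circleAvg_sub_le x ht hts hgc (fun y => (hgm y).1)
      fun y => (hgm y).2)
    refine le_of_mul_le_mul_left ?_ (show 0 < 9 * Real.pi * s ^ 4 by positivity)
    linarith
  · by_cases hy : y ∈ ball x (2 * s)
    · refine mul_nonneg (bump_nonneg x s y) ?_
      rw [hexcess y hy]
      exact sub_nonneg.2 (hsub y hy)
    · rw [bump_eq_zero hs.le (not_lt.1 (mem_ball.not.1 hy)), zero_mul]
  · have hys := hF z hz hy
    have hy2 : y ∈ ball x (2 * s) := closedBall_subset_ball (by linarith) hys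
    rw [hexcess y hy2]
    calc 9 * s ^ 4 * b ≤ 9 * s ^ 4 * (circleAvg u y t - u y) := by gcongr; exact hb z hz y hy
      _ ≤ _ := mul_le_mul_of_nonneg_right (le_bump hys) (sub_nonneg.2 (hsub y hy2))

end Bump

/-! ### Nondegeneracy -/

section FreeBoundarySet

variable {D : Set Plane} {f g h v : Plane → ℝ} {p y w : Plane} {lam R : ℝ}

/-- The free boundary of `v`: the part of the boundary of its positivity set away from `D`. -/
def freeBoundarySet (D : Set Plane) (v : Plane → ℝ) : Set Plane :=
  frontier (posSet D v) \ closure D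

theorem eq_zero_of_notMem_posSet (hp : p ∉ D) (hv : 0 ≤ v p) (hpv : p ∉ posSet D v) : v p = 0 :=
  le_antisymm (not_lt.1 fun hpos => hpv ⟨hp, hpos⟩) hv

theorem posSet_mono {v w : Plane → ℝ} (hvw : ∀ x ∉ D, v x ≤ w x) : posSet D v ⊆ posSet D w :=
  fun x hx => ⟨hx.1, hx.2.trans_le (hvw x hx.1)⟩

theorem isOpen_posSet_diff_closure (hv : ContinuousOn v Dᶜ) : IsOpen (posSet D v \ closure D) :=
  isOpen_iff_mem_nhds.2 fun _ hx => inter_mem (eventually_mem_posSet hv hx.2 hx.1.2)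
    (isClosed_closure.isOpen_compl.mem_nhds hx.2)

theorem IsSubsolution.notMem_posSet_of_mem_freeBoundarySet (hv : IsSubsolution D f g v)
    (hp : p ∈ freeBoundarySet D v) : p ∉ posSet D v :=
  notMem_posSet_of_mem_frontier hv.continuousOn hp.2 hp.1

theorem IsSubsolution.eq_zero_of_mem_freeBoundarySet (hv : IsSubsolution D f g v)
    (hp : p ∈ freeBoundarySet D v) : v p = 0 :=
  have hpD := notMem_of_notMem_closure hp.2
  eq_zero_of_notMem_posSet hpD (hv.nonneg p hpD) (hv.notMem_posSet_of_mem_freeBoundarySet hp)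

theorem Admissible.freeBoundarySet_subset (A : Admissible D f g h lam)
    (hv : v ∈ subsolutionsBelow D f g h) : freeBoundarySet D v ⊆ posSet D h \ closure D := by
  intro x hx
  have hxD := notMem_of_notMem_closure hx.2
  refine ⟨⟨hxD, lt_of_le_of_ne (A.h_nonneg x hxD) fun h0 => ?_⟩, hx.2⟩
  obtain ⟨y, s, hs, hxy, hdisj, hplane⟩ := A.h_slope x hx.2 h0.symm
  have hle : √(f x) ≤ √lam := hv.1.freeBoundary x hx y s hs hxy
    (hdisj.mono_right (posSet_mono hv.2)) _
    (hplane.mono (by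
      filter_upwards [compl_mem_nhds_of_notMem_closure hx.2] with z hz using hv.2 z hz))
  exact hle.not_gt (Real.sqrt_lt_sqrt A.lam_pos.le (A.lam_lt x))

theorem Admissible.isCompact_freeBoundarySet (A : Admissible D f g h lam) :
    IsCompact (freeBoundarySet D (largestSubsolution D f g h)) := by
  set u := largestSubsolution D f g h
  have hsub : freeBoundarySet D u ⊆ Dᶜ := fun x hx => notMem_of_notMem_closure hx.2
  refine Metric.isCompact_of_isClosed_isBounded (isClosed_of_closure_subset fun x hx => ?_) ?_
  · refine ⟨closure_minimal sdiff_subset isClosed_frontier hx, fun hxc => ?_⟩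
    have hxD : x ∉ D := closure_minimal hsub A.isOpen.isClosed_compl hx
    have hfr : x ∈ frontier D := A.isOpen.frontier_eq ▸ ⟨hxc, hxD⟩
    obtain ⟨v, hv, hpos⟩ := A.exists_pos_near_frontier hfr
    obtain ⟨y, hy, hypos⟩ := ((mem_closure_iff_frequently.1 hx).and_eventually hpos).exists
    exact A.largest_mem_subsolutionsBelow.1.notMem_posSet_of_mem_freeBoundarySet hy
      (posSet_subset_largest hv ⟨hsub hy, hypos (hsub hy)⟩)
  · refine A.h_supp.closure.subset (sdiff_subset.trans (frontier_subset_closure.trans ?_))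
    exact closure_mono (posSet_mono fun x => A.largest_le_barrier)

theorem Admissible.exists_uniform_scale (A : Admissible D f g h lam) :
    ∃ s > 0, ∃ C > 0, ∀ p ∈ freeBoundarySet D (largestSubsolution D f g h),
      closedBall p s ⊆ posSet D h \ closure D ∧
      ∀ y ∈ closedBall p s, largestSubsolution D f g h y ≤ C * dist y p := by
  set u := largestSubsolution D f g h
  have hu : u ∈ subsolutionsBelow D f g h := A.largest_mem_subsolutionsBelow
  have hS : IsCompact (freeBoundarySet D u) := A.isCompact_freeBoundarySet
  obtain ⟨δ, hδ, hδU⟩ := hS.exists_cthickening_subset_open (isOpen_posSet_diff_closure A.h_cont)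
    (A.freeBoundarySet_subset hu)
  set K := cthickening δ (freeBoundarySet D u)
  obtain ⟨m, hm, hmh⟩ : ∃ m, 0 < m ∧ ∀ y ∈ K, m ≤ h y :=
    hS.cthickening.exists_forall_le' (A.h_cont.mono fun y hy => (hδU hy).1.1)
      fun y hy => (hδU hy).1.2
  obtain ⟨L, hL, hLf⟩ : ∃ L, 0 < L ∧ ∀ y ∈ K, √(f y) ≤ L := by
    obtain ⟨L, hL⟩ := hS.cthickening.bddAbove_image A.f_cont.sqrt.continuousOn
    exact ⟨max L 1, by positivity, fun y hy => (hL (mem_image_of_mem _ hy)).trans (le_max_left _ _)⟩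
  set s := min (δ / 5) (m / (6 * L))
  have hsδ : 5 * s ≤ δ := by linarith [min_le_left (δ / 5) (m / (6 * L))]
  have hsm : 6 * L * s ≤ m :=
    (mul_le_mul_of_nonneg_left (min_le_right _ _) (by positivity)).trans_eq (by field_simp)
  have hs : 0 < s := by positivity
  refine ⟨s, hs, 10 * L, by positivity, fun p hp => ?_⟩
  have hK : closedBall p δ ⊆ K := fun x hx => mem_cthickening_of_dist_le x p δ _ hp hx
  refine ⟨(closedBall_subset_closedBall (by linarith)).trans (hK.trans hδU), fun y hy => ?_⟩
  rw [mem_closedBall] at hy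
  have hball : closedBall y (4 * dist y p) ⊆ K :=
    (closedBall_subset_closedBall' (by linarith)).trans hK
  have hball' : ball y (3 * dist y p) ⊆ K := (ball_subset_closedBall.trans
    (closedBall_subset_closedBall (by linarith [dist_nonneg (x := y) (y := p)]))).trans hball
  refine A.largest_le_dist (hu.1.notMem_posSet_of_mem_freeBoundarySet hp)
    (disjoint_left.2 fun x hx => (hδU (hball (ball_subset_closedBall hx))).1.1)
    (hδU (hball (mem_closedBall_self (by positivity)))).2 hL (fun x hx => hLf x (hball' hx))
    fun x hx => le_trans ?_ (hmh x (hball' hx))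
  exact (by gcongr : 6 * L * dist y p ≤ 6 * L * s).trans hsm

theorem Admissible.largest_nonneg_of_disjoint (A : Admissible D f g h lam)
    (hD : Disjoint (closedBall y R) (closure D)) {x : Plane} (hx : x ∈ sphere y R) :
    0 ≤ largestSubsolution D f g h x :=
  A.largest_nonneg (notMem_of_notMem_closure
    (notMem_closure_of_disjoint hD (sphere_subset_closedBall hx)))

theorem Admissible.largest_le_circleAvg (A : Admissible D f g h lam)
    (hD : Disjoint (closedBall y R) (closure D)) (hw : w ∈ ball y R) :
    largestSubsolution D f g h w ≤
      (R + dist w y) / (R - dist w y) * circleAvg (largestSubsolution D f g h) y R := by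
  have hnD : ∀ x ∈ closedBall y R, x ∉ D := fun x hx =>
    notMem_of_notMem_closure (notMem_closure_of_disjoint hD hx)
  refine subharmonic_le_circleAvg (A.continuousOn_largest.mono hnD)
    (fun x => A.largest_nonneg_of_disjoint hD)
    (A.viscositySubharmonicOn_largest.mono fun x hx => ?_) hw
  have hxR := ball_subset_closedBall hx.1
  exact ⟨⟨hnD x hxR, hx.2⟩, notMem_closure_of_disjoint hD hxR⟩

theorem Admissible.largest_le_circleAvg_self (A : Admissible D f g h lam) (hR : 0 < R)
    (hD : Disjoint (closedBall y R) (closure D)) :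
    largestSubsolution D f g h y ≤ circleAvg (largestSubsolution D f g h) y R := by
  simpa [div_self hR.ne'] using A.largest_le_circleAvg hD (mem_ball_self hR)

theorem Admissible.largest_le_mul_circleAvg (A : Admissible D f g h lam) {c : ℝ} (hR : 0 < R)
    (hD : Disjoint (closedBall y R) (closure D)) (hw : w ∈ ball y R)
    (hc : R + dist w y ≤ c * (R - dist w y)) :
    largestSubsolution D f g h w ≤ c * circleAvg (largestSubsolution D f g h) y R := by
  refine (A.largest_le_circleAvg hD hw).trans (mul_le_mul_of_nonneg_right ?_
    (circleAvg_nonneg hR.le fun x => A.largest_nonneg_of_disjoint hD))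
  rwa [div_le_iff₀ (sub_pos.2 hw)]

theorem Admissible.exists_mem_sphere_lt_of_infDist_eq (A : Admissible D f g h lam)
    (hv : IsSubsolution D f g v) {z : Plane} {τ : ℝ} (hτ : 0 < τ)
    (hD : Disjoint (closedBall z (2 * τ)) (closure D)) (hne : (posSet D v).Nonempty)
    (hz : infDist z (posSet D v) = τ) : ∃ x ∈ sphere z (2 * τ), √lam / 2 * τ < v x := by
  by_contra! hsmall
  obtain ⟨q, hq, hqz⟩ := isClosed_closure.exists_infDist_eq_dist hne.closure z
  rw [infDist_closure, hz, dist_comm] at hqz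
  have hlog : 1 / 2 ≤ Real.log (2 * τ) - Real.log τ := by
    rw [Real.log_mul two_ne_zero hτ.ne', add_sub_cancel_right]
    linarith [Real.one_sub_inv_le_log_of_pos two_pos]
  have htouch : √(f q) ≤ √lam * τ / τ := by
    refine hv.sqrt_le_of_touching hτ (by positivity) (hz ▸ disjoint_ball_infDist) hD
      (fun x hx _ => (hsmall x hx).trans ?_) hq hqz.symm (by rw [mem_ball]; linarith)
    calc √lam / 2 * τ = √lam * τ * (1 / 2) := by ring
      _ ≤ √lam * τ * (Real.log (2 * τ) - Real.log τ) := by gcongr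
      _ = logProfile z (-(√lam * τ)) τ x := by rw [logProfile, ← dist_eq_norm, hx]; ring
  rw [mul_div_cancel_right₀ _ hτ.ne'] at htouch
  exact htouch.not_gt (Real.sqrt_lt_sqrt A.lam_pos.le (A.lam_lt q))

theorem Admissible.le_circleAvg_sub_of_infDist_eq (A : Admissible D f g h lam) {z : Plane} {τ : ℝ}
    (hτ : 0 < τ) (hD : Disjoint (closedBall z (5 * τ)) (closure D))
    (hne : (posSet D (largestSubsolution D f g h)).Nonempty)
    (hz : infDist z (posSet D (largestSubsolution D f g h)) = τ) (hy : y ∈ ball z (τ / 2)) :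
    √lam / 10 * τ ≤
      circleAvg (largestSubsolution D f g h) y (4 * τ) - largestSubsolution D f g h y := by
  set u := largestSubsolution D f g h
  rw [mem_ball] at hy
  have hDy : Disjoint (closedBall y (4 * τ)) (closure D) :=
    hD.mono_left (closedBall_subset_closedBall' (by linarith))
  have hyD : y ∉ D := notMem_of_notMem_closure
    (notMem_closure_of_disjoint hDy (mem_closedBall_self (by positivity)))
  have huy : u y = 0 := eq_zero_of_notMem_posSet hyD (A.largest_nonneg hyD)
    (disjoint_left.1 disjoint_ball_infDist (by rw [hz, mem_ball]; linarith))
  obtain ⟨x, hx, hux⟩ := A.exists_mem_sphere_lt_of_infDist_eq A.largest_mem_subsolutionsBelow.1 hτ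
    (hD.mono_left (closedBall_subset_closedBall (by linarith))) hne hz
  have hxy : dist x y ≤ 5 / 2 * τ := by
    linarith [dist_triangle_right x y z, mem_sphere.1 hx]
  have hharnack : u x ≤ 5 * circleAvg u y (4 * τ) :=
    A.largest_le_mul_circleAvg (by positivity) hDy (by rw [mem_ball]; linarith) (by linarith)
  rw [huy]
  linarith

theorem Admissible.circleAvg_largest_pos (A : Admissible D f g h lam)
    (hp : p ∈ closure (posSet D (largestSubsolution D f g h))) (hR : 0 < R)
    (hD : Disjoint (closedBall p R) (closure D)) :
    0 < circleAvg (largestSubsolution D f g h) p R := by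
  obtain ⟨w, hw, hwp⟩ := Metric.mem_closure_iff.1 hp R hR
  rw [dist_comm] at hwp
  exact pos_of_mul_pos_right (hw.2.trans_le (A.largest_le_circleAvg hD hwp))
    (div_nonneg (add_nonneg hR.le dist_nonneg) (sub_nonneg.2 hwp.le))

-- Otherwise the harmonic replacement in the disc would be a larger subsolution, positive at `p`.
theorem Admissible.exists_mem_sphere_notMem_closure_posSet (A : Admissible D f g h lam)
    (hp : p ∈ freeBoundarySet D (largestSubsolution D f g h)) (hR : 0 < R)
    (hball : closedBall p R ⊆ posSet D h \ closure D) :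
    ∃ z ∈ sphere p R, z ∉ closure (posSet D (largestSubsolution D f g h)) := by
  by_contra! hcl
  have hD : Disjoint (closedBall p R) (closure D) := disjoint_left.2 fun x hx => (hball hx).2
  obtain ⟨v, hv, -, hvc, hvh, hveq⟩ := A.exists_harmonic_replacement
    A.largest_mem_subsolutionsBelow hR hD
    (fun x hx => (hball (ball_subset_closedBall hx)).1.2) hcl
  have hlt : 0 < largestSubsolution D f g h p :=
    calc 0 < circleAvg (largestSubsolution D f g h) p R := A.circleAvg_largest_pos hp.1.1 hR hD
      _ = v p := by rw [← circleAvg_congr hR.le hveq, circleAvg_eq_of_harmonic hR hvc hvh]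
      _ ≤ largestSubsolution D f g h p := le_largestSubsolution hv (notMem_of_notMem_closure hp.2)
  exact hlt.ne' (A.largest_mem_subsolutionsBelow.1.eq_zero_of_mem_freeBoundarySet hp)

theorem Admissible.exists_mem_sphere_mem_posSet (A : Admissible D f g h lam)
    (hp : p ∈ closure (posSet D (largestSubsolution D f g h))) (hR : 0 < R)
    (hD : Disjoint (closedBall p R) (closure D)) :
    ∃ q ∈ sphere p R, q ∈ posSet D (largestSubsolution D f g h) := by
  by_contra! hno
  have hzero : circleAvg (largestSubsolution D f g h) p R = circleAvg (fun _ => 0) p R :=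
    circleAvg_congr hR.le fun y hy => eq_zero_of_notMem_posSet (notMem_of_notMem_closure
      (notMem_closure_of_disjoint hD (sphere_subset_closedBall hy)))
      (A.largest_nonneg_of_disjoint hD hy) (hno y hy)
  exact (A.circleAvg_largest_pos hp hR hD).ne' (hzero.trans (Real.circleAverage_const 0 _ _))

theorem exists_forall_exists_mem_sphere_le_infDist {E : Type*} [NormedAddCommGroup E]
    [NormedSpace ℝ E] {P : Set E} (hP : P.Nonempty) {p : E} {a b : ℝ} (ha : 0 < a)
    (h : ∀ R ∈ Icc a b, ∃ z ∈ sphere p R, z ∉ closure P) :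
    ∃ τ > 0, ∀ R ∈ Icc a b, ∃ z ∈ sphere p R, τ ≤ infDist z P := by
  refine isCompact_Icc.induction_on (p := fun s => ∃ τ > 0, ∀ R ∈ s, ∃ z ∈ sphere p R,
    τ ≤ infDist z P) ⟨1, one_pos, by simp⟩ (fun s t hst ⟨τ, hτ, ht⟩ => ⟨τ, hτ, fun R hR =>
      ht R (hst hR)⟩) ?_ fun R hR => ?_
  · rintro s t ⟨τ, hτ, hs⟩ ⟨τ', hτ', ht⟩
    refine ⟨min τ τ', lt_min hτ hτ', ?_⟩
    rintro R (hR | hR)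
    · exact (hs R hR).imp fun z hz => ⟨hz.1, (min_le_left _ _).trans hz.2⟩
    · exact (ht R hR).imp fun z hz => ⟨hz.1, (min_le_right _ _).trans hz.2⟩
  · obtain ⟨z, hz, hzP⟩ := h R hR
    have hR0 : 0 < R := ha.trans_le hR.1
    have hpos : 0 < infDist z P := by
      rw [← infDist_closure]
      exact (isClosed_closure.notMem_iff_infDist_pos hP.closure).1 hzP
    set e := R⁻¹ • (z - p)
    have he : ‖e‖ = 1 := by
      rw [norm_smul, norm_inv, Real.norm_of_nonneg hR0.le, ← dist_eq_norm, hz,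
        inv_mul_cancel₀ hR0.ne']
    have hRe : p + R • e = z := by rw [smul_inv_smul₀ hR0.ne', add_sub_cancel]
    have hcont : ContinuousAt (fun t : ℝ => infDist (p + t • e) P) R :=
      ((continuous_infDist_pt P).comp (by fun_prop)).continuousAt
    have hnear : ∀ᶠ t in 𝓝 R, infDist z P / 2 < infDist (p + t • e) P :=
      hcont.eventually (lt_mem_nhds (by simpa only [hRe] using half_lt_self hpos))
    refine ⟨_, mem_nhdsWithin_of_mem_nhds (inter_mem hnear (lt_mem_nhds hR0)), infDist z P / 2,
      by positivity, fun t ⟨ht, ht0⟩ => ⟨p + t • e, ?_, ht.le⟩⟩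
    rw [mem_sphere, dist_eq_norm, add_sub_cancel_left, norm_smul, he, mul_one,
      Real.norm_of_nonneg (le_of_lt ht0)]

theorem Admissible.exists_mem_sphere_infDist_eq (A : Admissible D f g h lam)
    (hp : p ∈ freeBoundarySet D (largestSubsolution D f g h)) {a b : ℝ} (ha : 0 < a)
    (hball : closedBall p b ⊆ posSet D h \ closure D) :
    ∃ τ₀ > 0, ∀ τ ∈ Icc 0 τ₀, ∀ R ∈ Icc a b, ∃ z ∈ sphere p R,
      infDist z (posSet D (largestSubsolution D f g h)) = τ := by
  set P := posSet D (largestSubsolution D f g h)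
  have hne : P.Nonempty := closure_nonempty_iff.1 ⟨p, hp.1.1⟩
  have hsub : ∀ R ≤ b, closedBall p R ⊆ posSet D h \ closure D := fun R hR =>
    (closedBall_subset_closedBall hR).trans hball
  obtain ⟨τ₀, hτ₀, hfar⟩ := exists_forall_exists_mem_sphere_le_infDist hne ha fun R hR =>
    A.exists_mem_sphere_notMem_closure_posSet hp (ha.trans_le hR.1) (hsub R hR.2)
  refine ⟨τ₀, hτ₀, fun τ hτ R hR => ?_⟩
  have hR0 : 0 < R := ha.trans_le hR.1
  obtain ⟨x, hx, hxτ⟩ := hfar R hR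
  obtain ⟨q, hq, hqP⟩ := A.exists_mem_sphere_mem_posSet hp.1.1 hR0
    (disjoint_left.2 fun x hx => (hsub R hR.2 hx).2)
  have hrank : 1 < Module.rank ℝ Plane := by
    rw [← Module.finrank_eq_rank, finrank_euclideanSpace_fin]
    norm_num
  exact (isPreconnected_sphere hrank p R).intermediate_value hq hx
    (continuous_infDist_pt P).continuousOn
    ⟨by rw [infDist_zero_of_mem hqP]; exact hτ.1, hτ.2.trans hxτ⟩

theorem exists_finset_pairwiseDisjoint_ball {X : Type*} [PseudoMetricSpace X] {Q : Set X} {p : X}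
    {a τ : ℝ} (hτ : 0 < τ) (N : ℕ)
    (hQ : ∀ R ∈ Icc a (a + N * τ), ∃ z ∈ sphere p R, z ∈ Q) :
    ∃ F : Finset X, F.card = N ∧ (F : Set X) ⊆ Q ∩ closedBall p (a + N * τ) ∧
      (F : Set X).PairwiseDisjoint fun z => ball z (τ / 2) := by
  classical
  have hmem : ∀ j : Fin N, a + j * τ ∈ Icc a (a + N * τ) := fun j =>
    ⟨le_add_of_nonneg_right (by positivity), by gcongr; exact j.is_le'⟩
  choose z hz hzQ using fun j => hQ _ (hmem j)
  have hsep : ∀ i j, i ≠ j → τ ≤ dist (z i) (z j) := fun i j hij =>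
    calc τ = 1 * τ := (one_mul τ).symm
      _ ≤ |(i : ℝ) - j| * τ := by
        have hij' : (i : ℤ) - j ≠ 0 := sub_ne_zero.2 (by exact_mod_cast Fin.val_ne_of_ne hij)
        gcongr
        exact_mod_cast Int.one_le_abs hij'
      _ = |dist (z i) p - dist (z j) p| := by
        rw [hz, hz, add_sub_add_left_eq_sub, ← sub_mul, abs_mul, abs_of_pos hτ]
      _ ≤ dist (z i) (z j) := abs_dist_sub_le _ _ _
  have hdisj : Pairwise fun i j => Disjoint (ball (z i) (τ / 2)) (ball (z j) (τ / 2)) :=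
    fun i j hij => ball_disjoint_ball (by linarith [hsep i j hij])
  have hinj : Function.Injective z := fun i j hij => by
    by_contra hne
    have := hsep i j hne
    rw [hij, dist_self] at this
    exact this.not_gt hτ
  refine ⟨Finset.univ.image z, by rw [Finset.card_image_of_injective _ hinj, Finset.card_fin],
    ?_, ?_⟩
  · rintro _ hx
    obtain ⟨j, -, rfl⟩ := Finset.mem_image.1 (Finset.mem_coe.1 hx)
    exact ⟨hzQ j, mem_closedBall.2 ((hz j).le.trans (hmem j).2)⟩
  · rw [Finset.coe_image, Finset.coe_univ, image_univ]
    rintro _ ⟨i, rfl⟩ _ ⟨j, rfl⟩ hij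
    exact hdisj fun h => hij (congrArg z h)

theorem Admissible.exists_finset_infDist_eq (A : Admissible D f g h lam)
    (hp : p ∈ freeBoundarySet D (largestSubsolution D f g h)) {s : ℝ} (hs : 0 < s)
    (hball : closedBall p s ⊆ posSet D h \ closure D) :
    ∃ τ > 0, ∃ F : Finset Plane, τ ≤ s / 4 ∧ F.card * τ = s / 4 ∧
      (∀ z ∈ F, dist z p ≤ 3 / 4 * s ∧ infDist z (posSet D (largestSubsolution D f g h)) = τ) ∧
      (F : Set Plane).PairwiseDisjoint fun z => ball z (τ / 2) := by
  set P := posSet D (largestSubsolution D f g h)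
  obtain ⟨τ₀, hτ₀, hlevel⟩ := A.exists_mem_sphere_infDist_eq hp (half_pos hs) hball
  obtain ⟨N, hN⟩ := exists_nat_gt (s / (4 * τ₀))
  have hN0 : (0 : ℝ) < N := lt_trans (by positivity) hN
  have hN1 : (1 : ℝ) ≤ N := by exact_mod_cast hN0
  set τ := s / (4 * N) with hτ
  have hτ0 : 0 < τ := by positivity
  have hNτ : N * τ = s / 4 := by rw [hτ]; field_simp
  have hττ₀ : τ ≤ τ₀ := by
    rw [div_lt_iff₀ (by positivity)] at hN
    rw [hτ, div_le_iff₀ (by positivity)]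
    linarith
  obtain ⟨F, hcard, hF, hFdisj⟩ := exists_finset_pairwiseDisjoint_ball
    (Q := {z | infDist z P = τ}) (p := p) (a := s / 2) hτ0 N fun R hR =>
      hlevel τ ⟨hτ0.le, hττ₀⟩ R ⟨hR.1, by linarith [hR.2]⟩
  refine ⟨τ, hτ0, F, hNτ ▸ le_mul_of_one_le_left hτ0.le hN1, by rw [hcard, hNτ], fun z hz => ?_,
    hFdisj⟩
  exact ⟨by linarith [mem_closedBall.1 (hF hz).2], (hF hz).1⟩

-- The points of `F` sit at `≈ s / τ` places where the circular average over radius `4 * τ` exceeds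
-- the value by a multiple of `τ`; the counting bound makes this compatible only with `m ≳ s`.
theorem Admissible.sqrt_mul_le_of_forall_largest_le (A : Admissible D f g h lam)
    (hp : p ∈ freeBoundarySet D (largestSubsolution D f g h)) {s m : ℝ} (hs : 0 < s)
    (hball : closedBall p (3 * s) ⊆ posSet D h \ closure D)
    (hm : ∀ y ∈ closedBall p (3 * s), largestSubsolution D f g h y ≤ m) :
    √lam * s ≤ 125440 * m := by
  set u := largestSubsolution D f g h
  have hdisj : ∀ y R, dist y p + R ≤ 3 * s → Disjoint (closedBall y R) (closure D) :=
    fun y R hR => disjoint_left.2 fun x hx =>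
      (hball (closedBall_subset_closedBall' (by linarith) hx)).2
  obtain ⟨τ, hτ, F, hτs, hcard, hF, hFdisj⟩ := A.exists_finset_infDist_eq hp hs
    ((closedBall_subset_closedBall (by linarith)).trans hball)
  have hcount : F.card * (τ / 2) ^ 2 * (√lam / 10 * τ) ≤ 49 * m * (4 * τ) ^ 2 :=
    card_mul_le_of_circleAvg_sub hs (by positivity) (by linarith) (by positivity)
      (A.continuousOn_largest.mono fun y hy => (hball hy).1.1)
      (fun y hy => ⟨A.largest_nonneg (hball hy).1.1, hm y hy⟩)
      (fun y hy => A.largest_le_circleAvg_self (by positivity)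
        (hdisj y _ (by linarith [mem_ball.1 hy])))
      hFdisj
      (fun z hz => ball_subset_closedBall.trans
        (closedBall_subset_closedBall' (by linarith [(hF z hz).1])))
      fun z hz y hy => A.le_circleAvg_sub_of_infDist_eq hτ
        (hdisj z _ (by linarith [(hF z hz).1])) (closure_nonempty_iff.1 ⟨p, hp.1.1⟩)
        (hF z hz).2 hy
  refine le_of_mul_le_mul_right (a := τ ^ 2) ?_ (by positivity)
  calc √lam * s * τ ^ 2 = 4 * (F.card * τ) * √lam * τ ^ 2 := by rw [hcard]; ring
    _ = 160 * (F.card * (τ / 2) ^ 2 * (√lam / 10 * τ)) := by ring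
    _ ≤ 160 * (49 * m * (4 * τ) ^ 2) := by gcongr
    _ = 125440 * m * τ ^ 2 := by ring

end FreeBoundarySet

/-! ### Finite length of the free boundary -/

section HausdorffMeasure

open scoped ENNReal NNReal

theorem packingNumber_le {X : Type*} [PseudoEMetricSpace X] {T : Set X} {ε : ℝ≥0} {n : ℕ}
    (h : ∀ F : Finset X, (F : Set X) ⊆ T → IsSeparated ε (F : Set X) → F.card ≤ n) :
    packingNumber ε T ≤ n := by
  refine iSup₂_le fun S hST => iSup_le fun hS => ?_
  by_contra! hlt
  obtain ⟨F, hFS, hF⟩ := exists_subset_encard_eq (Order.add_one_le_of_lt hlt)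
  have hfin : F.Finite := finite_of_encard_eq_coe (k := n + 1) (by exact_mod_cast hF)
  lift F to Finset X using hfin
  have hcard : F.card = n + 1 := by
    rw [encard_coe_eq_coe_finsetCard] at hF
    exact_mod_cast hF
  exact (h F (hFS.trans hST) (hS.mono hFS)).not_gt (by omega)

theorem hausdorffMeasure_le_of_coveringNumber_mul_le {X : Type*} [EMetricSpace X]
    [MeasurableSpace X] [BorelSpace X] {T : Set X} {d : ℝ} (hd : 0 ≤ d) {C : ℝ≥0∞}
    (hC : C ≠ ⊤)
    (h : ∀ᶠ ε : ℝ≥0 in 𝓝[>] 0, (coveringNumber ε T : ℝ≥0∞) * ε ^ d ≤ C) :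
    Measure.hausdorffMeasure d T ≤ 2 ^ d * C := by
  let : ∀ ε : ℝ≥0, Fintype (minimalCover ε T) := fun _ => finite_minimalCover.fintype
  have hfinite : ∀ᶠ ε : ℝ≥0 in 𝓝[>] 0, coveringNumber ε T ≠ ⊤ := by
    filter_upwards [h, self_mem_nhdsWithin] with ε hε (hε0 : 0 < ε) htop
    rw [htop, ENat.toENNReal_top, ENNReal.top_mul (by simp [hε0.ne'])] at hε
    exact hC (top_le_iff.1 hε)
  have hcover : ∀ᶠ ε : ℝ≥0 in 𝓝[>] 0, T ⊆ ⋃ z : minimalCover ε T, closedEBall (z : X) ε := by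
    filter_upwards [hfinite] with ε hε
    rw [iUnion_coe_set]
    exact isCover_iff_subset_iUnion_closedEBall.1 (isCover_minimalCover hε)
  have hlim : Tendsto (fun ε : ℝ≥0 => 2 * (ε : ℝ≥0∞)) (𝓝[>] 0) (𝓝 0) := by
    have : Continuous fun ε : ℝ≥0 => 2 * (ε : ℝ≥0∞) :=
      (ENNReal.continuous_const_mul (by simp)).comp ENNReal.continuous_coe
    exact tendsto_nhdsWithin_of_tendsto_nhds (by simpa using this.tendsto 0)
  refine (Measure.hausdorffMeasure_le_liminf_sum d T _ hlim _
    (Eventually.of_forall fun _ _ => ediam_closedEBall_le) hcover).trans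
    (liminf_le_of_frequently_le' (Eventually.frequently ?_))
  filter_upwards [h, hfinite] with ε hε hεfin
  calc ∑ z : minimalCover ε T, ediam (closedEBall (z : X) ε) ^ d
      ≤ ∑ _z : minimalCover ε T, (2 * (ε : ℝ≥0∞)) ^ d :=
        Finset.sum_le_sum fun _ _ => ENNReal.rpow_le_rpow ediam_closedEBall_le hd
    _ = 2 ^ d * (coveringNumber ε T * ε ^ d) := by
        rw [Finset.sum_const, nsmul_eq_mul, Finset.card_univ, ENNReal.mul_rpow_of_nonneg _ _ hd,
          ← encard_minimalCover hεfin, ← coe_fintypeCard, ENat.toENNReal_coe]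
        ring
    _ ≤ 2 ^ d * C := by gcongr

theorem hausdorffMeasure_lt_top_of_card_mul_le {X : Type*} [EMetricSpace X]
    [MeasurableSpace X] [BorelSpace X] {T : Set X} {d : ℝ} (hd : 0 ≤ d) {C : ℝ≥0}
    (h : ∀ᶠ ε : ℝ≥0 in 𝓝[>] 0, ∀ F : Finset X, (F : Set X) ⊆ T → IsSeparated ε (F : Set X) →
      F.card * ε ^ d ≤ C) :
    Measure.hausdorffMeasure d T < ⊤ := by
  refine (hausdorffMeasure_le_of_coveringNumber_mul_le hd (ENNReal.coe_ne_top (r := C)) ?_).trans_lt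
    (ENNReal.mul_lt_top (ENNReal.rpow_lt_top_of_nonneg hd (by simp)) ENNReal.coe_lt_top)
  filter_upwards [h, self_mem_nhdsWithin] with ε hε (hε0 : 0 < ε)
  have hpow : 0 < ε ^ d := NNReal.rpow_pos hε0
  have hpack : packingNumber ε T ≤ ⌊C / ε ^ d⌋₊ :=
    packingNumber_le fun F hFT hF => Nat.le_floor ((le_div_iff₀ hpow).2 (hε F hFT hF))
  calc (coveringNumber ε T : ℝ≥0∞) * ε ^ d
      ≤ (⌊C / ε ^ d⌋₊ : ℝ≥0∞) * ε ^ d := by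
        gcongr
        exact_mod_cast ENat.toENNReal_le.2 ((coveringNumber_le_packingNumber ε T).trans hpack)
    _ = ((⌊C / ε ^ d⌋₊ * ε ^ d : ℝ≥0) : ℝ≥0∞) := by
        rw [ENNReal.coe_mul, ENNReal.coe_natCast, ENNReal.coe_rpow_of_nonneg _ hd]
    _ ≤ C := ENNReal.coe_le_coe.2 ((le_div_iff₀ hpow).1 (Nat.floor_le zero_le))

variable {D : Set Plane} {f g h : Plane → ℝ} {lam : ℝ}

theorem Admissible.le_circleAvg_sub_of_mem_freeBoundarySet (A : Admissible D f g h lam)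
    {x y : Plane} (hx : x ∈ freeBoundarySet D (largestSubsolution D f g h)) {t δ C : ℝ}
    (ht : 0 < t) (hC : 0 < C) (hδ : δ ≤ 1 / 2) (hδC : 4000000 * C * δ ≤ √lam)
    (hball : closedBall x (5 * t) ⊆ posSet D h \ closure D)
    (hlin : ∀ q ∈ closedBall x (5 * t), largestSubsolution D f g h q ≤ C * dist q x)
    (hy : y ∈ ball x (δ * t)) :
    C * δ * t ≤ circleAvg (largestSubsolution D f g h) y (4 * t) -
      largestSubsolution D f g h y := by
  set u := largestSubsolution D f g h
  have hδt : δ * t ≤ t / 2 := by nlinarith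
  have hyx : dist y x < δ * t := hy
  have hdisj : Disjoint (closedBall y (4 * t)) (closure D) := disjoint_left.2 fun q hq =>
    (hball (closedBall_subset_closedBall' (by linarith) hq)).2
  have huy : u y ≤ C * δ * t := calc
    u y ≤ C * dist y x := hlin y (mem_closedBall.2 (by linarith))
    _ ≤ C * δ * t := by rw [mul_assoc]; gcongr
  have havg : ∀ q ∈ closedBall x (3 * t), u q ≤ 15 * circleAvg u y (4 * t) := fun q hq => by
    have hqy : dist q y ≤ 7 / 2 * t := by
      linarith [dist_triangle_right q y x, mem_closedBall.1 hq]
    exact A.largest_le_mul_circleAvg (by positivity) hdisj (mem_ball.2 (by linarith)) (by linarith)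
  have hslope : √lam * t ≤ 125440 * (15 * circleAvg u y (4 * t)) :=
    A.sqrt_mul_le_of_forall_largest_le hx ht
      ((closedBall_subset_closedBall (by linarith)).trans hball) havg
  have : 4000000 * C * δ * t ≤ √lam * t := by gcongr
  have : 0 < C * (δ * t) := mul_pos hC (dist_nonneg.trans_lt hyx)
  linarith

-- The neighbourhoods of radius `≈ t` around a `t`-separated set of free boundary points all
-- contribute `≈ t` to `circleAvg u · (4 * t) - u`, so the counting bound applies.
theorem Admissible.exists_card_mul_le (A : Admissible D f g h lam) {s C : ℝ} (hs : 0 < s)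
    (hC : 0 < C)
    (hscale : ∀ p ∈ freeBoundarySet D (largestSubsolution D f g h),
      closedBall p (3 * s) ⊆ posSet D h \ closure D ∧
      ∀ y ∈ closedBall p (3 * s), largestSubsolution D f g h y ≤ C * dist y p) :
    ∃ K : ℝ, 0 ≤ K ∧ ∀ p ∈ freeBoundarySet D (largestSubsolution D f g h), ∀ t, 0 < t → t ≤ s / 4 →
      ∀ F : Finset Plane,
      (F : Set Plane) ⊆ freeBoundarySet D (largestSubsolution D f g h) ∩ closedBall p (s / 2) →
      (F : Set Plane).Pairwise (fun x y => t ≤ dist x y) → F.card * t ≤ K := by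
  set u := largestSubsolution D f g h
  obtain ⟨δ, hδ, hδle, hδC⟩ : ∃ δ > 0, δ ≤ 1 / 2 ∧ 4000000 * C * δ ≤ √lam := by
    have : 0 < √lam := Real.sqrt_pos.2 A.lam_pos
    refine ⟨min (1 / 2) (√lam / (4000000 * C)), by positivity, min_le_left _ _, ?_⟩
    rw [← le_div_iff₀' (by positivity)]
    exact min_le_right _ _
  refine ⟨49 * (3 * C * s) * 16 / (δ ^ 3 * C), by positivity, fun p hp t ht hts F hF hsep => ?_⟩
  have hnD : ∀ y ∈ closedBall p (3 * s), y ∉ closure D := fun y hy => ((hscale p hp).1 hy).2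
  have hnotMem : ∀ y ∈ closedBall p (3 * s), y ∉ D := fun y hy =>
    notMem_of_notMem_closure (hnD y hy)
  have hδt : δ * t ≤ t / 2 := by nlinarith
  have hcount : F.card * (δ * t) ^ 2 * (C * δ * t) ≤ 49 * (3 * C * s) * (4 * t) ^ 2 :=
    card_mul_le_of_circleAvg_sub hs (by positivity) (by linarith) (by positivity)
      (A.continuousOn_largest.mono hnotMem)
      (fun y hy => ⟨A.largest_nonneg (hnotMem y hy), ((hscale p hp).2 y hy).trans <| by
        linarith [mul_le_mul_of_nonneg_left (mem_closedBall.1 hy) hC.le]⟩)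
      (fun y hy => A.largest_le_circleAvg_self (by positivity) <| disjoint_left.2 fun q hq =>
        hnD q (closedBall_subset_closedBall' (by linarith [mem_ball.1 hy]) hq))
      (fun a ha b hb hab => ball_disjoint_ball (by linarith [hsep ha hb hab]))
      (fun a ha => ball_subset_closedBall.trans <| closedBall_subset_closedBall' <| by
        linarith [mem_closedBall.1 (hF ha).2])
      (fun a ha y hy => by
        have hsub : closedBall a (5 * t) ⊆ closedBall a (3 * s) :=
          closedBall_subset_closedBall (by linarith)
        obtain ⟨hpos, hlin⟩ := hscale a (hF ha).1
        exact A.le_circleAvg_sub_of_mem_freeBoundarySet (hF ha).1 ht hC hδle hδC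
          (hsub.trans hpos) (fun q hq => hlin q (hsub hq)) hy)
  rw [le_div_iff₀ (by positivity)]
  refine le_of_mul_le_mul_right (a := t ^ 2) ?_ (by positivity)
  linarith

theorem Admissible.hausdorffMeasure_freeBoundarySet_lt_top (A : Admissible D f g h lam) :
    Measure.hausdorffMeasure 1 (freeBoundarySet D (largestSubsolution D f g h)) < ⊤ := by
  obtain ⟨r, hr, C, hC, hscale⟩ := A.exists_uniform_scale
  set s := r / 3
  have hs : 0 < s := by positivity
  rw [← show 3 * s = r by simp only [s]; ring] at hscale
  obtain ⟨K, hK, hcard⟩ := A.exists_card_mul_le hs hC hscale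
  refine A.isCompact_freeBoundarySet.measure_lt_top_of_nhdsWithin fun p hp =>
    ⟨_, inter_mem_nhdsWithin _ (closedBall_mem_nhds p (half_pos hs)),
      hausdorffMeasure_lt_top_of_card_mul_le zero_le_one (C := K.toNNReal) ?_⟩
  have hsmall : Iic (s / 4).toNNReal ∈ 𝓝 (0 : ℝ≥0) := Iic_mem_nhds (by simpa using hs)
  filter_upwards [self_mem_nhdsWithin, mem_nhdsWithin_of_mem_nhds hsmall]
    with t (ht : 0 < t) hts F hF hsep
  rw [NNReal.rpow_one, ← NNReal.coe_le_coe, Real.coe_toNNReal K hK]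
  refine hcard p hp t ht ((Real.le_toNNReal_iff_coe_le (by positivity)).1 hts) F hF <|
    Set.Pairwise.mono' (fun x y hxy => ?_) hsep
  rw [dist_nndist]
  exact NNReal.coe_le_coe.2 (ENNReal.coe_lt_coe.1 (edist_nndist x y ▸ hxy)).le

end HausdorffMeasure

/-! ### The logarithmic barrier -/

section LogBarrier

variable {D : Set Plane} {f g h v : Plane → ℝ} {x z : Plane} {a lam ρ M R : ℝ}

theorem belowPlane_neg_of_le_logProfile (ha : 0 ≤ a) (hxz : x ≠ z)
    (hv : ∀ᶠ y in 𝓝 x, v y ≤ max (logProfile z a (dist x z) y) 0) :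
    BelowPlane v x ((dist x z)⁻¹ • (z - x)) (a / dist x z) := by
  have hdist : 0 < dist x z := dist_pos.2 hxz
  refine belowPlane_of_hasFDerivAt (by positivity) ?_ ?_ hv
  · rw [logProfile, dist_eq_norm, sub_self, mul_zero]
  · refine (hasFDerivAt_logProfile hxz).congr_fderiv ?_
    rw [← dist_eq_norm, map_smul, smul_smul, ← neg_sub x z, map_neg, smul_neg, neg_smul]
    congr 2
    field_simp

theorem harmonicAt_of_eq_max_logProfile (hxz : x ≠ z)
    (hh : h =ᶠ[𝓝 x] fun y => max (logProfile z a R y) 0) (hpos : 0 < h x) : HarmonicAt h x := by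
  have hprofile : 0 < logProfile z a R x :=
    (lt_max_iff.1 (hpos.trans_eq hh.self_of_nhds)).resolve_right (lt_irrefl 0)
  refine (harmonicAt_congr_nhds ?_).2 (harmonicAt_logProfile (a := a) (r := R) hxz)
  filter_upwards [hh, (continuousAt_logProfile hxz).eventually (lt_mem_nhds hprofile)] with y hy hyp
  rw [hy, max_eq_left hyp.le]

theorem posSet_subset_ball_of_eq_max_logProfile (ha : 0 < a) (hR : 0 < R)
    (hh : ∀ x ∉ D, h x = max (logProfile z a R x) 0) : posSet D h ⊆ ball z R := by
  intro x hx
  by_contra hxR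
  have hle : logProfile z a R x ≤ a * Real.log (R / R) := logProfile_le ha.le hR hR (not_lt.1 hxR)
  rw [div_self hR.ne', Real.log_one, mul_zero] at hle
  exact hx.2.ne' (hh x hx.1 ▸ max_eq_right hle)

theorem exists_ball_disjoint_posSet_of_eq_max_logProfile (ha : 0 < a) (hR : 0 < R)
    (hh : ∀ x ∉ D, h x = max (logProfile z a R x) 0) (hxz : x ≠ z) (hx : x ∉ closure D)
    (hx0 : h x = 0) :
    ∃ (y : Plane) (s : ℝ), 0 < s ∧ dist x y = s ∧ Disjoint (ball y s) (posSet D h) ∧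
      BelowPlane h x (s⁻¹ • (x - y)) (a / R) := by
  have hRx : R ≤ dist x z := by
    by_contra! hlt
    exact (lt_max_of_lt_left (logProfile_pos ha hxz hlt)).ne'
      (hh x (notMem_of_notMem_closure hx) ▸ hx0)
  have hpos : 0 < dist x z := hR.trans_le hRx
  refine ⟨x + (x - z), dist x z, hpos, by simp [dist_eq_norm, norm_sub_rev], ?_, ?_⟩
  · refine (ball_disjoint_ball ?_).mono_right (posSet_subset_ball_of_eq_max_logProfile ha hR hh)
    have hdist : dist (x + (x - z)) z = 2 * dist x z := by
      rw [dist_eq_norm, add_sub_right_comm, ← two_smul ℝ, norm_smul, Real.norm_ofNat, dist_eq_norm]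
    linarith
  · rw [sub_add_cancel_left, neg_sub]
    refine (belowPlane_neg_of_le_logProfile ha.le hxz ?_).mono_slope (by gcongr)
    filter_upwards [compl_mem_nhds_of_notMem_closure hx] with y hy
    rw [hh y hy]
    exact max_le_max_right 0 (by unfold logProfile; gcongr)

theorem admissible_of_eq_max_logProfile (hD_open : IsOpen D) (hD_conn : IsConnected D)
    (hz : z ∈ D) (hlam : 0 < lam) (hf_cont : Continuous f) (hlam_lt : ∀ x, lam < f x)
    (hg_cont : ContinuousOn g (frontier D)) (hg_pos : ∀ x ∈ frontier D, 0 < g x)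
    (hgh : ∀ x ∈ frontier D, g x ≤ h x) (ha : 0 < a) (hR : 0 < R) (haR : a / R ≤ √lam)
    (hh : ∀ x ∉ D, h x = max (logProfile z a R x) 0) : Admissible D f g h lam := by
  have hne : ∀ x ∉ D, x ≠ z := fun x hx hxz => hx (hxz ▸ hz)
  exact {
    isOpen := hD_open
    isConnected := hD_conn
    lam_pos := hlam
    f_cont := hf_cont
    lam_lt := hlam_lt
    g_cont := hg_cont
    g_pos := hg_pos
    g_le_h := hgh
    h_nonneg := fun x hx => hh x hx ▸ le_max_right _ _
    h_cont := ContinuousOn.congr (fun x hx =>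
      ((continuousAt_logProfile (hne x hx)).sup continuousAt_const).continuousWithinAt) hh
    h_harm := fun x hx => harmonicAt_of_eq_max_logProfile (hne x (notMem_of_notMem_closure hx))
      (mem_of_superset (compl_mem_nhds_of_notMem_closure hx) hh)
    h_supp := isBounded_ball.subset (posSet_subset_ball_of_eq_max_logProfile ha hR hh)
    h_slope := fun x hx hx0 => by
      obtain ⟨y, s, hs, hxy, hdisj, hbelow⟩ := exists_ball_disjoint_posSet_of_eq_max_logProfile
        ha hR hh (hne x (notMem_of_notMem_closure hx)) hx hx0
      exact ⟨y, s, hs, hxy, hdisj, hbelow.mono_slope haR⟩ }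

theorem div_lt_iff_lt_sqrt_mul (hlam : 0 < lam) (hM : 0 < M) (hρ : 0 < ρ) (hR : ρ < R) :
    M ^ 2 / (R ^ 2 * Real.log (ρ / R) ^ 2) < lam ↔ M < √lam * (R * Real.log (R / ρ)) := by
  have : 0 < R := hρ.trans hR
  have : 0 < Real.log (R / ρ) := Real.log_pos ((one_lt_div hρ).2 hR)
  rw [← inv_div R ρ, Real.log_inv, neg_sq, div_lt_iff₀ (by positivity), ← mul_pow,
    ← Real.sq_sqrt hlam.le, ← mul_pow, sq_lt_sq₀ hM.le (by positivity), Real.sq_sqrt hlam.le]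

theorem barrierRadius_eq_sInf (hlam : 0 < lam) (hM : 0 < M) (hρ : 0 < ρ) :
    barrierRadius lam ρ M = sInf {R | ρ < R ∧ M < √lam * (R * Real.log (R / ρ))} := by
  rw [barrierRadius]
  congr 1
  ext R
  exact and_congr_right fun hR => div_lt_iff_lt_sqrt_mul hlam hM hρ hR

theorem exists_lt_sqrt_mul_log (hlam : 0 < lam) (hρ : 0 < ρ) (M : ℝ) :
    ∃ R, ρ < R ∧ M < √lam * (R * Real.log (R / ρ)) := by
  have hlim : Tendsto (fun R => √lam * (R * Real.log (R / ρ))) atTop atTop :=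
    (tendsto_id.atTop_mul_atTop₀ (Real.tendsto_log_atTop.comp
      (tendsto_id.atTop_div_const hρ))).const_mul_atTop (Real.sqrt_pos.2 hlam)
  exact ((eventually_gt_atTop ρ).and (hlim.eventually_gt_atTop M)).exists

theorem barrierRadius_mem_closure (hlam : 0 < lam) (hM : 0 < M) (hρ : 0 < ρ) :
    barrierRadius lam ρ M ∈ closure {R | ρ < R ∧ M < √lam * (R * Real.log (R / ρ))} := by
  rw [barrierRadius_eq_sInf hlam hM hρ]
  exact csInf_mem_closure (exists_lt_sqrt_mul_log hlam hρ M) ⟨ρ, fun R hR => hR.1.le⟩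

theorem le_barrierRadius (hlam : 0 < lam) (hM : 0 < M) (hρ : 0 < ρ) : ρ ≤ barrierRadius lam ρ M :=
  closure_minimal (fun _ hR => hR.1.le) isClosed_Ici (barrierRadius_mem_closure hlam hM hρ)

theorem le_sqrt_mul_log_barrierRadius (hlam : 0 < lam) (hM : 0 < M) (hρ : 0 < ρ) :
    M ≤ √lam * (barrierRadius lam ρ M * Real.log (barrierRadius lam ρ M / ρ)) := by
  have hpos : 0 < barrierRadius lam ρ M := hρ.trans_le (le_barrierRadius hlam hM hρ)
  refine ContinuousWithinAt.closure_le (f := fun _ => M)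
    (g := fun R => √lam * (R * Real.log (R / ρ))) (barrierRadius_mem_closure hlam hM hρ)
    continuousWithinAt_const (ContinuousAt.continuousWithinAt ?_) fun _ hR => hR.2.le
  have : ContinuousAt (fun R => Real.log (R / ρ)) (barrierRadius lam ρ M) :=
    ContinuousAt.log (by fun_prop) (div_pos hpos hρ).ne'
  fun_prop

theorem lt_barrierRadius (hlam : 0 < lam) (hM : 0 < M) (hρ : 0 < ρ) :
    ρ < barrierRadius lam ρ M := by
  refine (le_barrierRadius hlam hM hρ).lt_of_ne fun heq => ?_
  have := le_sqrt_mul_log_barrierRadius hlam hM hρ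
  rw [← heq, div_self hρ.ne', Real.log_one, mul_zero, mul_zero] at this
  exact this.not_gt hM

theorem barrier_eq_max_logProfile (hM : 0 ≤ M) (hρ : 0 < ρ) (hR : ρ < barrierRadius lam ρ M)
    (hx : x ≠ 0) :
    barrier lam ρ M x = max (logProfile 0 (M / Real.log (barrierRadius lam ρ M / ρ))
      (barrierRadius lam ρ M) x) 0 := by
  have hR0 : 0 < barrierRadius lam ρ M := hρ.trans hR
  rw [barrier, logProfile, sub_zero, mul_max_of_nonneg _ _ hM, mul_zero,
    Real.log_div (norm_ne_zero_iff.2 hx) hR0.ne', ← inv_div _ ρ, Real.log_inv, div_neg, ← neg_div,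
    neg_sub, mul_div_assoc', div_mul_eq_mul_div]

theorem admissible_barrier (hD_open : IsOpen D) (hD_conn : IsConnected D)
    (hD_zero : (0 : Plane) ∈ D) (hlam : 0 < lam) (hf_cont : Continuous f) (hlam_lt : ∀ x, lam < f x)
    (hg_cont : ContinuousOn g (frontier D)) (hg_pos : ∀ x ∈ frontier D, 0 < g x) (hM : 0 < M)
    (hρ : 0 < ρ) (hgh : ∀ x ∈ frontier D, g x ≤ barrier lam ρ M x) :
    Admissible D f g (barrier lam ρ M) lam := by
  have hR : ρ < barrierRadius lam ρ M := lt_barrierRadius hlam hM hρ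
  have hlog : 0 < Real.log (barrierRadius lam ρ M / ρ) := Real.log_pos ((one_lt_div hρ).2 hR)
  refine admissible_of_eq_max_logProfile hD_open hD_conn hD_zero hlam hf_cont hlam_lt hg_cont hg_pos
    hgh (div_pos hM hlog) (hρ.trans hR) ?_
    fun x hx => barrier_eq_max_logProfile hM.le hρ hR fun hx0 => hx (hx0 ▸ hD_zero)
  rw [div_le_iff₀ (hρ.trans hR), div_le_iff₀ hlog, mul_assoc]
  exact le_sqrt_mul_log_barrierRadius hlam hM hρ

end LogBarrier

/-! ### Components of the positivity set -/

theorem frontier_connectedComponentIn_subset {X : Type*} [TopologicalSpace X]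
    [LocallyConnectedSpace X] (W : Set X) (y : X) :
    frontier (connectedComponentIn W y) ⊆ frontier W := by
  refine fun z hz => ⟨closure_mono (connectedComponentIn_subset W y) hz.1, fun hzW => hz.2 ?_⟩
  have hnhds : connectedComponentIn W z ∈ 𝓝 z :=
    connectedComponentIn_mem_nhds (mem_interior_iff_mem_nhds.1 hzW)
  obtain ⟨q, hqz, hqy⟩ := mem_closure_iff_nhds.1 hz.1 _ hnhds
  rw [connectedComponentIn_eq hqy, ← connectedComponentIn_eq hqz]
  exact mem_interior_iff_mem_nhds.2 hnhds

theorem hausdorffMeasure_complex_sphere_lt_top (c : ℂ) (R : ℝ) :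
    Measure.hausdorffMeasure 1 (sphere c |R|) < ⊤ := by
  rw [← image_circleMap_Ioc]
  refine ((lipschitzWith_circleMap c R).hausdorffMeasure_image_le zero_le_one _).trans_lt ?_
  rw [hausdorffMeasure_real]
  exact ENNReal.mul_lt_top (by simp) measure_Ioc_lt_top

theorem hausdorffMeasure_sphere_lt_top (x : Plane) {R : ℝ} (hR : 0 ≤ R) :
    Measure.hausdorffMeasure 1 (sphere x R) < ⊤ := by
  have himage : toPlane '' sphere (toPlane.symm x) |R| = sphere x R := by
    rw [toPlane.image_sphere, toPlane.apply_symm_apply, abs_of_nonneg hR]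
  rw [← himage, toPlane.isometry.hausdorffMeasure_image (Or.inl zero_le_one)]
  exact hausdorffMeasure_complex_sphere_lt_top _ R

section Components

variable {D : Set Plane} {u : Plane → ℝ} {x₀ : Plane} {r : ℝ}

theorem posSet_congr {w : Plane → ℝ} (huw : ∀ x ∉ D, u x = w x) : posSet D u = posSet D w :=
  ext fun x => and_congr_right fun hx => by rw [huw x hx]

theorem sub_smul_mem_ball (hr : 0 < r) {x : Plane} (hx : x ∈ ball (0 : Plane) 1) :
    x₀ - r • x ∈ ball x₀ r := by
  rw [mem_ball_zero_iff] at hx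
  rw [mem_ball, dist_eq_norm, sub_sub_cancel_left, norm_neg, norm_smul, Real.norm_of_nonneg hr.le]
  exact mul_lt_of_lt_one_right hr hx

theorem setOf_normalize_pos_eq (hr : 0 < r) (hrD : Disjoint (ball x₀ r) D) :
    {x ∈ ball (0 : Plane) 1 | 0 < normalize u x₀ r x} =
      ball 0 1 ∩ (fun x => x₀ - r • x) ⁻¹' posSet D u := by
  ext x
  refine and_congr_right fun hx => ?_
  have hxD : x₀ - r • x ∉ D := hrD.notMem_of_mem_left (sub_smul_mem_ball hr hx)
  rw [normalize, div_pos_iff_of_pos_right hr]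
  exact (and_iff_right hxD).symm

theorem frontier_setOf_normalize_pos_subset (hr : 0 < r) (hrD : Disjoint (ball x₀ r) D) :
    frontier {x ∈ ball (0 : Plane) 1 | 0 < normalize u x₀ r x} ⊆
      sphere 0 1 ∪ (fun x => x₀ - r • x) ⁻¹' freeBoundarySet D u := by
  rw [setOf_normalize_pos_eq hr hrD]
  intro z hz
  by_cases hzs : z ∈ sphere (0 : Plane) 1
  · exact Or.inl hzs
  rcases frontier_inter_subset _ _ hz with ⟨hball, -⟩ | ⟨hball, hfr⟩
  · exact absurd (frontier_ball_subset_sphere hball) hzs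
  · have hzb : z ∈ ball (0 : Plane) 1 := (closure_ball_subset_closedBall hball).lt_of_ne hzs
    exact Or.inr ⟨(by fun_prop : Continuous fun x => x₀ - r • x).frontier_preimage_subset _ hfr,
      (hrD.closure_right isOpen_ball).notMem_of_mem_left (sub_smul_mem_ball hr hzb)⟩

theorem antilipschitzWith_sub_smul (hr : 0 < r) (x₀ : Plane) :
    AntilipschitzWith (Real.nnabs r⁻¹) fun x => x₀ - r • x := by
  refine AntilipschitzWith.of_le_mul_dist fun x y => ?_
  rw [dist_sub_left, dist_smul₀, Real.coe_nnabs, abs_inv, Real.norm_eq_abs,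
    inv_mul_cancel_left₀ (abs_pos.2 hr.ne').ne']

theorem hausdorffMeasure_frontier_setOf_normalize_pos_lt_top
    (hfb : Measure.hausdorffMeasure 1 (freeBoundarySet D u) < ⊤) (hr : 0 < r)
    (hrD : Disjoint (ball x₀ r) D) :
    Measure.hausdorffMeasure 1
      (frontier {x ∈ ball (0 : Plane) 1 | 0 < normalize u x₀ r x}) < ⊤ := by
  refine (measure_mono (frontier_setOf_normalize_pos_subset hr hrD)).trans_lt
    (measure_union_lt_top (hausdorffMeasure_sphere_lt_top 0 zero_le_one) ?_)
  refine ((antilipschitzWith_sub_smul hr x₀).hausdorffMeasure_preimage_le zero_le_one _).trans_lt ?_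
  exact ENNReal.mul_lt_top (by simp) hfb

end Components

end FreeBoundary

theorem lemma4p6_general {D : Set Plane} {f g h u : Plane → ℝ} {lam : ℝ}
    (A : FreeBoundary.Admissible D f g h lam)
    (hu : ∀ x ∉ D, u x = FreeBoundary.largestSubsolution D f g h x) {x₀ : Plane} {r : ℝ}
    (hr : 0 < r) (hrD : Disjoint (ball x₀ r) D) :
    Measure.hausdorffMeasure 1
      (frontier {x ∈ ball (0 : Plane) 1 | 0 < FreeBoundary.normalize u x₀ r x}) < ⊤ := by
  refine FreeBoundary.hausdorffMeasure_frontier_setOf_normalize_pos_lt_top ?_ hr hrD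
  rw [FreeBoundary.freeBoundarySet, FreeBoundary.posSet_congr hu]
  exact A.hausdorffMeasure_freeBoundarySet_lt_top

theorem lemma4p6
    (D : Set Plane) (hD_open : IsOpen D) (hD_conn : IsConnected D)
    (hD_zero : (0 : Plane) ∈ D)
    (f g : Plane → ℝ) (lam Lam : ℝ) (hlam : 0 < lam)
    (hf_cont : Continuous f) (hf_bound : ∀ x, lam < f x ∧ f x < Lam)
    (hg_cont : ContinuousOn g (frontier D)) (hg_pos : ∀ x ∈ frontier D, 0 < g x)
    (ρ M : ℝ) (hM : 0 < M) (hDρ : D ⊆ ball (0 : Plane) ρ)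
    (hgM : ∀ x ∈ frontier D, g x ≤ FreeBoundary.barrier lam ρ M x)
    (u : Plane → ℝ)
    (hu : ∀ x ∉ D, u x =
      FreeBoundary.largestSubsolution D f g (FreeBoundary.barrier lam ρ M) x)
    (x₀ : Plane) (hx₀ : x₀ ∈ frontier (FreeBoundary.posSet D u))
    (r : ℝ) (hr : 0 < r) (hrD : Disjoint (ball x₀ r) D)
    (Γ : Set Plane)
    (hΓ : ∃ y ∈ {x ∈ ball (0 : Plane) 1 | 0 < FreeBoundary.normalize u x₀ r x},
      Γ = connectedComponentIn
        {x ∈ ball (0 : Plane) 1 | 0 < FreeBoundary.normalize u x₀ r x} y) :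
    Measure.hausdorffMeasure 1 (frontier Γ) < ⊤ := by
  obtain ⟨y, -, rfl⟩ := hΓ
  refine (measure_mono (FreeBoundary.frontier_connectedComponentIn_subset _ y)).trans_lt ?_
  exact lemma4p6_general (FreeBoundary.admissible_barrier hD_open hD_conn hD_zero hlam hf_cont
    (fun x => (hf_bound x).1) hg_cont hg_pos hM (pos_of_mem_ball (hDρ hD_zero)) hgM) hu hr hrD
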